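/- Let $\mathrm M$ be a loopless matroid on a finite ground set $E$, with lattice of flats $\mathcal L$ (least element $\hat 0=\varnothing$). Let $\mathcal G\subseteq\mathcal L\setminus\{\hat 0\}$ be a building set: for every flat $F\neq\hat 0$, if $G_1,\dots,G_k$ are the maximal elements of $\mathcal G_{\leqslant F}$, the join map $\prod_i[\hat 0,G_i]\to[\hat 0,F]$ is an isomorphism of posets. Let $\vartriangleleft$ be a total order on $E$ for which $(\mathrm M,\mathcal G)$ is complete, i.e. for every flat $F$ and every $G\in\mathcal G$ with $F\subseteq G$, writing $G\setminus F=\{e_1\vartriangleleft\cdots\vartriangleleft e_k\}$, each flat $\operatorname{cl}(F\cup\{e_1,\dots,e_i\})$, $1\leqslant i\leqslant k$, has the form $F\vee H$ with $H\in\mathcal G$, $H\subseteq G$. A subset $\mathcal S\subseteq\mathcal G$ is nested if no antichain contained in $\mathcal S$ with at least two elements has its join in $\mathcal G$. Let $\mathcal S$ be an inclusion-maximal nested subset of $\mathcal G$ (so $\mathcal S$ contains the maximal elements of $\mathcal G$). For $G\in\mathcal S$ put $J^G=\bigvee\{H\in\mathcal S: H<G\}$ and $\lambda_{\mathcal S}(G)=\min_{\vartriangleleft}\{e\in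 E: J^G\vee e=G\}$. If $G$ is not maximal in $\mathcal S$, its parent $p(G)$ is the least element of $\{H\in\mathcal S:H>G\}$, and $G$ is a child of $p(G)$. A descent of $\mathcal S$ is a non-maximal $G\in\mathcal S$ with $\lambda_{\mathcal S}(G)\vartriangleright\lambda_{\mathcal S}(p(G))$, and $\mathrm{des}(\mathcal S)$ is the number of descents. A bottom descent is a descent that is minimal in $\mathcal S$; a double descent is a descent that is not minimal in $\mathcal S$ and all of whose children are descents. $\mathcal S$ is stable if it has no bottom descents and no double descents; let $\mathcal N^{\max}_{\mathrm{stable}}$ be the set of stable maximal nested sets. Let $$\mathrm{CH}(\mathrm M,\mathcal G)=\mathbb Q[x_G:G\in\mathcal G]\Big/\Big(\prod_{G\in\mathcal S}x_G\ (\mathcal S\subseteq\mathcal G\text{ not nested}),\ \sum_{G\in\mathcal G,\,e\in G}x_G\ (e\in E)\Big)$$ be the Chow ring of $(\mathrm M,\mathcal G)$, graded by degree, and let $\mathrm H(t)=\sum_k\dim_{\mathbb Q}\mathrm{CH}^k(\mathrm M,\mathcal G)\,t^k$ be its Hilbert–Poincaré series. Then $\mathrm H(t)$ is a palindromic polynomial,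 and with $d=\deg \mathrm H$ it has a unique expansion $\mathrm H(t)=\sum_{i=0}^{\lfloor d/2\rfloor}\gamma_i\,t^i(1+t)^{d-2i}$. Its $\gamma$-polynomial $\gamma(t)=\sum_i\gamma_it^i$ is $$\gamma(t)=\sum_{\mathcal S\in\mathcal N^{\max}_{\mathrm{stable}}}t^{\mathrm{des}(\mathcal S)}.$$ In particular $\mathrm H(t)$ is $\gamma$-positive, i.e. $\gamma_i\geqslant 0$ for all $i$. -/

import Mathlib

open Polynomial

noncomputable section

namespace BuiltMatroid

/-! ### Building sets

Flats of `M : Matroid α` are sets `F : Set α` with `M.IsFlat F`, ordered by inclusion. The least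
flat is `M.closure ∅` (it is `∅` when `M` is loopless), the greatest is `M.E`, and the join of a
family of flats is the closure of its union. -/

/-- The interval `[0̂, F]` of the lattice of flats of `M`, ordered by inclusion. -/
abbrev Below {α : Type*} (M : Matroid α) (F : Set α) : Type _ :=
  {H : Set α // M.IsFlat H ∧ H ⊆ F}

/-- The `𝒢`-factors of `F`: the maximal elements of `𝒢_{≤ F}`. -/
def factors {α : Type*} (𝒢 : Finset (Set α)) (F : Set α) : Set (Set α) :=
  {G | Maximal (fun G' => G' ∈ 𝒢 ∧ G' ⊆ F) G}

/-- `𝒢` is a building set of the lattice of flats of `M`: a set of flats different from `0̂` such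
that for every flat `F ≠ 0̂` the join map `∏_{G ∈ factors 𝒢 F} [0̂, G] → [0̂, F]` is an isomorphism
of posets. -/
structure IsBuildingSet {α : Type*} (M : Matroid α) (𝒢 : Finset (Set α)) : Prop where
  isFlat : ∀ G ∈ 𝒢, M.IsFlat G
  ne_bot : ∀ G ∈ 𝒢, G ≠ M.closure ∅
  join_iso : ∀ F : Set α, M.IsFlat F → F ≠ M.closure ∅ →
    ∃ ψ : (∀ G : factors 𝒢 F, Below M (G : Set α)) ≃o Below M F,
      ∀ H : ∀ G : factors 𝒢 F, Below M (G : Set α),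
        (ψ H : Set α) = M.closure (⋃ G, (H G : Set α))

/-! ### Completeness

A total order on the ground set is given by a linear order on the ambient type. -/

/-- The building set `𝒢_F^G` induced on the interval `[F, G]`. -/
def intervalBuildingSet {α : Type*} (M : Matroid α) (𝒢 : Finset (Set α)) (F G : Set α) :
    Set (Set α) :=
  {K | ∃ H ∈ 𝒢, H ⊆ G ∧ K = M.closure (F ∪ H)} \ {F}

/-- The chain from `F` to `G` determined by the order: if `G \ F = {e₁ < ⋯ < e_k}`, it consists of
`F` and the flats `cl (F ∪ {e₁, …, e_i})` for `1 ≤ i ≤ k`. -/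
def orderChain {α : Type*} [LinearOrder α] (M : Matroid α) (F G : Set α) : Set (Set α) :=
  {K | K = F ∨ ∃ e ∈ G \ F, K = M.closure (F ∪ {x | x ∈ G \ F ∧ x ≤ e})}

/-- `(M, 𝒢)` is complete with respect to the given order. -/
def IsComplete {α : Type*} [LinearOrder α] (M : Matroid α) (𝒢 : Finset (Set α)) : Prop :=
  ∀ F : Set α, M.IsFlat F → ∀ G ∈ 𝒢, F ⊆ G →
    orderChain M F G ⊆ intervalBuildingSet M 𝒢 F G ∪ {F}

/-! ### Nested sets -/

/-- `S ⊆ 𝒢` is nested: no antichain in `S` with at least two elements has its join in `𝒢`. -/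
def IsNested {α : Type*} (M : Matroid α) (𝒢 S : Finset (Set α)) : Prop :=
  S ⊆ 𝒢 ∧ ∀ A ⊆ S, IsAntichain (· ⊆ ·) (A : Set (Set α)) → 2 ≤ A.card →
    M.closure (⋃₀ (A : Set (Set α))) ∉ 𝒢

/-- `S` is a maximal nested set (the maximal elements of `𝒢` are allowed as members). -/
def IsMaxNested {α : Type*} (M : Matroid α) (𝒢 S : Finset (Set α)) : Prop :=
  Maximal (IsNested M 𝒢) S

/-- The join `J^G` of all elements of `S` strictly below `G`. -/
def lowerJoin {α : Type*} (M : Matroid α) (S : Finset (Set α)) (G : Set α) : Set α :=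
  M.closure (⋃₀ {H | H ∈ S ∧ H ⊂ G})

/-- `e` is the label `λ_S(G)`: the least `e` in the ground set with `J^G ∨ e = G`. -/
def IsLabel {α : Type*} [LinearOrder α] (M : Matroid α) (S : Finset (Set α)) (G : Set α) (e : α) :
    Prop :=
  IsLeast {x | x ∈ M.E ∧ M.closure (insert x (lowerJoin M S G)) = G} e

/-- `P` is the parent of `G` in `S`: the least element of `S_{> G}`. -/
def IsParent {α : Type*} (S : Finset (Set α)) (G P : Set α) : Prop :=
  IsLeast {H | H ∈ S ∧ G ⊂ H} P

/-- `G` is a descent of `S`: it has a parent, and its label is larger than that of its parent. -/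
def IsDescent {α : Type*} [LinearOrder α] (M : Matroid α) (S : Finset (Set α)) (G : Set α) :
    Prop :=
  G ∈ S ∧ ∃ P, IsParent S G P ∧ ∃ a b, IsLabel M S G a ∧ IsLabel M S P b ∧ b < a

/-- `G` is a bottom descent of `S`: a descent which is minimal in `S`. -/
def IsBottomDescent {α : Type*} [LinearOrder α] (M : Matroid α) (S : Finset (Set α)) (G : Set α) :
    Prop :=
  IsDescent M S G ∧ Minimal (· ∈ S) G

/-- `G` is a double descent of `S`: a descent which is not minimal in `S` and all of whose children
are descents. -/
def IsDoubleDescent {α : Type*} [LinearOrder α] (M : Matroid α) (S : Finset (Set α)) (G : Set α) :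
    Prop :=
  IsDescent M S G ∧ ¬ Minimal (· ∈ S) G ∧ ∀ H ∈ S, IsParent S H G → IsDescent M S H

/-- `S` is a stable maximal nested set. -/
def IsStableMaxNested {α : Type*} [LinearOrder α] (M : Matroid α) (𝒢 S : Finset (Set α)) : Prop :=
  IsMaxNested M 𝒢 S ∧ (∀ G, ¬ IsBottomDescent M S G) ∧ ∀ G, ¬ IsDoubleDescent M S G

open Classical in
/-- The set of all stable maximal nested sets. -/
def stableMaxNested {α : Type*} [LinearOrder α] (M : Matroid α) (𝒢 : Finset (Set α)) :
    Finset (Finset (Set α)) :=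
  𝒢.powerset.filter (IsStableMaxNested M 𝒢)

open Classical in
/-- The number of descents of `S`. -/
def des {α : Type*} [LinearOrder α] (M : Matroid α) (S : Finset (Set α)) : ℕ :=
  (S.filter (IsDescent M S)).card

/-! ### The Chow ring and the Chow polynomial -/

open Classical in
/-- The relations of the Feichtner--Yuzvinsky Chow ring in the polynomial ring with one variable
`x_G` for each `G ∈ 𝒢`: the monomials `∏_{G ∈ S} x_G` for `S ⊆ 𝒢` not nested, and the linear forms
`∑_{G ∋ e} x_G` for `e` in the ground set (equivalently, `∑_{G ≥ a} x_G` for `a` an atom). -/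
def chowIdeal {α : Type*} (M : Matroid α) (𝒢 : Finset (Set α)) : Ideal (MvPolynomial 𝒢 ℚ) :=
  Ideal.span
    ({p | ∃ S : Finset 𝒢, ¬ IsNested M 𝒢 (S.map (Function.Embedding.subtype _)) ∧
        p = ∏ G ∈ S, MvPolynomial.X G} ∪
      {p | ∃ e ∈ M.E, p = ∑ G : 𝒢 with e ∈ G.1, MvPolynomial.X G})

/-- The Chow ring `CH(M, 𝒢)`. -/
abbrev ChowRing {α : Type*} (M : Matroid α) (𝒢 : Finset (Set α)) : Type _ :=
  MvPolynomial 𝒢 ℚ ⧸ chowIdeal M 𝒢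

/-- The degree `k` piece of the Chow ring: the classes of homogeneous polynomials of degree `k`. -/
def chowPiece {α : Type*} (M : Matroid α) (𝒢 : Finset (Set α)) (k : ℕ) :
    Submodule ℚ (ChowRing M 𝒢) :=
  (MvPolynomial.homogeneousSubmodule 𝒢 ℚ k).map
    (Ideal.Quotient.mkₐ ℚ (chowIdeal M 𝒢)).toLinearMap

/-- The Hilbert--Poincaré series of the Chow ring. -/
def chowSeries {α : Type*} (M : Matroid α) (𝒢 : Finset (Set α)) : PowerSeries ℝ :=
  PowerSeries.mk fun k => (Module.finrank ℚ (chowPiece M 𝒢 k) : ℝ)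

/-! ### Gamma expansions -/

/-- `γ` is the `γ`-polynomial of `h`: with `d = deg h`, the polynomial `γ` has degree at most
`⌊d/2⌋` and `h = ∑_{i ≤ d/2} γ_i t^i (1 + t)^{d - 2i}`. -/
def IsGammaExpansion (h γ : ℝ[X]) : Prop :=
  γ.natDegree ≤ h.natDegree / 2 ∧
    h = ∑ i ∈ Finset.range (h.natDegree / 2 + 1),
      C (γ.coeff i) * X ^ i * (1 + X) ^ (h.natDegree - 2 * i)

/-- `h` is `γ`-positive: it is palindromic and its `γ`-polynomial has nonnegative coefficients. -/
def IsGammaPositive (h : ℝ[X]) : Prop :=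
  (∀ i ≤ h.natDegree, h.coeff i = h.coeff (h.natDegree - i)) ∧
    ∃ γ : ℝ[X], IsGammaExpansion h γ ∧ ∀ i, 0 ≤ γ.coeff i

end BuiltMatroid

end

/-! The argument combines a monomial basis of the Chow ring with a partition of the nested sets into
intervals.

Algebra. For a nested set N and G in N, let gap_N(G) be the corank in G of the join of the members
of N strictly below G. The monomials with nested support N and exponents 1 ≤ m_G < gap_N(G) form a
basis (Feichtner and Yuzvinsky), so H(t) is the sum over nested N of ∏_{G ∈ N} (t + ⋯ +
t^{gap_N(G)-1}), which is `chowSeries_eq`. They span because every other monomial can be rewritten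
with monomials of strictly larger total weight, where x_G weighs |G| (`prod_mul_upSum_pow_eq_zero`,
`mon_mem_weightSpan_succ`). They are independent by induction over a sequence of blow-ups: adding a
minimal B to an upper set 𝒰 replaces a ring R/I by a quotient of R[x] by I, J·x and a monic P of
degree d, where J ⊇ I is the ideal of the center and P(0)·J ⊆ I. A polynomial of degree less than d
in these relations has its constant term in I and its other coefficients in J, and the induction
continues with I and with J. The set K records which centers have been restricted to
(`IsRelFamily.blowup`, `coeff_mem_of_mem_sup`, `eq_zero_of_mem_relIdeal`).

Combinatorics. In a maximal nested set every gap is one. If S is maximal nested and N ⊆ S contains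
all descents of S, then labels increase on the way up to G outside N. Hence the join below G in S is
the closure of the join below G in N together with an initial segment of the rest of G
(`lowerJoin_eq`). Initial segments are comparable, so N determines S; completeness provides such an
S for each N, and shows that at most one child of G lies outside N. The nested sets are thus
partitioned into the intervals [Des S, S] (`exists_unique_isMaxNested`).

On one interval, gap_N(G) is 1 unless the only non-descent child C of G is missing from N, and then
it is 1 + gap_N(C). Since t + ⋯ + t^d = t(1 + (t + ⋯ + t^{d-1})), the sum over the interval factors
(`IsChainGap.sum_prod_chainWeight`): G contributes [G is not a descent] + t·[G has a non-descent
child]. The product vanishes unless every descent has a non-descent child, which is stability, and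
otherwise equals t^des (1+t)^(n - 2 des), where n is the rank minus the number of maximal elements
of 𝒢. The completion of ∅ has no descents, so γ_0 ≠ 0 and n is the degree of H; uniqueness of the
expansion is triangularity. -/

noncomputable section

open Classical

set_option linter.unusedSectionVars false

namespace BuiltMatroid

section

variable {α : Type*} {M : Matroid α} {𝒢 : Finset (Set α)}

/-! ### Rank as a natural number -/

/-- The rank of a set, as a natural number. -/
def rk (M : Matroid α) (X : Set α) : ℕ := (M.eRk X).toNat

section Rank
variable [M.Finite]

theorem coe_rk (M : Matroid α) [M.Finite] (X : Set α) : (rk M X : ℕ∞) = M.eRk X :=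
  ENat.natCast_toNat (Matroid.eRk_ne_top_iff.2 (Matroid.isRkFinite_set M X))

theorem rk_mono {X Y : Set α} (h : X ⊆ Y) : rk M X ≤ rk M Y := by
  have := M.eRk_mono h
  rw [← coe_rk, ← coe_rk] at this
  exact_mod_cast this

theorem rk_closure (X : Set α) : rk M (M.closure X) = rk M X := by
  rw [rk, M.eRk_closure_eq, rk]

theorem rk_empty : rk M ∅ = 0 := by simp [rk]

theorem rk_inter_add_rk_union_le (X Y : Set α) :
    rk M (X ∩ Y) + rk M (X ∪ Y) ≤ rk M X + rk M Y := by
  have := M.eRk_inter_add_eRk_union_le X Y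
  simp only [← coe_rk] at this
  exact_mod_cast this

theorem rk_insert {X : Set α} {e : α} (he : e ∈ M.E) (h : e ∉ M.closure X) :
    rk M (insert e X) = rk M X + 1 := by
  have := M.eRk_insert_eq_add_one ⟨he, h⟩
  simp only [← coe_rk] at this
  exact_mod_cast this

theorem closure_eq_of_rk_le {X Y : Set α} (h : X ⊆ Y) (hr : rk M Y ≤ rk M X) :
    M.closure X = M.closure Y := by
  apply Matroid.IsRkFinite.closure_eq_closure_of_subset_of_eRk_ge_eRk
    (Matroid.isRkFinite_set M X) h
  rw [← coe_rk, ← coe_rk]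
  exact_mod_cast hr

/-- Submodularity in the form of diminishing returns. It transports a corank bound over `X` to any
larger set. -/
theorem rk_union_le_of_subset {C X Y : Set α} {k : ℕ} (h : rk M (C ∪ X) ≤ rk M X + k)
    (hXY : X ⊆ Y) : rk M (C ∪ Y) ≤ rk M Y + k := by
  have h1 := rk_inter_add_rk_union_le (M := M) (C ∪ X) Y
  have h2 : rk M X ≤ rk M ((C ∪ X) ∩ Y) := rk_mono (by tauto_set)
  have h3 : C ∪ X ∪ Y = C ∪ Y := by tauto_set
  rw [h3] at h1
  omega

end Rank

theorem closure_empty' [M.Loopless] : M.closure ∅ = ∅ := by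
  rw [M.closure_empty, M.loops_eq_empty]

/-! ### Factors -/

section Factors

theorem exists_factor {F C : Set α} (hC : C ∈ 𝒢) (hCF : C ⊆ F) : ∃ D ∈ factors 𝒢 F, C ⊆ D := by
  obtain ⟨D, hCD, hD⟩ := (𝒢.filter (· ⊆ F)).exists_le_maximal (a := C) (by simp [hC, hCF])
  refine ⟨D, ?_, hCD⟩
  simpa [factors] using hD

variable [M.Loopless] (h𝒢 : IsBuildingSet M 𝒢)
include h𝒢

theorem building_subset_ground {G : Set α} (hG : G ∈ 𝒢) : G ⊆ M.E := (h𝒢.isFlat G hG).subset_ground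

theorem building_nonempty {G : Set α} (hG : G ∈ 𝒢) : G.Nonempty := by
  rw [Set.nonempty_iff_ne_empty]
  have := h𝒢.ne_bot G hG
  rwa [closure_empty'] at this

omit [M.Loopless] h𝒢 in
theorem mem_of_mem_factors {F D : Set α} (hD : D ∈ factors 𝒢 F) : D ∈ 𝒢 ∧ D ⊆ F :=
  Maximal.prop (P := fun G' => G' ∈ 𝒢 ∧ G' ⊆ F) hD

/-- Injectivity of the join map. Two tuples are full outside `D` and have `cl (X ∩ D)`, respectively
`cl (X ∩ D ∪ {e})`, in position `D`; since `e ∈ cl X` they have the same join, so they agree in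
position `D`. The hypothesis `hXF` disappears in `mem_closure_inter`, once the factors are known to
cover `F`. -/
theorem mem_closure_inter_factor {F D X : Set α} (hF : M.IsFlat F) (hD : D ∈ factors 𝒢 F)
    (hX : X ⊆ F) {e : α} (heD : e ∈ D) (he : e ∈ M.closure X) (hXF : X ⊆ ⋃₀ factors 𝒢 F) :
    e ∈ M.closure (X ∩ D) := by
  have hDG := mem_of_mem_factors hD
  have hF0 : F ≠ M.closure ∅ := by
    rw [closure_empty']; exact Set.Nonempty.ne_empty ⟨e, hDG.2 heD⟩
  obtain ⟨ψ, hψ⟩ := h𝒢.join_iso F hF hF0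
  have fl : ∀ G : factors 𝒢 F, M.IsFlat (G : Set α) := fun G =>
    h𝒢.isFlat _ (mem_of_mem_factors G.2).1
  have key : ∀ Y : Set α, Y ⊆ D → Below M D := fun Y hY =>
    ⟨M.closure Y, M.isFlat_closure Y, by
      have := M.closure_subset_closure hY
      rwa [(fl ⟨D, hD⟩).closure] at this⟩
  have cX : M.closure (X ∩ D) ⊆ D := by
    have := M.closure_subset_closure (Set.inter_subset_right (s := X) (t := D))
    rwa [(fl ⟨D, hD⟩).closure] at this
  have cX' : M.closure (insert e (X ∩ D)) ⊆ D := by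
    have := M.closure_subset_closure (X := insert e (X ∩ D)) (Y := D)
      (Set.insert_subset heD Set.inter_subset_right)
    rwa [(fl ⟨D, hD⟩).closure] at this
  let H : ∀ G : factors 𝒢 F, Below M (G : Set α) := fun G =>
    if h : (G : Set α) = D then ⟨M.closure (X ∩ D), M.isFlat_closure _, by rw [h]; exact cX⟩
    else ⟨G, fl G, subset_rfl⟩
  let H' : ∀ G : factors 𝒢 F, Below M (G : Set α) := fun G =>
    if h : (G : Set α) = D then ⟨M.closure (insert e (X ∩ D)), M.isFlat_closure _,
      by rw [h]; exact cX'⟩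
    else ⟨G, fl G, subset_rfl⟩
  have heE : e ∈ M.E := (fl ⟨D, hD⟩).subset_ground heD
  have hXE : X ⊆ M.E := hX.trans hF.subset_ground
  have hHD : (H ⟨D, hD⟩ : Set α) = M.closure (X ∩ D) := by simp [H]
  have hH'D : (H' ⟨D, hD⟩ : Set α) = M.closure (insert e (X ∩ D)) := by simp [H']
  have hHn : ∀ G : factors 𝒢 F, (G : Set α) ≠ D → (H G : Set α) = G ∧ (H' G : Set α) = G := by
    intro G hG
    simp [H, H', hG]
  have hXH : X ⊆ ⋃ G, (H G : Set α) := by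
    intro x hx
    obtain ⟨G, hG, hxG⟩ := hXF hx
    refine Set.mem_iUnion.2 ⟨⟨G, hG⟩, ?_⟩
    by_cases hGD : G = D
    · subst hGD
      rw [hHD]
      exact M.mem_closure_of_mem' ⟨hx, hxG⟩ (hXE hx)
    · rw [(hHn ⟨G, hG⟩ hGD).1]; exact hxG
  have heq : ψ H' = ψ H := by
    apply Subtype.ext
    rw [hψ, hψ]
    apply subset_antisymm
    · rw [← M.closure_closure (⋃ G, (H G : Set α))]
      apply M.closure_subset_closure
      apply Set.iUnion_subset
      intro G
      by_cases hGD : (G : Set α) = D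
      · have : G = ⟨D, hD⟩ := Subtype.ext hGD
        subst this
        rw [hH'D]
        apply M.closure_subset_closure_of_subset_closure
        apply Set.insert_subset
        · exact M.closure_subset_closure hXH he
        · intro x hx
          exact M.mem_closure_of_mem' (hXH hx.1) (hXE hx.1)
      · rw [(hHn G hGD).2]
        intro x hx
        refine M.mem_closure_of_mem' (Set.mem_iUnion.2 ⟨G, ?_⟩) ((fl G).subset_ground hx)
        rw [(hHn G hGD).1]; exact hx
    · apply M.closure_subset_closure
      apply Set.iUnion_mono
      intro G
      by_cases hGD : (G : Set α) = D
      · have : G = ⟨D, hD⟩ := Subtype.ext hGD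
        subst this
        rw [hHD, hH'D]
        exact M.closure_subset_closure (Set.subset_insert _ _)
      · rw [(hHn G hGD).1, (hHn G hGD).2]
  have := congrFun (ψ.injective heq) ⟨D, hD⟩
  rw [← hHD, ← this, hH'D]
  exact M.mem_closure_of_mem' (Set.mem_insert _ _) heE

/-- Surjectivity of the join map. A tuple with join `cl {x}` has a nonempty entry; a point of this
entry is parallel to `x`, so the entry, and with it a factor, contains `x`. -/
theorem subset_sUnion_factors {F : Set α} (hF : M.IsFlat F) : F ⊆ ⋃₀ factors 𝒢 F := by
  intro x hx
  have hF0 : F ≠ M.closure ∅ := by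
    rw [closure_empty']; exact Set.Nonempty.ne_empty ⟨x, hx⟩
  have hxE := hF.subset_ground hx
  have hx1 : M.IsNonloop x := M.isNonloop_of_loopless hxE
  obtain ⟨ψ, hψ⟩ := h𝒢.join_iso F hF hF0
  have hxF : M.closure {x} ⊆ F := by
    have := M.closure_subset_closure (Set.singleton_subset_iff.2 hx)
    rwa [hF.closure] at this
  obtain ⟨H, hH⟩ := ψ.surjective ⟨M.closure {x}, M.isFlat_closure _, hxF⟩
  have h1 : M.closure {x} = M.closure (⋃ G, (H G : Set α)) := by
    rw [← hψ, hH]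
  have h2 : ∃ G, (H G : Set α).Nonempty := by
    by_contra hcon
    push Not at hcon
    have : (⋃ G, (H G : Set α)) = ∅ := by simp [hcon]
    rw [this, closure_empty'] at h1
    have := M.mem_closure_self x
    rw [h1] at this
    exact this
  obtain ⟨G, y, hy⟩ := h2
  have hyE : y ∈ M.E := (H G).2.1.subset_ground hy
  have hyx : y ∈ M.closure {x} := by
    rw [h1]; exact M.mem_closure_of_mem' (Set.mem_iUnion.2 ⟨G, hy⟩) hyE
  have hxy : x ∈ M.closure {y} := by
    have := M.closure_exchange (X := ∅) (e := y) (f := x)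
      ⟨by simpa using hyx, by rw [closure_empty']; simp⟩
    simpa using this.1
  have : M.closure {y} ⊆ H G := by
    have := M.closure_subset_closure (Set.singleton_subset_iff.2 hy)
    rwa [(H G).2.1.closure] at this
  exact ⟨G, G.2, (H G).2.2 (this hxy)⟩

/-- Injectivity of the join map again: `cl {x}` is the join of the tuple supported in position `D`
and of the one supported in position `D'`. -/
theorem eq_of_mem_factors {F D D' : Set α} (hF : M.IsFlat F) (hD : D ∈ factors 𝒢 F)
    (hD' : D' ∈ factors 𝒢 F) {x : α} (hx : x ∈ D) (hx' : x ∈ D') : D = D' := by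
  by_contra hne
  have hDG := mem_of_mem_factors hD
  have hF0 : F ≠ M.closure ∅ := by
    rw [closure_empty']; exact Set.Nonempty.ne_empty ⟨x, hDG.2 hx⟩
  obtain ⟨ψ, hψ⟩ := h𝒢.join_iso F hF hF0
  have hxE := hF.subset_ground (hDG.2 hx)
  have fl : ∀ G : factors 𝒢 F, M.IsFlat (G : Set α) := fun G =>
    h𝒢.isFlat _ (mem_of_mem_factors G.2).1
  have clx : ∀ G : factors 𝒢 F, x ∈ (G : Set α) → M.closure {x} ⊆ G := by
    intro G hG
    have := M.closure_subset_closure (Set.singleton_subset_iff.2 hG)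
    rwa [(fl G).closure] at this
  have cle : ∀ G : Set α, M.closure ∅ ⊆ G := fun G => by rw [closure_empty']; exact Set.empty_subset _
  let H : Set α → ∀ G : factors 𝒢 F, Below M (G : Set α) := fun A G =>
    if h : (G : Set α) = A ∧ x ∈ (G : Set α) then ⟨M.closure {x}, M.isFlat_closure _, clx G h.2⟩
    else ⟨M.closure ∅, M.isFlat_closure _, cle _⟩
  have hU : ∀ A (hA : A ∈ factors 𝒢 F), x ∈ A → (⋃ G, (H A G : Set α)) = M.closure {x} := by
    intro A hA hxA
    apply subset_antisymm
    · apply Set.iUnion_subset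
      intro G
      by_cases h : (G : Set α) = A ∧ x ∈ (G : Set α)
      · have : H A G = ⟨M.closure {x}, M.isFlat_closure _, clx G h.2⟩ := dif_pos h
        rw [this]
      · have : H A G = ⟨M.closure ∅, M.isFlat_closure _, cle _⟩ := dif_neg h
        rw [this]
        exact cle _
    · refine Set.subset_iUnion_of_subset ⟨A, hA⟩ ?_
      simp [H, hxA]
  have heq : ψ (H D) = ψ (H D') := by
    apply Subtype.ext
    rw [hψ, hψ, hU D hD hx, hU D' hD' hx']
  have := congrArg Subtype.val (congrFun (ψ.injective heq) ⟨D, hD⟩)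
  simp only [H, hx, hne, dite_false, and_self, dite_true, and_true, closure_empty'] at this
  have h2 := M.mem_closure_self x
  rw [this] at h2
  exact h2

theorem mem_closure_inter {F D X : Set α} (hF : M.IsFlat F) (hD : D ∈ factors 𝒢 F)
    (hX : X ⊆ F) {e : α} (heD : e ∈ D) (he : e ∈ M.closure X) : e ∈ M.closure (X ∩ D) :=
  mem_closure_inter_factor h𝒢 hF hD hX heD he (hX.trans (subset_sUnion_factors h𝒢 hF))

/-- Every element of the building set below `F` that meets a factor is contained in it. -/
theorem subset_factor {F D C : Set α} (hF : M.IsFlat F) (hD : D ∈ factors 𝒢 F) (hC : C ∈ 𝒢)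
    (hCF : C ⊆ F) {x : α} (hxC : x ∈ C) (hxD : x ∈ D) : C ⊆ D := by
  obtain ⟨D', hD', hCD'⟩ := exists_factor hC hCF
  rwa [eq_of_mem_factors h𝒢 hF hD hD' hxD (hCD' hxC)]

variable [M.Finite]

/-- `F` is the direct sum of its factors: by `mem_closure_inter` a dependence in the union of a
basis of `X` and a basis of `Y` is already a dependence inside one factor, hence inside one of the
two bases. -/
theorem rk_union_of_factor {F D X Y : Set α} (hF : M.IsFlat F) (hD : D ∈ factors 𝒢 F)
    (hX : X ⊆ D) (hY : Y ⊆ F \ D) : rk M (X ∪ Y) = rk M X + rk M Y := by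
  have hDF := (mem_of_mem_factors hD).2
  have hFE := hF.subset_ground
  have hXE : X ⊆ M.E := (hX.trans hDF).trans hFE
  have hYE : Y ⊆ M.E := (hY.trans Set.sdiff_subset).trans hFE
  obtain ⟨I, hI⟩ := M.exists_isBasis X
  obtain ⟨J, hJ⟩ := M.exists_isBasis Y
  have hID : I ⊆ D := hI.subset.trans hX
  have hJD : J ⊆ F \ D := hJ.subset.trans hY
  have hind : M.Indep (I ∪ J) := by
    rw [Matroid.indep_iff_forall_notMem_closure_sdiff
      (Set.union_subset (hI.subset.trans hXE) (hJ.subset.trans hYE))]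
    intro e he hcl
    have hsub : (I ∪ J) \ {e} ⊆ F :=
      Set.sdiff_subset.trans (Set.union_subset (hID.trans hDF) (hJD.trans Set.sdiff_subset))
    rcases he with he | he
    · have := mem_closure_inter h𝒢 hF hD hsub (hID he) hcl
      refine hI.indep.notMem_closure_sdiff_of_mem he (M.closure_subset_closure ?_ this)
      rintro x ⟨⟨hx | hx, hxe⟩, hxD⟩
      · exact ⟨hx, hxe⟩
      · exact absurd hxD (hJD hx).2
    · obtain ⟨D', hD', heD'⟩ := subset_sUnion_factors h𝒢 hF (hJD he).1
      have := mem_closure_inter h𝒢 hF hD' hsub heD' hcl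
      refine hJ.indep.notMem_closure_sdiff_of_mem he (M.closure_subset_closure ?_ this)
      rintro x ⟨⟨hx | hx, hxe⟩, hxD⟩
      · have := eq_of_mem_factors h𝒢 hF hD hD' (hID hx) hxD
        exact absurd (this ▸ heD') (hJD he).2
      · exact ⟨hx, hxe⟩
  have hbas : M.IsBasis (I ∪ J) (X ∪ Y) := hind.isBasis_of_subset_of_subset_closure
    (Set.union_subset_union hI.subset hJ.subset)
    (Set.union_subset (hI.subset_closure.trans (M.closure_subset_closure Set.subset_union_left))
      (hJ.subset_closure.trans (M.closure_subset_closure Set.subset_union_right)))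
  have hdis : Disjoint I J := by
    rw [Set.disjoint_left]; intro x hx hxJ; exact (hJD hxJ).2 (hID hx)
  have := hbas.encard_eq_eRk
  rw [Set.encard_union_eq hdis, hI.encard_eq_eRk, hJ.encard_eq_eRk] at this
  simp only [← coe_rk] at this
  exact_mod_cast this.symm

theorem rk_add_of_factor {F D C X : Set α} (hF : M.IsFlat F) (hD : D ∈ factors 𝒢 F)
    (hC : C ⊆ D) (hX : X ⊆ F) :
    rk M (C ∪ X) = rk M (C ∪ (X ∩ D)) + rk M (X \ D) := by
  rw [← rk_union_of_factor h𝒢 hF hD (X := C ∪ (X ∩ D)) (Y := X \ D)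
    (Set.union_subset hC Set.inter_subset_right) (Set.sdiff_subset_sdiff_left hX)]
  congr 1
  tauto_set

theorem rk_eq_of_factor {F D X : Set α} (hF : M.IsFlat F) (hD : D ∈ factors 𝒢 F)
    (hX : X ⊆ F) : rk M X = rk M (X ∩ D) + rk M (X \ D) := by
  have := rk_add_of_factor h𝒢 hF hD (Set.empty_subset D) hX
  simpa using this

/-- A factor is a modular element below `F`, so submodularity is an equality here. The exact
computations of gaps rest on this. -/
theorem rk_factor_union_add {F D X : Set α} (hF : M.IsFlat F) (hD : D ∈ factors 𝒢 F)
    (hX : X ⊆ F) : rk M (D ∪ X) + rk M (X ∩ D) = rk M D + rk M X := by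
  have h1 := rk_add_of_factor h𝒢 hF hD subset_rfl hX
  have h2 := rk_eq_of_factor h𝒢 hF hD hX
  have h3 : D ∪ (X ∩ D) = D := by tauto_set
  rw [h3] at h1
  omega

theorem rk_inter_factor_le {F D C X : Set α} (hF : M.IsFlat F) (hD : D ∈ factors 𝒢 F)
    (hC : C ⊆ D) (hX : X ⊆ F) {k : ℕ} (h : rk M (C ∪ X) ≤ rk M X + k) :
    rk M (C ∪ (X ∩ D)) ≤ rk M (X ∩ D) + k := by
  have h1 := rk_add_of_factor h𝒢 hF hD hC hX
  have h2 := rk_eq_of_factor h𝒢 hF hD hX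
  omega

end Factors

/-! ### Nested sets -/

section Nested
variable [M.Loopless] (h𝒢 : IsBuildingSet M 𝒢)
include h𝒢

/-- The factor of the join that contains `G₁` meets `G₂`, hence contains both and is the whole join.
-/
theorem closure_union_mem {G₁ G₂ : Set α} (h₁ : G₁ ∈ 𝒢) (h₂ : G₂ ∈ 𝒢) {x : α} (hx₁ : x ∈ G₁)
    (hx₂ : x ∈ G₂) : M.closure (G₁ ∪ G₂) ∈ 𝒢 := by
  have e₁ := building_subset_ground h𝒢 h₁
  have e₂ := building_subset_ground h𝒢 h₂
  have hW := M.isFlat_closure (G₁ ∪ G₂)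
  have hs := M.subset_closure (G₁ ∪ G₂) (Set.union_subset e₁ e₂)
  obtain ⟨D, hD, h1D⟩ := exists_factor h₁ (Set.subset_union_left.trans hs)
  have h2D := subset_factor h𝒢 hW hD h₂ (Set.subset_union_right.trans hs) hx₂ (h1D hx₁)
  have hDG := mem_of_mem_factors hD
  have : M.closure (G₁ ∪ G₂) = D := by
    apply subset_antisymm _ hDG.2
    have := M.closure_subset_closure (Set.union_subset h1D h2D)
    rwa [(h𝒢.isFlat D hDG.1).closure] at this
  rw [this]; exact hDG.1

theorem sUnion_subset_ground {T : Set (Set α)} (hT : T ⊆ 𝒢) : ⋃₀ T ⊆ M.E :=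
  Set.sUnion_subset fun _ ht => building_subset_ground h𝒢 (hT ht)

omit [M.Loopless] h𝒢 in
theorem IsNested.mono {N S : Finset (Set α)} (hS : IsNested M 𝒢 S) (h : N ⊆ S) :
    IsNested M 𝒢 N :=
  ⟨h.trans hS.1, fun A hA => hS.2 A (hA.trans h)⟩

/-- The working form of nestedness. Let `D` be the factor of the join of `T` that contains `C`. The
maximal members of `T` inside `D` form an antichain, and by `mem_closure_inter` their join is `D ∈
𝒢`. So there is only one of them, and it equals `D`. -/
theorem IsNested.exists_subset {N : Finset (Set α)} (hN : IsNested M 𝒢 N) {T : Set (Set α)}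
    (hT : T ⊆ N) {C : Set α} (hC : C ∈ 𝒢) (h : C ⊆ M.closure (⋃₀ T)) : ∃ n ∈ T, C ⊆ n := by
  have hTG : T ⊆ 𝒢 := hT.trans (by exact_mod_cast hN.1)
  have hTE := sUnion_subset_ground h𝒢 hTG
  have hW := M.isFlat_closure (⋃₀ T)
  obtain ⟨D, hD, hCD⟩ := exists_factor hC h
  have hDG := mem_of_mem_factors hD
  let T' : Finset (Set α) := N.filter (fun n => n ∈ T ∧ n ⊆ D)
  let A : Finset (Set α) := T'.filter (fun n => Maximal (· ∈ T') n)
  have hA : ∀ n ∈ T', ∃ a ∈ A, n ⊆ a := by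
    intro n hn
    obtain ⟨a, hna, ha⟩ := T'.exists_le_maximal hn
    exact ⟨a, by simp only [A, Finset.mem_filter]; exact ⟨ha.prop, ha⟩, hna⟩
  have hDA : D ⊆ M.closure (⋃₀ (A : Set (Set α))) := by
    intro x hx
    have hx1 := mem_closure_inter h𝒢 hW hD (M.subset_closure _ hTE) hx (hDG.2 hx)
    refine M.closure_subset_closure ?_ hx1
    rintro y ⟨⟨t, ht, hyt⟩, hyD⟩
    have htD : t ⊆ D := subset_factor h𝒢 hW hD (hTG ht)
      ((Set.subset_sUnion_of_mem ht).trans (M.subset_closure _ hTE)) hyt hyD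
    obtain ⟨a, ha, hta⟩ := hA t (by simp only [T', Finset.mem_filter]; exact ⟨hT ht, ht, htD⟩)
    exact ⟨a, ha, hta hyt⟩
  have hAsub : ∀ a ∈ A, a ∈ N ∧ a ∈ T ∧ a ⊆ D := by
    intro a ha
    simp only [A, T', Finset.mem_filter] at ha
    exact ⟨ha.1.1, ha.1.2.1, ha.1.2.2⟩
  have hAD : M.closure (⋃₀ (A : Set (Set α))) = D := by
    apply subset_antisymm _ hDA
    have := M.closure_subset_closure (X := ⋃₀ (A : Set (Set α))) (Y := D)
      (Set.sUnion_subset fun a ha => (hAsub a ha).2.2)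
    rwa [(h𝒢.isFlat D hDG.1).closure] at this
  have hanti : IsAntichain (· ⊆ ·) (A : Set (Set α)) := by
    intro a ha b hb hab hsub
    have ha' : a ∈ A := ha
    have hb' : b ∈ A := hb
    simp only [A, Finset.mem_filter] at ha' hb'
    exact hab (subset_antisymm hsub (ha'.2.2 hb'.1 hsub))
  have hcard : ¬ 2 ≤ A.card := fun h2 =>
    hN.2 A (fun a ha => (hAsub a ha).1) hanti h2 (hAD ▸ hDG.1)
  have hne : A.Nonempty := by
    rw [Finset.nonempty_iff_ne_empty]
    rintro h0
    rw [h0] at hAD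
    simp only [Finset.coe_empty, Set.sUnion_empty] at hAD
    exact h𝒢.ne_bot D hDG.1 hAD.symm
  have h1 : A.card = 1 := by have := hne.card_pos; omega
  obtain ⟨a, ha⟩ := Finset.card_eq_one.1 h1
  have haA : a ∈ A := by simp [ha]
  have : a = D := by
    rw [ha] at hAD
    simp only [Finset.coe_singleton, Set.sUnion_singleton] at hAD
    rwa [(h𝒢.isFlat a (hTG (hAsub a haA).2.1)).closure] at hAD
  exact ⟨a, (hAsub a haA).2.1, this ▸ hCD⟩

theorem IsNested.closure_mem {N : Finset (Set α)} (hN : IsNested M 𝒢 N) {T : Set (Set α)}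
    (hT : T ⊆ N) (h : M.closure (⋃₀ T) ∈ 𝒢) : M.closure (⋃₀ T) ∈ T := by
  obtain ⟨n, hn, hs⟩ := hN.exists_subset h𝒢 hT h subset_rfl
  have hTE := sUnion_subset_ground h𝒢 (hT.trans (by exact_mod_cast hN.1))
  rwa [subset_antisymm hs ((Set.subset_sUnion_of_mem hn).trans (M.subset_closure _ hTE))]

-- Converse of `IsNested.closure_mem`. Together they characterize nested sets without mentioning
-- antichains or cardinalities.
omit [M.Loopless] in
theorem isNested_of_closure_mem {N : Finset (Set α)} (hN : N ⊆ 𝒢)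
    (h : ∀ T : Set (Set α), T ⊆ N → M.closure (⋃₀ T) ∈ 𝒢 → M.closure (⋃₀ T) ∈ T) :
    IsNested M 𝒢 N := by
  refine ⟨hN, fun A hA hanti h2 hmem => ?_⟩
  have hj := h A (by exact_mod_cast hA) hmem
  obtain ⟨a, ha, b, hb, hab⟩ := Finset.one_lt_card.1 (show 1 < A.card by omega)
  have hAE : ⋃₀ (A : Set (Set α)) ⊆ M.E :=
    Set.sUnion_subset fun t ht => (h𝒢.isFlat t (hN (hA ht))).subset_ground
  have hall : ∀ t ∈ A, t = M.closure (⋃₀ (A : Set (Set α))) := fun t ht => by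
    by_contra hne
    exact hanti ht hj hne ((Set.subset_sUnion_of_mem (Finset.mem_coe.2 ht)).trans
      (M.subset_closure _ hAE))
  exact hab ((hall a ha).trans (hall b hb).symm)

theorem IsNested.subset_or_subset {N : Finset (Set α)} (hN : IsNested M 𝒢 N) {G₁ G₂ : Set α}
    (h₁ : G₁ ∈ N) (h₂ : G₂ ∈ N) {x : α} (hx₁ : x ∈ G₁) (hx₂ : x ∈ G₂) : G₁ ⊆ G₂ ∨ G₂ ⊆ G₁ := by
  have h := closure_union_mem h𝒢 (hN.1 h₁) (hN.1 h₂) hx₁ hx₂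
  have e₁ := building_subset_ground h𝒢 (hN.1 h₁)
  have e₂ := building_subset_ground h𝒢 (hN.1 h₂)
  have hs := M.subset_closure (G₁ ∪ G₂) (Set.union_subset e₁ e₂)
  rw [← Set.sUnion_pair] at h hs
  have := hN.closure_mem h𝒢 (T := {G₁, G₂}) (by
    intro t ht; rcases ht with rfl | rfl <;> assumption) h
  rcases this with h' | h'
  · rw [h'] at hs; right; exact (Set.subset_sUnion_of_mem (by simp)).trans hs
  · rw [Set.mem_singleton_iff.1 h'] at hs
    left; exact (Set.subset_sUnion_of_mem (by simp)).trans hs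

theorem not_isNested_iff {N : Finset (Set α)} (hN : N ⊆ 𝒢) :
    ¬ IsNested M 𝒢 N ↔ ∃ T : Finset (Set α), T ⊆ N ∧ IsAntichain (· ⊆ ·) (T : Set (Set α)) ∧
      M.closure (⋃₀ (T : Set (Set α))) ∈ 𝒢 ∧ M.closure (⋃₀ (T : Set (Set α))) ∉ T := by
  constructor
  · intro h
    simp only [IsNested, hN, true_and, not_forall, not_not] at h
    obtain ⟨T, hT, hanti, h2, hmem⟩ := h
    refine ⟨T, hT, hanti, hmem, fun hj => ?_⟩
    obtain ⟨a, ha, b, hb, hab⟩ := Finset.one_lt_card.1 (show 1 < T.card by omega)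
    have hTE : ⋃₀ (T : Set (Set α)) ⊆ M.E := sUnion_subset_ground h𝒢 (by exact_mod_cast hT.trans hN)
    have hall : ∀ t ∈ T, t = M.closure (⋃₀ (T : Set (Set α))) := fun t ht => by
      by_contra hne
      exact hanti ht hj hne ((Set.subset_sUnion_of_mem (Finset.mem_coe.2 ht)).trans
        (M.subset_closure _ hTE))
    exact hab ((hall a ha).trans (hall b hb).symm)
  · rintro ⟨T, hT, -, hmem, hj⟩ hnest
    exact hj (by exact_mod_cast hnest.closure_mem h𝒢 (by exact_mod_cast hT) hmem)

theorem closure_singleton_mem {x : α} (hx : x ∈ M.E) : M.closure {x} ∈ 𝒢 := by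
  obtain ⟨D, hD, hxD⟩ := subset_sUnion_factors h𝒢 (M.isFlat_closure {x}) (M.mem_closure_self x)
  have hDG := mem_of_mem_factors hD
  have : M.closure {x} = D := by
    apply subset_antisymm _ hDG.2
    have := M.closure_subset_closure (Set.singleton_subset_iff.2 hxD)
    rwa [(h𝒢.isFlat D hDG.1).closure] at this
  rw [this]; exact hDG.1

/-- A point of the join of a nested set lies in one of its members. -/
theorem IsNested.mem_sUnion {N : Finset (Set α)} (hN : IsNested M 𝒢 N) {T : Set (Set α)}
    (hT : T ⊆ N) {x : α} (hx : x ∈ M.closure (⋃₀ T)) : ∃ n ∈ T, x ∈ n := by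
  have hxE := M.closure_subset_ground _ hx
  obtain ⟨n, hn, h⟩ := hN.exists_subset h𝒢 hT (closure_singleton_mem h𝒢 hxE) (by
    have := M.closure_subset_closure (Set.singleton_subset_iff.2 hx)
    rwa [M.closure_closure] at this)
  exact ⟨n, hn, h (M.mem_closure_self x)⟩

end Nested
end

section

variable {α : Type*} {M : Matroid α} {𝒢 : Finset (Set α)}

/-! ### Standard monomials -/

/-- The corank in `G` of the join of the members of `N` strictly below `G`. -/
def gap (M : Matroid α) (N : Finset (Set α)) (G : Set α) : ℕ :=
  rk M G - rk M (⋃₀ {H | H ∈ N ∧ H ⊂ G})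

/-- The exponent vectors of the standard monomials in the variables `x_G`, `G ∈ 𝒰`, relative to a
set `K` of flats. -/
structure IsStandard (M : Matroid α) (𝒢 𝒰 K : Finset (Set α)) (m : Set α →₀ ℕ) : Prop where
  support_subset : m.support ⊆ 𝒰
  isNested : IsNested M 𝒢 (m.support ∪ K)
  lt_gap : ∀ G ∈ m.support, m G < gap M (m.support ∪ K) G

section Sums
variable {R : Type*} [CommRing R]

/-- The sum of the variables indexed by the members of `𝒰` containing `B`. -/
def upSum (𝒰 : Finset (Set α)) (x : Set α → R) (B : Set α) : R := ∑ G ∈ 𝒰 with B ⊆ G, x G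

theorem mul_sum_filter_congr {ι : Type*} (s : Finset ι) (x : ι → R) {p q : ι → Prop}
    (hqp : ∀ i ∈ s, q i → p i) {y : R} (h : ∀ i ∈ s, p i → ¬ q i → y * x i = 0) :
    y * ∑ i ∈ s with p i, x i = y * ∑ i ∈ s with q i, x i := by
  rw [Finset.mul_sum, Finset.mul_sum]
  symm
  apply Finset.sum_subset
  · intro i hi
    simp only [Finset.mem_filter] at hi ⊢
    exact ⟨hi.1, hqp i hi.1 hi.2⟩
  · intro i hi hi'
    simp only [Finset.mem_filter, not_and] at hi hi'
    exact h i hi.1 hi.2 (hi' hi.1)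

theorem mul_upSum_congr {𝒰 : Finset (Set α)} {x : Set α → R} {B D : Set α} (hBD : B ⊆ D) {y : R}
    (h : ∀ G ∈ 𝒰, B ⊆ G → ¬ D ⊆ G → y * x G = 0) :
    y * upSum 𝒰 x B = y * upSum 𝒰 x D :=
  mul_sum_filter_congr 𝒰 x (fun _ _ hG => hBD.trans hG) h

theorem mul_pow_congr {y a b : R} (h : y * a = y * b) (k : ℕ) : y * a ^ k = y * b ^ k := by
  induction k with
  | zero => simp
  | succ k ih => rw [pow_succ, pow_succ, ← mul_assoc, ih, mul_right_comm, h]; ring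

/-- The monomial with exponent vector `m`. -/
def mon (x : Set α → R) (m : Set α →₀ ℕ) : R := m.prod fun G n => x G ^ n

theorem mon_add (x : Set α → R) (m m' : Set α →₀ ℕ) : mon x (m + m') = mon x m * mon x m' :=
  Finsupp.prod_add_index' (fun _ => pow_zero _) fun _ _ _ => pow_add _ _ _

theorem mon_single (x : Set α → R) (G : Set α) (n : ℕ) : mon x (Finsupp.single G n) = x G ^ n :=
  Finsupp.prod_single_index (pow_zero _)

theorem mon_sum_single (x : Set α → R) (A : Finset (Set α)) :
    mon x (∑ G ∈ A, Finsupp.single G 1) = ∏ G ∈ A, x G := by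
  induction A using Finset.induction_on with
  | empty => simp [mon]
  | insert a s ha ih => rw [Finset.sum_insert ha, mon_add, ih, mon_single, Finset.prod_insert ha,
      pow_one]

end Sums

/-! ### Power relations in the Chow ring -/

section Spanning
variable [M.Loopless] [M.Finite] (h𝒢 : IsBuildingSet M 𝒢)
variable {R : Type*} [CommRing R] {x : Set α → R}
  (hx : ∀ S ⊆ 𝒢, ¬ IsNested M 𝒢 S → ∏ G ∈ S, x G = 0)
  (hlin : ∀ e ∈ M.E, ∑ G ∈ 𝒢 with e ∈ G, x G = 0)
include h𝒢 hx hlin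

/-- Induction on the corank bound `k`. If `k = 0`, then `A` has join `B`, so it is not nested.
Otherwise choose `e` in `B` outside the join of `A` and compare one factor `upSum 𝒢 x B` with the
linear relation of `e`. The extra terms are those of `G ∋ e` not above `B`; for them `x G * upSum 𝒢
x B = x G * upSum 𝒢 x (B ∨ G)`, and the induction hypothesis for `insert G A` and `B ∨ G` applies.
-/
theorem prod_mul_upSum_pow_eq_zero (k : ℕ) : ∀ (A : Finset (Set α)) (B : Set α), A ⊆ 𝒢 → B ∈ 𝒢 →
    (∀ a ∈ A, a ⊂ B) → rk M B ≤ rk M (⋃₀ (A : Set (Set α))) + k →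
    (∏ G ∈ A, x G) * upSum 𝒢 x B ^ k = 0 := by
  have key : ∀ (A : Finset (Set α)) (B : Set α), (∀ a ∈ A, a ⊂ B) →
      ⋃₀ (A : Set (Set α)) ⊆ B := fun A B h => Set.sUnion_subset fun a ha => (h a ha).subset
  induction k with
  | zero =>
    intro A B hA hB hAB hr
    rw [pow_zero, mul_one]
    apply hx A hA
    intro hnest
    have hcl := closure_eq_of_rk_le (M := M) (key A B hAB) hr
    rw [(h𝒢.isFlat B hB).closure] at hcl
    obtain ⟨n, hn, hBn⟩ := hnest.exists_subset h𝒢 (T := A) subset_rfl hB hcl.ge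
    exact (hAB n hn).not_subset hBn
  | succ k ih =>
    intro A B hA hB hAB hr
    by_cases hr' : rk M B ≤ rk M (⋃₀ (A : Set (Set α))) + k
    · rw [pow_succ, ← mul_assoc, ih A B hA hB hAB hr', zero_mul]
    have hBE := building_subset_ground h𝒢 hB
    obtain ⟨e, heB, heA⟩ : ∃ e ∈ B, e ∉ M.closure (⋃₀ (A : Set (Set α))) := by
      by_contra hcon
      push Not at hcon
      have := rk_mono (M := M) (show B ⊆ _ from hcon)
      rw [rk_closure] at this
      omega
    rw [pow_succ, ← mul_assoc]
    have : (∏ G ∈ A, x G) * upSum 𝒢 x B ^ k * ∑ G ∈ 𝒢 with e ∈ G, x G =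
        (∏ G ∈ A, x G) * upSum 𝒢 x B ^ k * ∑ G ∈ 𝒢 with B ⊆ G, x G := by
      apply mul_sum_filter_congr 𝒢 x (fun G _ h => h heB)
      intro G hG heG hBG
      have hDG := closure_union_mem h𝒢 hB hG heB heG
      have hGE := building_subset_ground h𝒢 hG
      have hBGs := M.subset_closure (B ∪ G) (Set.union_subset hBE hGE)
      have hBD := Set.subset_union_left.trans hBGs
      have hGD := Set.subset_union_right.trans hBGs
      have h1 : x G * upSum 𝒢 x B = x G * upSum 𝒢 x (M.closure (B ∪ G)) := by
        apply mul_upSum_congr hBD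
        intro G' hG' hBG' hDG'
        have hne : G ≠ G' := fun h => hBG (h ▸ hBG')
        rw [← Finset.prod_pair hne]
        apply hx _ (by intro t ht; simp only [Finset.mem_insert, Finset.mem_singleton] at ht
                       rcases ht with rfl | rfl <;> assumption)
        intro hnest
        rcases hnest.subset_or_subset h𝒢 (G₁ := G) (G₂ := G') (by simp) (by simp) heG (hBG' heB)
          with h | h
        · apply hDG'
          have := M.closure_subset_closure (Set.union_subset hBG' h)
          rwa [(h𝒢.isFlat G' hG').closure] at this
        · exact hBG (hBG'.trans h)
      have hGA : G ∉ A := fun h => heA (M.mem_closure_of_mem' ⟨G, h, heG⟩ (hBE heB))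
      have h2 := ih (insert G A) (M.closure (B ∪ G)) (Finset.insert_subset hG hA) hDG (by
        intro a ha
        rcases Finset.mem_insert.1 ha with rfl | ha
        · exact ⟨hGD, fun h => hBG (hBD.trans h)⟩
        · exact (hAB a ha).trans_subset hBD) (by
        rw [rk_closure]
        -- Adding `e` raises the rank of the join of `A` by one, which pays for the factor that has
        -- been used up; passing from `e` to `G ∋ e` keeps the bound.
        have h3 : rk M (B ∪ insert e (⋃₀ (A : Set (Set α)))) ≤
            rk M (insert e (⋃₀ (A : Set (Set α)))) + k := by
          rw [rk_insert (hBE heB) heA, Set.union_eq_left.2 (Set.insert_subset heB (key A B hAB))]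
          omega
        have h4 := rk_union_le_of_subset h3 (Y := ⋃₀ ((insert G A : Finset (Set α)) : Set (Set α)))
          (by
            rw [Finset.coe_insert, Set.sUnion_insert]
            exact Set.insert_subset (Or.inl heG) Set.subset_union_right)
        refine le_trans (rk_mono ?_) h4
        rw [Finset.coe_insert, Set.sUnion_insert]
        tauto_set)
      rw [Finset.prod_insert hGA] at h2
      calc _ = (∏ G ∈ A, x G) * (x G * upSum 𝒢 x B ^ k) := by ring
        _ = (∏ G ∈ A, x G) * (x G * upSum 𝒢 x (M.closure (B ∪ G)) ^ k) := by
          rw [mul_pow_congr h1]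
        _ = _ := by rw [← h2]; ring
    exact this.symm.trans (by rw [hlin e (hBE heB), mul_zero])

end Spanning

/-! ### Straightening by weight: standard monomials span -/

section Filtration
variable {R : Type*} [CommRing R] [Algebra ℚ R]

/-- The span of the monomials of degree `k` and weight at least `a`, where `x_G` has weight `|G|`. -/
def weightSpan (𝒢 : Finset (Set α)) (x : Set α → R) (k a : ℕ) : Submodule ℚ R :=
  Submodule.span ℚ {y | ∃ m : Set α →₀ ℕ, m.support ⊆ 𝒢 ∧ m.degree = k ∧
    a ≤ Finsupp.weight (fun G : Set α => G.ncard) m ∧ y = mon x m}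

theorem weightSpan_anti {𝒢 : Finset (Set α)} {x : Set α → R} {k a b : ℕ} (h : a ≤ b) :
    weightSpan 𝒢 x k b ≤ weightSpan 𝒢 x k a := by
  apply Submodule.span_mono
  rintro y ⟨m, h1, h2, h3, h4⟩
  exact ⟨m, h1, h2, h.trans h3, h4⟩

theorem mul_mem_weightSpan {𝒢 : Finset (Set α)} {x : Set α → R} {k a : ℕ} {y : R}
    (hy : y ∈ weightSpan 𝒢 x k a) {G : Set α} (hG : G ∈ 𝒢) :
    y * x G ∈ weightSpan 𝒢 x (k + 1) (a + G.ncard) := by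
  induction hy using Submodule.span_induction with
  | mem y hy =>
    obtain ⟨m, h1, h2, h3, rfl⟩ := hy
    apply Submodule.subset_span
    refine ⟨m + Finsupp.single G 1, ?_, ?_, ?_, ?_⟩
    · refine Finsupp.support_add.trans (Finset.union_subset h1 ?_)
      exact Finsupp.support_single_subset.trans (by simpa using hG)
    · simp [h2]
    · simp only [map_add, Finsupp.weight_single, one_smul]
      omega
    · rw [mon_add, mon_single, pow_one]
  | zero => simp
  | add y z _ _ hy hz => rw [add_mul]; exact Submodule.add_mem _ hy hz
  | smul c y _ hy => rw [smul_mul_assoc]; exact Submodule.smul_mem _ _ hy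

/-- Every `G' ⊃ G` has more points than `G`, so `x G` is the term of least weight in `upSum 𝒢 x G`.
-/
theorem pow_upSum_sub_mem {𝒢 : Finset (Set α)} (hfin : ∀ G ∈ 𝒢, G.Finite) {x : Set α → R}
    {k a : ℕ} {y : R} (hy : y ∈ weightSpan 𝒢 x k a) {G : Set α} (hG : G ∈ 𝒢) (j : ℕ) :
    y * x G ^ j ∈ weightSpan 𝒢 x (k + j) (a + j * G.ncard) ∧
    y * upSum 𝒢 x G ^ j - y * x G ^ j ∈ weightSpan 𝒢 x (k + j) (a + j * G.ncard + 1) := by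
  have hup : upSum 𝒢 x G = x G + ∑ G' ∈ 𝒢 with G ⊂ G', x G' := by
    have : 𝒢.filter (fun G' => G ⊆ G') = insert G (𝒢.filter (fun G' => G ⊂ G')) := by
      ext G'
      simp only [Finset.mem_filter, Finset.mem_insert, Set.ssubset_iff_subset_ne]
      constructor
      · rintro ⟨h1, h2⟩
        by_cases h : G' = G
        · exact Or.inl h
        · exact Or.inr ⟨h1, h2, Ne.symm h⟩
      · rintro (rfl | h)
        · exact ⟨hG, subset_rfl⟩
        · exact ⟨h.1, h.2.1⟩
    rw [upSum, this, Finset.sum_insert (by simp)]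
  induction j with
  | zero => simpa using hy
  | succ j ih =>
    obtain ⟨ih1, ih2⟩ := ih
    constructor
    · have := mul_mem_weightSpan ih1 hG
      rw [pow_succ, ← mul_assoc]
      convert this using 1
      ring_nf
    · have e : y * upSum 𝒢 x G ^ (j + 1) - y * x G ^ (j + 1) =
          (y * upSum 𝒢 x G ^ j - y * x G ^ j) * x G +
          ((∑ G' ∈ 𝒢 with G ⊂ G', (y * upSum 𝒢 x G ^ j - y * x G ^ j) * x G') +
          ∑ G' ∈ 𝒢 with G ⊂ G', (y * x G ^ j) * x G') := by
        rw [← Finset.mul_sum, ← Finset.mul_sum, pow_succ, ← mul_assoc]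
        nth_rewrite 2 [hup]
        ring
      rw [e]
      have hdeg : k + (j + 1) = k + j + 1 := by ring
      have hwt : a + (j + 1) * G.ncard + 1 = a + j * G.ncard + 1 + G.ncard := by ring
      rw [hdeg, hwt]
      refine Submodule.add_mem _ (mul_mem_weightSpan ih2 hG) (Submodule.add_mem _
        (Submodule.sum_mem _ fun G' hG' => ?_) (Submodule.sum_mem _ fun G' hG' => ?_))
      · simp only [Finset.mem_filter] at hG'
        have hlt := Set.ncard_lt_ncard hG'.2 (hfin G' hG'.1)
        exact weightSpan_anti (by omega) (mul_mem_weightSpan ih2 hG'.1)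
      · simp only [Finset.mem_filter] at hG'
        have hlt := Set.ncard_lt_ncard hG'.2 (hfin G' hG'.1)
        exact weightSpan_anti (by omega) (mul_mem_weightSpan ih1 hG'.1)

variable [M.Loopless] [M.Finite] (h𝒢 : IsBuildingSet M 𝒢) {x : Set α → R}
  (hx : ∀ S ⊆ 𝒢, ¬ IsNested M 𝒢 S → ∏ G ∈ S, x G = 0)
  (hlin : ∀ e ∈ M.E, ∑ G ∈ 𝒢 with e ∈ G, x G = 0)
include h𝒢 hx hlin

/-- A monomial with non-nested support is zero. Otherwise some exponent `m G` is at least `d = gap`,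
and the monomial is divisible by `x G ^ d` and by each `x H` with `H` in the support below `G`. With
`upSum 𝒢 x G ^ d` in place of `x G ^ d` it vanishes, so it equals the negative of the terms of
larger weight. -/
theorem mon_mem_weightSpan_succ {m : Set α →₀ ℕ} (hm : m.support ⊆ 𝒢)
    (hst : ¬ IsStandard M 𝒢 𝒢 ∅ m) :
    mon x m ∈ weightSpan 𝒢 x m.degree (Finsupp.weight (fun G : Set α => G.ncard) m + 1) := by
  by_cases hnest : IsNested M 𝒢 m.support
  swap
  · have h0 : mon x m = 0 := by
      have hle : ∑ G ∈ m.support, Finsupp.single G 1 ≤ m := by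
        intro H
        rw [Finsupp.finsetSum_apply]
        simp only [Finsupp.single_apply, Finset.sum_ite_eq', Finsupp.mem_support_iff]
        split_ifs <;> omega
      rw [← tsub_add_cancel_of_le hle, mon_add, mon_sum_single, hx _ hm hnest, mul_zero]
    rw [h0]; exact Submodule.zero_mem _
  obtain ⟨G, hG, hgap⟩ : ∃ G ∈ m.support, gap M m.support G ≤ m G := by
    by_contra hcon
    push Not at hcon
    exact hst ⟨hm, by simpa using hnest, by simpa using hcon⟩
  set d := gap M m.support G
  let A : Finset (Set α) := m.support.filter (· ⊂ G)
  let c : Set α →₀ ℕ := ∑ H ∈ A, Finsupp.single H 1 + Finsupp.single G d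
  have hGA : G ∉ A := by simp [A]
  have hle : c ≤ m := by
    intro H
    simp only [c, Finsupp.add_apply]
    rw [Finsupp.finsetSum_apply]
    simp only [Finsupp.single_apply, Finset.sum_ite_eq']
    by_cases hH : G = H
    · subst hH
      simp [hGA, hgap]
    · simp only [hH, if_false, add_zero]
      split_ifs with h
      · have : H ∈ m.support := (Finset.mem_filter.1 h).1
        rw [Finsupp.mem_support_iff] at this
        omega
      · omega
  -- This is `m` with exactly `d` removed at `G`, written so that the divisor `∏ H ∈ A, x H` is
  -- visible.
  set m' := m - c + ∑ H ∈ A, Finsupp.single H 1 with hm'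
  have hmm : m = m' + Finsupp.single G d := by
    rw [hm', add_assoc]; exact (tsub_add_cancel_of_le hle).symm
  have hAS : (A : Set (Set α)) = {H | H ∈ m.support ∧ H ⊂ G} := by ext; simp [A]
  have hzero : mon x m' * upSum 𝒢 x G ^ d = 0 := by
    rw [hm', mon_add, mon_sum_single, mul_assoc,
      prod_mul_upSum_pow_eq_zero h𝒢 hx hlin d A G ((Finset.filter_subset _ _).trans hm) (hm hG)
      (fun a ha => (Finset.mem_filter.1 ha).2), mul_zero]
    rw [hAS]
    simp only [d, gap]
    omega
  have hmem : mon x m' ∈ weightSpan 𝒢 x m'.degree (Finsupp.weight (fun G : Set α => G.ncard) m') := by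
    apply Submodule.subset_span
    refine ⟨m', ?_, rfl, le_rfl, rfl⟩
    intro H hH
    apply hm
    rw [Finsupp.mem_support_iff] at hH ⊢
    rw [hmm, Finsupp.add_apply]
    omega
  have hfin : ∀ G ∈ 𝒢, G.Finite := fun G hG =>
    M.ground_finite.subset (building_subset_ground h𝒢 hG)
  have := (pow_upSum_sub_mem hfin hmem (hm hG) d).2
  rw [hzero, zero_sub, Submodule.neg_mem_iff] at this
  have e : mon x m = mon x m' * x G ^ d := by rw [hmm, mon_add, mon_single]
  rw [e]
  convert this using 2
  · rw [hmm]; simp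
  · rw [hmm, map_add, Finsupp.weight_single, smul_eq_mul]

/-- Straightening terminates because a monomial of degree `k` has weight at most `k * |E|`; `n` is a
bound for the remaining number of steps. -/
theorem weightSpan_le_span_standard (k : ℕ) (n a : ℕ) (hna : k * M.E.ncard < a + n) :
    weightSpan 𝒢 x k a ≤
      Submodule.span ℚ {y | ∃ m, IsStandard M 𝒢 𝒢 ∅ m ∧ m.degree = k ∧ y = mon x m} := by
  induction n generalizing a with
  | zero =>
    apply Submodule.span_le.2
    rintro y ⟨m, h1, h2, h3, rfl⟩
    exfalso
    have : Finsupp.weight (fun G : Set α => G.ncard) m ≤ k * M.E.ncard := by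
      rw [Finsupp.weight_apply, ← h2, Finsupp.degree_apply, Finset.sum_mul]
      apply Finset.sum_le_sum
      intro G hG
      simp only [smul_eq_mul]
      exact Nat.mul_le_mul_left _ (Set.ncard_le_ncard (building_subset_ground h𝒢 (h1 hG))
        M.ground_finite)
    omega
  | succ n ih =>
    apply Submodule.span_le.2
    rintro y ⟨m, h1, h2, h3, rfl⟩
    by_cases hst : IsStandard M 𝒢 𝒢 ∅ m
    · exact Submodule.subset_span ⟨m, hst, h2, rfl⟩
    · have := mon_mem_weightSpan_succ h𝒢 hx hlin h1 hst
      rw [h2] at this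
      exact ih (a + 1) (by omega) (weightSpan_anti (by omega) this)

theorem mon_mem_span_standard {m : Set α →₀ ℕ} (hm : m.support ⊆ 𝒢) :
    mon x m ∈ Submodule.span ℚ
      {y | ∃ m', IsStandard M 𝒢 𝒢 ∅ m' ∧ m'.degree = m.degree ∧ y = mon x m'} :=
  weightSpan_le_span_standard h𝒢 hx hlin m.degree (m.degree * M.E.ncard + 1) 0 (by omega)
    (Submodule.subset_span ⟨m, hm, rfl, Nat.zero_le _, rfl⟩)

end Filtration
end

section

variable {α : Type*} {M : Matroid α} {𝒢 : Finset (Set α)}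

/-! ### Linear independence of the standard monomials -/

/-- The union of a finite family of sets. -/
abbrev sU (S : Finset (Set α)) : Set α := ⋃₀ (S : Set (Set α))

theorem sU_insert (B : Set α) (S : Finset (Set α)) : sU (insert B S) = B ∪ sU S := by
  simp [sU]

theorem sU_mono {S T : Finset (Set α)} (h : S ⊆ T) : sU S ⊆ sU T :=
  Set.sUnion_subset_sUnion (by exact_mod_cast h)

theorem subset_sU {S : Finset (Set α)} {B : Set α} (h : B ∈ S) : B ⊆ sU S :=
  Set.subset_sUnion_of_mem (Finset.mem_coe.2 h)

/-- The elements `x G` satisfy the relations of the intermediate Chow ring in which only the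
elements of `𝒰` have been blown up, restricted to the stratum given by `K`. -/
structure IsRelFamily (M : Matroid α) (𝒢 𝒰 K : Finset (Set α)) {R : Type*} [CommRing R]
    (x : Set α → R) : Prop where
  prod_eq_zero : ∀ S ⊆ 𝒰, ¬ IsNested M 𝒢 (S ∪ K) → ∏ G ∈ S, x G = 0
  prod_mul_pow_eq_zero : ∀ A ⊆ 𝒰, ∀ C ∈ 𝒰, ∀ k, ¬ C ⊆ M.closure (sU (A ∪ K)) →
    rk M (C ∪ sU (A ∪ K)) ≤ rk M (sU (A ∪ K)) + k →
    (∏ G ∈ A, x G) * upSum 𝒰 x C ^ k = 0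

/-- `B` can be added to `𝒰` as a new minimal element, `K` consisting of elements not above any
element of `𝒰 ∪ {B}`. -/
structure IsBlowup (M : Matroid α) (𝒢 𝒰 K : Finset (Set α)) (B : Set α) : Prop where
  subset : 𝒰 ⊆ 𝒢
  upper : ∀ G ∈ 𝒰, ∀ H ∈ 𝒢, G ⊆ H → H ∈ 𝒰
  mem : B ∈ 𝒢
  notMem : B ∉ 𝒰
  upper_of_ssubset : ∀ H ∈ 𝒢, B ⊂ H → H ∈ 𝒰
  subset_K : K ⊆ 𝒢
  not_subset_K : ∀ G ∈ 𝒰, ∀ k ∈ K, ¬ G ⊆ k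
  not_subset_K' : ∀ k ∈ K, ¬ B ⊆ k

/-! ### Behavior of the relations under one blow-up -/

section Relations
variable [M.Loopless] [M.Finite] (h𝒢 : IsBuildingSet M 𝒢)
variable {R : Type*} [CommRing R] {x : Set α → R} {𝒰 K : Finset (Set α)} {B : Set α}

theorem prod_mul_eq_zero_of_insert {S : Finset (Set α)} {G : Set α}
    (h : ∏ H ∈ insert G S, x H = 0) : (∏ H ∈ S, x H) * x G = 0 := by
  by_cases hG : G ∈ S
  · rw [Finset.insert_eq_of_mem hG] at h
    rw [h, zero_mul]
  · rw [Finset.prod_insert hG] at h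
    rw [mul_comm, h]

include h𝒢

theorem sU_subset_ground {S : Finset (Set α)} (hS : S ⊆ 𝒢) : sU S ⊆ M.E :=
  sUnion_subset_ground h𝒢 (by exact_mod_cast hS)

theorem IsNested.exists_subset_of_subset_closure {N : Finset (Set α)} (hN : IsNested M 𝒢 N)
    {C : Set α} (hC : C ∈ 𝒢) (h : C ⊆ M.closure (sU N)) : ∃ n ∈ N, C ⊆ n :=
  hN.exists_subset h𝒢 (T := N) subset_rfl hC h

theorem mem_factors_of_isNested {N : Finset (Set α)} (hN : IsNested M 𝒢 (insert B N))
    (hBN : ∀ n ∈ N, ¬ B ⊆ n) : B ∈ factors 𝒢 (M.closure (sU (insert B N))) := by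
  have hE := sU_subset_ground h𝒢 hN.1
  have hB : B ∈ 𝒢 := hN.1 (Finset.mem_insert_self _ _)
  obtain ⟨D, hD, hBD⟩ := exists_factor (F := M.closure (sU (insert B N))) hB
    ((subset_sU (Finset.mem_insert_self _ _)).trans (M.subset_closure _ hE))
  have hDG := mem_of_mem_factors hD
  obtain ⟨n, hn, hDn⟩ := hN.exists_subset_of_subset_closure h𝒢 hDG.1 hDG.2
  rcases Finset.mem_insert.1 hn with h | hn
  · rwa [← subset_antisymm hBD (h ▸ hDn)] at hD
  · exact absurd (hBD.trans hDn) (hBN n hn)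

/-- If `T` witnesses that `B` is incompatible with `S ∪ K`, then so does `T` with `B` replaced by
any larger `G`, unless `G` is already above the join of `T`. -/
theorem not_isNested_insert_of_bad_join {S T : Finset (Set α)} (hT : T ⊆ insert B (S ∪ K))
    (hD : M.closure (sU T) ∈ 𝒢) (hDT : M.closure (sU T) ∉ T) (hTG : T ⊆ 𝒢)
    {G : Set α} (hBG : B ⊆ G) (hDG : ¬ M.closure (sU T) ⊆ G) :
    ¬ IsNested M 𝒢 (insert G S ∪ K) := by
  intro hnest
  have hTE := sU_subset_ground h𝒢 hTG
  have hsub : (((insert G (T.erase B)) : Finset (Set α)) : Set (Set α)) ⊆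
      ((insert G S ∪ K : Finset (Set α)) : Set (Set α)) := by
    intro t ht
    simp only [Finset.coe_insert, Finset.coe_erase, Set.mem_insert_iff, Set.mem_sdiff,
      Finset.mem_coe, Set.mem_singleton_iff] at ht
    simp only [Finset.coe_union, Finset.coe_insert, Set.mem_union, Set.mem_insert_iff,
      Finset.mem_coe]
    rcases ht with h | ⟨h, h'⟩
    · exact Or.inl (Or.inl h)
    · have := hT h
      simp only [Finset.mem_insert, Finset.mem_union] at this
      tauto
  obtain ⟨n, hn, hDn⟩ := hnest.exists_subset h𝒢 hsub hD (by
    apply M.closure_subset_closure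
    apply Set.sUnion_subset
    intro t ht
    by_cases htB : t = B
    · rw [htB]
      exact hBG.trans (subset_sU (Finset.mem_insert_self _ _))
    · exact subset_sU (Finset.mem_insert_of_mem (Finset.mem_erase.2 ⟨htB, ht⟩)))
  rw [Finset.mem_coe, Finset.mem_insert] at hn
  rcases hn with rfl | hn
  · exact hDG hDn
  · have hnT := Finset.mem_of_mem_erase hn
    have : M.closure (sU T) = n := subset_antisymm hDn ((subset_sU hnT).trans (M.subset_closure _ hTE))
    rw [this] at hDT
    exact hDT hnT

variable (hb : IsBlowup M 𝒢 𝒰 K B)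
include hb

/-- The incompatibility is witnessed by an antichain containing `B` whose join `D ∈ 𝒢` is strictly
above `B`, hence in `𝒰`. After multiplication by the product over `S` the sums for `B` and `D`
agree, and `D` has at most the corank of `B` over `S ∪ K`, so a relation for `D` applies. -/
theorem IsRelFamily.prod_mul_pow_of_not_isNested (hx : IsRelFamily M 𝒢 𝒰 K x)
    {S : Finset (Set α)} (hS : S ⊆ 𝒰) (hn : ¬ IsNested M 𝒢 (insert B (S ∪ K)))
    (hBS : ¬ B ⊆ M.closure (sU (S ∪ K))) {k : ℕ}
    (hr : rk M (B ∪ sU (S ∪ K)) ≤ rk M (sU (S ∪ K)) + k) :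
    (∏ G ∈ S, x G) * upSum 𝒰 x B ^ k = 0 := by
  by_cases hSK : IsNested M 𝒢 (S ∪ K)
  swap
  · rw [hx.prod_eq_zero S hS hSK, zero_mul]
  have hsubG : insert B (S ∪ K) ⊆ 𝒢 :=
    Finset.insert_subset hb.mem (Finset.union_subset (hS.trans hb.subset) hb.subset_K)
  obtain ⟨T, hT, hanti, hD, hDT⟩ := (not_isNested_iff h𝒢 hsubG).1 hn
  have hTG := hT.trans hsubG
  have hTE := sU_subset_ground h𝒢 hTG
  have hXE := sU_subset_ground h𝒢 hSK.1
  have hBE := building_subset_ground h𝒢 hb.mem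
  have hBT : B ∈ T := by
    by_contra hBT
    refine (not_isNested_iff h𝒢 hSK.1).2 ⟨T, ?_, hanti, hD, hDT⟩ hSK
    intro t ht
    rcases Finset.mem_insert.1 (hT ht) with rfl | h
    · exact absurd ht hBT
    · exact h
  set D := M.closure (sU T) with hDdef
  have hBD : B ⊆ D := (subset_sU hBT).trans (M.subset_closure _ hTE)
  have hDU : D ∈ 𝒰 := hb.upper_of_ssubset D hD ⟨hBD, fun h => hDT (by
    rwa [subset_antisymm h hBD])⟩
  have hup : (∏ G ∈ S, x G) * upSum 𝒰 x B = (∏ G ∈ S, x G) * upSum 𝒰 x D := by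
    apply mul_upSum_congr hBD
    intro G hG hBG hDG
    exact prod_mul_eq_zero_of_insert (hx.prod_eq_zero _ (Finset.insert_subset hG hS)
      (not_isNested_insert_of_bad_join h𝒢 hT hD hDT hTG hBG hDG))
  rw [mul_pow_congr hup]
  apply hx.prod_mul_pow_eq_zero S hS D hDU k (fun h => hBS (hBD.trans h))
  refine le_trans ?_ hr
  rw [← rk_closure (B ∪ sU (S ∪ K))]
  apply rk_mono
  apply Set.union_subset
  · apply M.closure_subset_closure
    rw [← sU_insert]
    exact sU_mono hT
  · exact Set.subset_union_right.trans (M.subset_closure _ (Set.union_subset hBE hXE))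

/-- Half of P(0)·J ⊆ I: the `d`-th power of `upSum 𝒰 x B` kills the monomial relations of the
center. Only the members of `S` in the witnessing antichain are kept, since `B` is not below any of
these and the previous lemma needs `B` outside their join. -/
theorem IsRelFamily.prod_mul_center (hx : IsRelFamily M 𝒢 𝒰 K x)
    {S : Finset (Set α)} (hS : S ⊆ 𝒰) (hn : ¬ IsNested M 𝒢 (insert B (S ∪ K))) {d : ℕ}
    (hr : rk M (B ∪ sU K) ≤ rk M (sU K) + d) :
    (∏ G ∈ S, x G) * upSum 𝒰 x B ^ d = 0 := by
  by_cases hSK : IsNested M 𝒢 (S ∪ K)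
  swap
  · rw [hx.prod_eq_zero S hS hSK, zero_mul]
  have hsubG : insert B (S ∪ K) ⊆ 𝒢 :=
    Finset.insert_subset hb.mem (Finset.union_subset (hS.trans hb.subset) hb.subset_K)
  obtain ⟨T, hT, hanti, hD, hDT⟩ := (not_isNested_iff h𝒢 hsubG).1 hn
  have hBT : B ∈ T := by
    by_contra hBT
    refine (not_isNested_iff h𝒢 hSK.1).2 ⟨T, ?_, hanti, hD, hDT⟩ hSK
    intro t ht
    rcases Finset.mem_insert.1 (hT ht) with rfl | h
    · exact absurd ht hBT
    · exact h
  have hS' : T ∩ S ⊆ S := Finset.inter_subset_right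
  have hSK' : IsNested M 𝒢 (T ∩ S ∪ K) := hSK.mono (Finset.union_subset_union hS' subset_rfl)
  have hTS' : T ⊆ insert B (T ∩ S ∪ K) := by
    intro t ht
    have := hT ht
    simp only [Finset.mem_insert, Finset.mem_union, Finset.mem_inter] at this ⊢
    tauto
  have h0 := hx.prod_mul_pow_of_not_isNested h𝒢 hb (S := T ∩ S) (k := d) (hS'.trans hS)
    ((not_isNested_iff h𝒢 (Finset.insert_subset hb.mem hSK'.1)).2 ⟨T, hTS', hanti, hD, hDT⟩)
    (by
      intro hBs
      obtain ⟨s, hs, hBs⟩ := hSK'.exists_subset_of_subset_closure h𝒢 hb.mem hBs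
      rcases Finset.mem_union.1 hs with hs | hs
      · rw [Finset.mem_inter] at hs
        by_cases he : B = s
        · exact hb.notMem (he ▸ hS hs.2)
        · exact hanti hBT hs.1 he hBs
      · exact hb.not_subset_K' s hs hBs)
    (rk_union_le_of_subset hr (sU_mono Finset.subset_union_right))
  rw [← Finset.prod_sdiff hS', mul_assoc, h0, mul_zero]

/-- The other half of P(0)·J ⊆ I, for the power relations. The proof depends on whether `B` lies in
the factor `D` of `C ∨ B ∨ A ∨ K` that contains `C`. -/
theorem IsRelFamily.prod_mul_pow_mul_center (hx : IsRelFamily M 𝒢 𝒰 K x)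
    {A : Finset (Set α)} (hA : A ⊆ 𝒰) {C : Set α} (hC : C ∈ 𝒰) {k d : ℕ}
    (hCA : ¬ C ⊆ M.closure (sU (A ∪ insert B K)))
    (hk : rk M (C ∪ sU (A ∪ insert B K)) ≤ rk M (sU (A ∪ insert B K)) + k)
    (hr : rk M (B ∪ sU K) ≤ rk M (sU K) + d) :
    (∏ G ∈ A, x G) * upSum 𝒰 x C ^ k * upSum 𝒰 x B ^ d = 0 := by
  rw [Finset.union_insert, sU_insert] at hCA hk
  by_cases hn : IsNested M 𝒢 (insert B (A ∪ K))
  swap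
  · rw [mul_right_comm, hx.prod_mul_center h𝒢 hb hA hn hr, zero_mul]
  have hAK : IsNested M 𝒢 (A ∪ K) := hn.mono (Finset.subset_insert _ _)
  have hAKE := sU_subset_ground h𝒢 hAK.1
  have hBE := building_subset_ground h𝒢 hb.mem
  have hCG := hb.subset hC
  have hCE := building_subset_ground h𝒢 hCG
  set X := sU (A ∪ K) with hX
  have hXE : C ∪ (B ∪ X) ⊆ M.E := Set.union_subset hCE (Set.union_subset hBE hAKE)
  have hWs := M.subset_closure _ hXE
  have hCX : ¬ C ⊆ M.closure X := fun h =>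
    hCA (h.trans (M.closure_subset_closure Set.subset_union_right))
  obtain ⟨D, hD, hCD⟩ := exists_factor hCG (Set.subset_union_left.trans hWs)
  have hDG := mem_of_mem_factors hD
  have hDX : ¬ D ⊆ M.closure X := fun h => hCX (hCD.trans h)
  have hnotsub : ∀ n ∈ A ∪ K, ¬ C ⊆ n := fun n hn h =>
    hCX (h.trans ((subset_sU hn).trans (M.subset_closure _ hAKE)))
  -- If `B ⊆ D`, all the sums for `B` and then those for `C` may be replaced by sums for `D`. The
  -- result is a relation for `D` with exponent `d + k`, which bounds the corank of `D` over `A ∪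
  -- K`.
  by_cases hBD : B ⊆ D
  · have hDU := hb.upper C hC D hDG.1 hCD
    have hBr : ∀ Y, X ⊆ Y → rk M (B ∪ Y) ≤ rk M Y + d := fun Y hY =>
      rk_union_le_of_subset hr ((sU_mono Finset.subset_union_right).trans hY)
    have hins : ∀ G, sU (insert G A ∪ K) = G ∪ X := fun G => by
      rw [Finset.insert_union, sU_insert]
    have step1 : (∏ G ∈ A, x G) * upSum 𝒰 x C ^ k * upSum 𝒰 x B =
        (∏ G ∈ A, x G) * upSum 𝒰 x C ^ k * upSum 𝒰 x D := by
      apply mul_upSum_congr hBD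
      intro G hG hBG hDGn
      have hGE := building_subset_ground h𝒢 (hb.subset hG)
      by_cases hGA : IsNested M 𝒢 (insert G A ∪ K)
      swap
      · rw [mul_right_comm, prod_mul_eq_zero_of_insert (hx.prod_eq_zero _
          (Finset.insert_subset hG hA) hGA), zero_mul]
      by_cases hCGs : C ⊆ G
      · exfalso
        obtain ⟨n, hn, hDn⟩ := hGA.exists_subset_of_subset_closure h𝒢 hDG.1 (by
          rw [hins]
          exact hDG.2.trans (M.closure_subset_closure (Set.union_subset
            (hCGs.trans Set.subset_union_left) (Set.union_subset_union_left _ hBG))))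
        rw [Finset.insert_union, Finset.mem_insert] at hn
        rcases hn with rfl | hn
        · exact hDGn hDn
        · exact hnotsub n hn (hCD.trans hDn)
      · have h0 := hx.prod_mul_pow_eq_zero (insert G A) (Finset.insert_subset hG hA) C hC k
          (by
            intro h
            obtain ⟨n, hn, hDn⟩ := hGA.exists_subset_of_subset_closure h𝒢 hCG h
            rw [Finset.insert_union, Finset.mem_insert] at hn
            rcases hn with rfl | hn
            · exact hCGs hDn
            · exact hnotsub n hn hDn)
          (by
            rw [hins]
            exact rk_union_le_of_subset hk (Set.union_subset_union_left _ hBG))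
        by_cases hGmem : G ∈ A
        · rw [Finset.insert_eq_of_mem hGmem] at h0
          rw [h0, zero_mul]
        · rw [Finset.prod_insert hGmem] at h0
          rw [← h0]; ring
    have step2 : (∏ G ∈ A, x G) * upSum 𝒰 x D ^ d * upSum 𝒰 x C =
        (∏ G ∈ A, x G) * upSum 𝒰 x D ^ d * upSum 𝒰 x D := by
      apply mul_upSum_congr hCD
      intro G hG hCGs hDGn
      have hGE := building_subset_ground h𝒢 (hb.subset hG)
      by_cases hGA : IsNested M 𝒢 (insert G A ∪ K)
      swap
      · rw [mul_right_comm, prod_mul_eq_zero_of_insert (hx.prod_eq_zero _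
          (Finset.insert_subset hG hA) hGA), zero_mul]
      have h0 := hx.prod_mul_pow_eq_zero (insert G A) (Finset.insert_subset hG hA) D hDU d
        (by
          intro h
          obtain ⟨n, hn, hDn⟩ := hGA.exists_subset_of_subset_closure h𝒢 hDG.1 h
          rw [Finset.insert_union, Finset.mem_insert] at hn
          rcases hn with rfl | hn
          · exact hDGn hDn
          · exact hnotsub n hn (hCD.trans hDn))
        (by
          rw [hins]
          refine le_trans ?_ (hBr (G ∪ X) Set.subset_union_right)
          rw [← rk_closure (B ∪ (G ∪ X))]
          apply rk_mono
          apply Set.union_subset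
          · exact hDG.2.trans (M.closure_subset_closure (Set.union_subset
              (hCGs.trans (Set.subset_union_left.trans Set.subset_union_right))
              (Set.union_subset_union_right _ Set.subset_union_right)))
          · exact Set.subset_union_right.trans (M.subset_closure _
              (Set.union_subset hBE (Set.union_subset hGE hAKE))))
      by_cases hGmem : G ∈ A
      · rw [Finset.insert_eq_of_mem hGmem] at h0
        rw [h0, zero_mul]
      · rw [Finset.prod_insert hGmem] at h0
        rw [← h0]; ring
    rw [mul_pow_congr step1, mul_right_comm, mul_pow_congr step2, mul_assoc, ← pow_add]
    apply hx.prod_mul_pow_eq_zero A hA D hDU _ hDX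
    calc rk M (D ∪ X) ≤ rk M (C ∪ (B ∪ X)) := by
          rw [← rk_closure (C ∪ (B ∪ X))]
          apply rk_mono
          exact Set.union_subset hDG.2
            ((Set.subset_union_right.trans Set.subset_union_right).trans hWs)
      _ ≤ rk M (B ∪ X) + k := hk
      _ ≤ rk M X + (d + k) := by have := hBr X subset_rfl; omega
  -- Otherwise `B` is disjoint from `D`. It does not affect the corank of `C`, so the relation for
  -- `C` holds without `B` in `K`.
  · have hdisj : ∀ b ∈ B, b ∉ D := fun b hbB hbD => hBD (subset_factor h𝒢 (M.isFlat_closure _) hD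
      hb.mem ((Set.subset_union_left.trans Set.subset_union_right).trans hWs) hbB hbD)
    have h1 := rk_inter_factor_le h𝒢 (M.isFlat_closure _) hD hCD
      (Set.subset_union_right.trans hWs) hk
    have h2 : (B ∪ X) ∩ D = X ∩ D := by
      ext y
      simp only [Set.mem_inter_iff, Set.mem_union]
      constructor
      · rintro ⟨h | h, h'⟩
        · exact absurd h' (hdisj y h)
        · exact ⟨h, h'⟩
      · rintro ⟨h, h'⟩
        exact ⟨Or.inr h, h'⟩
    rw [h2] at h1
    rw [hx.prod_mul_pow_eq_zero A hA C hC k hCX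
      (rk_union_le_of_subset h1 Set.inter_subset_left), zero_mul]

theorem IsRelFamily.of_insert (hx : IsRelFamily M 𝒢 𝒰 (insert B K) x) :
    IsRelFamily M 𝒢 𝒰 K x := by
  have hsub : ∀ S : Finset (Set α), S ∪ K ⊆ S ∪ insert B K := fun S =>
    Finset.union_subset_union subset_rfl (Finset.subset_insert _ _)
  refine ⟨fun S hS hn => hx.prod_eq_zero S hS fun h => hn (h.mono (hsub S)), ?_⟩
  intro A hA C hC k hCA hk
  by_cases hn : IsNested M 𝒢 (A ∪ insert B K)
  swap
  · rw [hx.prod_eq_zero A hA hn, zero_mul]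
  apply hx.prod_mul_pow_eq_zero A hA C hC k _ (rk_union_le_of_subset hk (sU_mono (hsub A)))
  intro h
  obtain ⟨n, hn', hCn⟩ := hn.exists_subset_of_subset_closure h𝒢 (hb.subset hC) h
  rw [Finset.union_insert, Finset.mem_insert] at hn'
  rcases hn' with rfl | hn'
  · exact hb.notMem (hb.upper C hC n hb.mem hCn)
  · have hE := sU_subset_ground h𝒢 (hn.mono (hsub A)).1
    exact hCA (hCn.trans ((subset_sU hn').trans (M.subset_closure _ hE)))

omit [M.Loopless] [M.Finite] h𝒢 in
theorem upSum_insert_self : upSum (insert B 𝒰) x B = x B + upSum 𝒰 x B := by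
  rw [upSum, Finset.filter_insert, if_pos subset_rfl, Finset.sum_insert (by simp [hb.notMem]), upSum]

omit [M.Loopless] [M.Finite] h𝒢 in
theorem upSum_insert_of_mem {C : Set α} (hC : C ∈ 𝒰) : upSum (insert B 𝒰) x C = upSum 𝒰 x C := by
  rw [upSum, Finset.filter_insert, if_neg (fun h => hb.notMem (hb.upper C hC B hb.mem h)), upSum]

/-- The presentation of the blow-up: three families of conditions on `x B` imply all relations for
`insert B 𝒰`. The only new power relations not covered directly are those for `C = B`. If `B` is
compatible with `A ∪ K` they follow from the relation of degree `d`; if not, `h1` removes `x B` and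
an old relation remains. -/
theorem IsRelFamily.blowup (hx : IsRelFamily M 𝒢 𝒰 K x)
    (h1 : ∀ S ⊆ 𝒰, ¬ IsNested M 𝒢 (S ∪ insert B K) → x B * ∏ G ∈ S, x G = 0)
    (h2 : ∀ A ⊆ 𝒰, ∀ C ∈ 𝒰, ∀ k, ¬ C ⊆ M.closure (sU (A ∪ insert B K)) →
      rk M (C ∪ sU (A ∪ insert B K)) ≤ rk M (sU (A ∪ insert B K)) + k →
      x B * ((∏ G ∈ A, x G) * upSum 𝒰 x C ^ k) = 0)
    {d : ℕ} (hd : d ≤ rk M (B ∪ sU K) - rk M (sU K)) (h3 : (x B + upSum 𝒰 x B) ^ d = 0) :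
    IsRelFamily M 𝒢 (insert B 𝒰) K x := by
  have herase : ∀ S : Finset (Set α), S ⊆ insert B 𝒰 → S.erase B ⊆ 𝒰 := by
    intro S hS s hs
    rw [Finset.mem_erase] at hs
    exact (Finset.mem_insert.1 (hS hs.2)).resolve_left hs.1
  have hnot : ∀ S : Finset (Set α), S ⊆ insert B 𝒰 → B ∉ S → S ⊆ 𝒰 := by
    intro S hS hBS
    have := herase S hS
    rwa [Finset.erase_eq_of_notMem hBS] at this
  have hun : ∀ S : Finset (Set α), B ∈ S → S.erase B ∪ insert B K = S ∪ K := by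
    intro S hBS
    ext t
    simp only [Finset.mem_union, Finset.mem_erase, Finset.mem_insert]
    by_cases h : t = B
    · subst h; simp [hBS]
    · simp [h]
  constructor
  · intro S hS hn
    by_cases hBS : B ∈ S
    · rw [← Finset.mul_prod_erase _ _ hBS]
      exact h1 _ (herase S hS) (by rwa [hun S hBS])
    · exact hx.prod_eq_zero S (hnot S hS hBS) hn
  · intro A hA C hC k hCA hk
    have hAKG : A ∪ K ⊆ 𝒢 := Finset.union_subset
      (hA.trans (Finset.insert_subset hb.mem hb.subset)) hb.subset_K
    have hAKE := sU_subset_ground h𝒢 hAKG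
    by_cases hCB : C = B
    · subst hCB
      have hBA : C ∉ A := fun h => hCA ((subset_sU (Finset.mem_union_left _ h)).trans
        (M.subset_closure _ hAKE))
      have hA' := hnot A hA hBA
      rw [upSum_insert_self hb]
      by_cases hn : IsNested M 𝒢 (A ∪ insert C K)
      · rw [Finset.union_insert] at hn
        have hnot : ∀ n ∈ A ∪ K, ¬ C ⊆ n := fun n hn h =>
          hCA (h.trans ((subset_sU hn).trans (M.subset_closure _ hAKE)))
        have hfac := mem_factors_of_isNested h𝒢 hn hnot
        have hE := sU_subset_ground h𝒢 hn.1
        have h4 := rk_inter_factor_le h𝒢 (M.isFlat_closure _) hfac subset_rfl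
          ((sU_mono (Finset.subset_insert _ _)).trans (M.subset_closure _ hE)) hk
        -- Members of `A` do not meet `C`: being nested with `C` they would be comparable to it, and
        -- neither inclusion is possible. So the corank of `C` over `A ∪ K`, localized at the factor
        -- `C`, bounds the corank over `K`, giving `d ≤ k`.
        have h5 : sU (A ∪ K) ∩ C ⊆ sU K := by
          rintro y ⟨⟨a, ha, hya⟩, hyC⟩
          rw [Finset.mem_coe] at ha
          rcases Finset.mem_union.1 ha with ha' | ha'
          · exfalso
            rcases hn.subset_or_subset h𝒢 (Finset.mem_insert_of_mem ha)
              (Finset.mem_insert_self _ _) hya hyC with h | h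
            · exact hb.notMem (hb.upper a (hA' ha') C hb.mem h)
            · exact hnot a ha h
          · exact ⟨a, ha', hya⟩
        have h6 := rk_union_le_of_subset h4 h5
        obtain ⟨j, rfl⟩ : ∃ j, k = d + j := ⟨k - d, by omega⟩
        rw [pow_add, h3]; ring
      · have h4 : (∏ G ∈ A, x G) * (x C + upSum 𝒰 x C) = (∏ G ∈ A, x G) * upSum 𝒰 x C := by
          rw [mul_add, mul_comm _ (x C), h1 A hA' hn, zero_add]
        rw [mul_pow_congr h4]
        exact hx.prod_mul_pow_of_not_isNested h𝒢 hb hA' (by rwa [Finset.union_insert] at hn) hCA hk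
    · have hC' : C ∈ 𝒰 := (Finset.mem_insert.1 hC).resolve_left hCB
      rw [upSum_insert_of_mem hb hC']
      by_cases hBA : B ∈ A
      · rw [← Finset.mul_prod_erase _ _ hBA, mul_assoc]
        exact h2 _ (herase A hA) C hC' k (by rwa [hun A hBA]) (by rwa [hun A hBA])
      · exact hx.prod_mul_pow_eq_zero A (hnot A hA hBA) C hC' k hCA hk

end Relations

/-! ### Division by a monic polynomial -/

section Division

/-- Modulo `J` the polynomial `p` is a multiple `q * P` of degree less than that of the monic `P`,
so `q` and hence `p` vanish modulo `J`. The constant term of `p` is then an element of `I` plus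
`q.coeff 0 * P.coeff 0`, and `q.coeff 0 ∈ J`. -/
theorem coeff_mem_of_mem_sup {R : Type*} [CommRing R] {I J : Ideal R} (hIJ : I ≤ J) {P p : R[X]}
    (hP : P.Monic) (hPJ : ∀ j ∈ J, P.coeff 0 * j ∈ I)
    (hp : p ∈ I.map C ⊔ J.map C * Ideal.span {X} ⊔ Ideal.span {P})
    (hdeg : p.degree < (P.natDegree : WithBot ℕ)) : p.coeff 0 ∈ I ∧ ∀ i, p.coeff i ∈ J := by
  obtain ⟨u, hu, v, hv, rfl⟩ := Submodule.mem_sup.1 hp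
  obtain ⟨a, ha, b, hb, rfl⟩ := Submodule.mem_sup.1 hu
  obtain ⟨b, hb', rfl⟩ := Ideal.mem_mul_span_singleton.1 hb
  obtain ⟨q, rfl⟩ := Ideal.mem_span_singleton'.1 hv
  rw [Ideal.mem_map_C_iff] at ha hb'
  have hmap : (a + b * X + q * P).map (Ideal.Quotient.mk J) =
      q.map (Ideal.Quotient.mk J) * P.map (Ideal.Quotient.mk J) := by
    have h1 : a.map (Ideal.Quotient.mk J) = 0 := by
      ext n; rw [coeff_map, coeff_zero, Ideal.Quotient.eq_zero_iff_mem]; exact hIJ (ha n)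
    have h2 : b.map (Ideal.Quotient.mk J) = 0 := by
      ext n; rw [coeff_map, coeff_zero, Ideal.Quotient.eq_zero_iff_mem]; exact hb' n
    simp [h1, h2]
  have hq : q.map (Ideal.Quotient.mk J) = 0 := by
    rcases subsingleton_or_nontrivial (R ⧸ J) with hs | hs
    · exact Subsingleton.elim _ _
    by_contra hq
    have hPm : (P.map (Ideal.Quotient.mk J)).Monic := hP.map _
    have h1 : ((a + b * X + q * P).map (Ideal.Quotient.mk J)).degree < (P.natDegree : WithBot ℕ) :=
      degree_map_le.trans_lt hdeg
    rw [hmap, hPm.degree_mul, degree_eq_natDegree hq, degree_eq_natDegree hPm.ne_zero,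
      hP.natDegree_map] at h1
    norm_cast at h1
    omega
  have hpJ : ∀ i, (a + b * X + q * P).coeff i ∈ J := by
    intro i
    rw [← Ideal.Quotient.eq_zero_iff_mem, ← coeff_map, hmap, hq, zero_mul, coeff_zero]
  refine ⟨?_, hpJ⟩
  have hq0 : q.coeff 0 ∈ J := by
    rw [← Ideal.Quotient.eq_zero_iff_mem, ← coeff_map, hq, coeff_zero]
  simp only [coeff_add, mul_coeff_zero, coeff_X_zero, mul_zero, add_zero]
  exact I.add_mem (ha 0) (by rw [mul_comm]; exact hPJ _ hq0)

end Division

end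

section

variable {α : Type*} {M : Matroid α} {𝒢 : Finset (Set α)}

/-! ### Ideals of the intermediate rings and induction over blow-ups -/

section Ideal

/-- The ideal of relations of the intermediate Chow ring. -/
def relIdeal (M : Matroid α) (𝒢 𝒰 K : Finset (Set α)) : Ideal (MvPolynomial (Set α) ℚ) :=
  Ideal.span
    ({p | ∃ S ⊆ 𝒰, ¬ IsNested M 𝒢 (S ∪ K) ∧ p = ∏ G ∈ S, MvPolynomial.X G} ∪
      {p | ∃ A ⊆ 𝒰, ∃ C ∈ 𝒰, ∃ k, ¬ C ⊆ M.closure (sU (A ∪ K)) ∧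
        rk M (C ∪ sU (A ∪ K)) ≤ rk M (sU (A ∪ K)) + k ∧
        p = (∏ G ∈ A, MvPolynomial.X G) * upSum 𝒰 MvPolynomial.X C ^ k})

variable {𝒰 K : Finset (Set α)}

theorem map_upSum {R R' : Type*} [CommRing R] [CommRing R'] (f : R →+* R') (x : Set α → R)
    (C : Set α) : f (upSum 𝒰 x C) = upSum 𝒰 (fun G => f (x G)) C := by
  simp [upSum, map_sum]

theorem isRelFamily_of_le_ker {R : Type*} [CommRing R] (f : MvPolynomial (Set α) ℚ →+* R)
    (hf : relIdeal M 𝒢 𝒰 K ≤ RingHom.ker f) :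
    IsRelFamily M 𝒢 𝒰 K (fun G => f (MvPolynomial.X G)) := by
  constructor
  · intro S hS hn
    have := hf (Ideal.subset_span (Or.inl ⟨S, hS, hn, rfl⟩))
    rwa [RingHom.mem_ker, map_prod] at this
  · intro A hA C hC k h1 h2
    have := hf (Ideal.subset_span (Or.inr ⟨A, hA, C, hC, k, h1, h2, rfl⟩))
    rwa [RingHom.mem_ker, map_mul, map_prod, map_pow, map_upSum] at this

theorem le_ker_of_isRelFamily {R : Type*} [CommRing R] (f : MvPolynomial (Set α) ℚ →+* R)
    (hf : IsRelFamily M 𝒢 𝒰 K (fun G => f (MvPolynomial.X G))) :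
    relIdeal M 𝒢 𝒰 K ≤ RingHom.ker f := by
  rw [relIdeal, Ideal.span_le]
  rintro p (⟨S, hS, hn, rfl⟩ | ⟨A, hA, C, hC, k, h1, h2, rfl⟩)
  · rw [SetLike.mem_coe, RingHom.mem_ker, map_prod, hf.prod_eq_zero S hS hn]
  · rw [SetLike.mem_coe, RingHom.mem_ker, map_mul, map_prod, map_pow, map_upSum,
      hf.prod_mul_pow_eq_zero A hA C hC k h1 h2]

theorem IsRelFamily.congr {R : Type*} [CommRing R] {x y : Set α → R}
    (hx : IsRelFamily M 𝒢 𝒰 K x) (h : ∀ G ∈ 𝒰, x G = y G) : IsRelFamily M 𝒢 𝒰 K y := by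
  have hp : ∀ S ⊆ 𝒰, ∏ G ∈ S, x G = ∏ G ∈ S, y G := fun S hS =>
    Finset.prod_congr rfl fun G hG => h G (hS hG)
  have hs : ∀ C, upSum 𝒰 x C = upSum 𝒰 y C := fun C =>
    Finset.sum_congr rfl fun G hG => h G (Finset.mem_filter.1 hG).1
  refine ⟨fun S hS hn => hp S hS ▸ hx.prod_eq_zero S hS hn, fun A hA C hC k h1 h2 => ?_⟩
  rw [← hp A hA, ← hs]
  exact hx.prod_mul_pow_eq_zero A hA C hC k h1 h2

/-- View the variable `x_B` as the variable of a univariate polynomial ring. -/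
def split (B : Set α) : MvPolynomial (Set α) ℚ →ₐ[ℚ] (MvPolynomial (Set α) ℚ)[X] :=
  MvPolynomial.aeval fun G => if G = B then X else C (MvPolynomial.X G)

theorem split_monomial (B : Set α) (m : Set α →₀ ℕ) (c : ℚ) :
    split B (MvPolynomial.monomial m c) =
      C (MvPolynomial.monomial (m.erase B) c) * X ^ m B := by
  rw [split, MvPolynomial.aeval_monomial]
  have hm : m = m.erase B + Finsupp.single B (m B) := (Finsupp.erase_add_single B m).symm
  conv_lhs => rw [hm]
  rw [Finsupp.prod_add_index' (fun _ => pow_zero _) (fun _ _ _ => pow_add _ _ _),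
    Finsupp.prod_single_index (h := fun x => HPow.hPow (if x = B then
      (X : (MvPolynomial (Set α) ℚ)[X]) else C (MvPolynomial.X x))) (pow_zero _), if_pos rfl,
    ← mul_assoc]
  congr 1
  rw [MvPolynomial.monomial_eq, C_mul]
  congr 1
  rw [Finsupp.prod, Finsupp.prod, map_prod]
  apply Finset.prod_congr rfl
  intro G hG
  rw [Finsupp.support_erase, Finset.mem_erase] at hG
  rw [if_neg hG.1, map_pow]

theorem eval_split (B : Set α) (p : MvPolynomial (Set α) ℚ) :
    (split B p).eval (MvPolynomial.X B) = p := by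
  have : ((evalRingHom (MvPolynomial.X B)).comp (split B).toRingHom) = RingHom.id _ := by
    apply MvPolynomial.ringHom_ext
    · intro r
      simp [split, Polynomial.algebraMap_apply, MvPolynomial.algebraMap_eq]
    · intro G
      by_cases h : G = B <;> simp [split, h]
  exact congrArg (fun f => f p) this

theorem coeff_split (B : Set α) (p : MvPolynomial (Set α) ℚ) (i : ℕ) :
    (split B p).coeff i = ∑ m ∈ p.support with m B = i,
      MvPolynomial.monomial (m.erase B) (p.coeff m) := by
  conv_lhs => rw [p.as_sum]
  rw [map_sum, finsetSum_coeff, Finset.sum_filter]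
  apply Finset.sum_congr rfl
  intro m _
  rw [split_monomial, coeff_C_mul, coeff_X_pow]
  by_cases h : m B = i
  · simp [h]
  · simp [h, Ne.symm h]

theorem exists_of_mem_support_coeff_split {B : Set α} {p : MvPolynomial (Set α) ℚ} {i : ℕ}
    {n : Set α →₀ ℕ} (hn : n ∈ ((split B p).coeff i).support) :
    ∃ m ∈ p.support, m B = i ∧ n = m.erase B := by
  rw [coeff_split] at hn
  obtain ⟨m, hm, h⟩ := Finset.mem_biUnion.1 (MvPolynomial.support_sum hn)
  rw [Finset.mem_filter] at hm
  refine ⟨m, hm.1, hm.2, ?_⟩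
  exact Finset.mem_singleton.1 (MvPolynomial.support_monomial_subset h)

variable [M.Loopless] [M.Finite] (h𝒢 : IsBuildingSet M 𝒢) {B : Set α}
include h𝒢

/-- The universal property of the blow-up presentation, for an arbitrary target in which the images
of the variables form a family to which `IsRelFamily.blowup` applies. -/
theorem map_split_eq_zero (hb : IsBlowup M 𝒢 𝒰 K B) {Q : Type*} [CommRing Q]
    (g : (MvPolynomial (Set α) ℚ)[X] →+* Q) (hI : ∀ i ∈ relIdeal M 𝒢 𝒰 K, g (C i) = 0)
    (hJ : ∀ j ∈ relIdeal M 𝒢 𝒰 (insert B K), g X * g (C j) = 0)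
    (hP : g ((X + C (upSum 𝒰 MvPolynomial.X B)) ^ (rk M (B ∪ sU K) - rk M (sU K))) = 0)
    {p : MvPolynomial (Set α) ℚ} (hp : p ∈ relIdeal M 𝒢 (insert B 𝒰) K) :
    g (split B p) = 0 := by
  let f := g.comp (split B).toRingHom
  have hfB : f (MvPolynomial.X B) = g X := by simp [f, split]
  have hfG : ∀ G ∈ 𝒰, g (C (MvPolynomial.X G)) = f (MvPolynomial.X G) := by
    intro G hG
    have : G ≠ B := fun h => hb.notMem (h ▸ hG)
    simp [f, split, this]
  have hfC : ∀ S ⊆ 𝒰, ∏ G ∈ S, f (MvPolynomial.X G) = g (C (∏ G ∈ S, MvPolynomial.X G)) := by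
    intro S hS
    rw [map_prod, map_prod]
    exact Finset.prod_congr rfl fun G hG => (hfG G (hS hG)).symm
  have hfS : ∀ D, upSum 𝒰 (fun G => f (MvPolynomial.X G)) D =
      g (C (upSum 𝒰 MvPolynomial.X D)) := by
    intro D
    rw [upSum, upSum, map_sum, map_sum]
    exact Finset.sum_congr rfl fun G hG => (hfG G (Finset.mem_filter.1 hG).1).symm
  have hrel : IsRelFamily M 𝒢 𝒰 K (fun G => f (MvPolynomial.X G)) :=
    (isRelFamily_of_le_ker (g.comp C) hI).congr hfG
  have hrel' : IsRelFamily M 𝒢 (insert B 𝒰) K (fun G => f (MvPolynomial.X G)) := by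
    refine hrel.blowup h𝒢 hb ?_ ?_ le_rfl ?_
    · intro S hS hn
      rw [hfB, hfC S hS]
      exact hJ _ (Ideal.subset_span (Or.inl ⟨S, hS, hn, rfl⟩))
    · intro A hA D hD k h1 h2
      rw [hfB, hfC A hA, hfS]
      have := hJ _ (Ideal.subset_span (Or.inr ⟨A, hA, D, hD, k, h1, h2, rfl⟩))
      rwa [C_mul, C_pow, map_mul, map_pow] at this
    · rw [hfB, hfS, ← map_add, ← map_pow, hP]
  exact le_ker_of_isRelFamily f hrel' hp

theorem split_mem_of_mem_relIdeal (hb : IsBlowup M 𝒢 𝒰 K B) {p : MvPolynomial (Set α) ℚ}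
    (hp : p ∈ relIdeal M 𝒢 (insert B 𝒰) K) :
    split B p ∈ (relIdeal M 𝒢 𝒰 K).map C ⊔
      (relIdeal M 𝒢 𝒰 (insert B K)).map C * Ideal.span {X} ⊔
      Ideal.span {(X + C (upSum 𝒰 MvPolynomial.X B)) ^ (rk M (B ∪ sU K) - rk M (sU K))} := by
  generalize hL : _ ⊔ Ideal.span {(_ : (MvPolynomial (Set α) ℚ)[X])} = L
  rw [← Ideal.Quotient.eq_zero_iff_mem]
  refine map_split_eq_zero h𝒢 hb (Q := (MvPolynomial (Set α) ℚ)[X] ⧸ L) (Ideal.Quotient.mk L)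
    (fun i hi => ?_) (fun j hj => ?_) ?_ hp <;> subst hL
  · rw [Ideal.Quotient.eq_zero_iff_mem]
    exact Ideal.mem_sup_left (Ideal.mem_sup_left (Ideal.mem_map_of_mem _ hi))
  · rw [← map_mul, Ideal.Quotient.eq_zero_iff_mem, mul_comm]
    exact Ideal.mem_sup_left (Ideal.mem_sup_right
      (Ideal.mul_mem_mul (Ideal.mem_map_of_mem _ hj) (Ideal.mem_span_singleton_self _)))
  · rw [Ideal.Quotient.eq_zero_iff_mem]
    exact Ideal.mem_sup_right (Ideal.mem_span_singleton_self _)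

theorem relIdeal_le_insert (hb : IsBlowup M 𝒢 𝒰 K B) :
    relIdeal M 𝒢 𝒰 K ≤ relIdeal M 𝒢 𝒰 (insert B K) := by
  have h := (isRelFamily_of_le_ker (M := M) (𝒢 := 𝒢) (𝒰 := 𝒰) (K := insert B K)
    (Ideal.Quotient.mk (relIdeal M 𝒢 𝒰 (insert B K))) (by rw [Ideal.mk_ker])).of_insert h𝒢 hb
  have := le_ker_of_isRelFamily _ h
  rwa [Ideal.mk_ker] at this

theorem upSum_pow_mul_mem (hb : IsBlowup M 𝒢 𝒰 K B) {d : ℕ}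
    (hr : rk M (B ∪ sU K) ≤ rk M (sU K) + d) {j : MvPolynomial (Set α) ℚ}
    (hj : j ∈ relIdeal M 𝒢 𝒰 (insert B K)) :
    upSum 𝒰 MvPolynomial.X B ^ d * j ∈ relIdeal M 𝒢 𝒰 K := by
  have hx := isRelFamily_of_le_ker (M := M) (𝒢 := 𝒢) (𝒰 := 𝒰) (K := K)
    (Ideal.Quotient.mk (relIdeal M 𝒢 𝒰 K)) (by rw [Ideal.mk_ker])
  induction hj using Submodule.span_induction with
  | mem j hj =>
    rw [← Ideal.Quotient.eq_zero_iff_mem, map_mul, map_pow, map_upSum, mul_comm]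
    rcases hj with ⟨S, hS, hn, rfl⟩ | ⟨A, hA, D, hD, k, h1, h2, rfl⟩
    · rw [map_prod]
      exact hx.prod_mul_center h𝒢 hb hS (by rwa [← Finset.union_insert]) hr
    · rw [map_mul, map_prod, map_pow, map_upSum]
      exact hx.prod_mul_pow_mul_center h𝒢 hb hA hD h1 h2 hr
  | zero => simp
  | add a b _ _ ha hb => rw [mul_add]; exact Ideal.add_mem _ ha hb
  | smul a b _ hb => rw [smul_eq_mul, mul_left_comm]; exact Ideal.mul_mem_left _ _ hb

/-- The members of `K` that meet `B` lie strictly below it, and `B` is a factor of its join with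
`K`, so the corank can be localized at `B`. It follows that exponents of `x_B` in standard monomials
stay below the degree of the monic relation. -/
theorem gap_le_of_isNested {N : Finset (Set α)} (hN : IsNested M 𝒢 N) (hKN : K ⊆ N) (hBN : B ∈ N)
    (hBK : ∀ k ∈ K, ¬ B ⊆ k) : gap M N B ≤ rk M (B ∪ sU K) - rk M (sU K) := by
  have hn : IsNested M 𝒢 (insert B K) := hN.mono (Finset.insert_subset hBN hKN)
  have hfac := mem_factors_of_isNested h𝒢 hn hBK
  have hE := sU_subset_ground h𝒢 hn.1
  have h4 := rk_inter_factor_le h𝒢 (M.isFlat_closure _) hfac subset_rfl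
    ((sU_mono (Finset.subset_insert _ _)).trans (M.subset_closure _ hE))
    (k := rk M (B ∪ sU K) - rk M (sU K)) (X := sU K) (by omega)
  have h5 : sU K ∩ B ⊆ ⋃₀ {H | H ∈ N ∧ H ⊂ B} := by
    rintro y ⟨⟨a, ha, hya⟩, hyB⟩
    rw [Finset.mem_coe] at ha
    refine ⟨a, ⟨hKN ha, ?_⟩, hya⟩
    rcases hN.subset_or_subset h𝒢 (hKN ha) hBN hya hyB with h | h
    · exact ⟨h, hBK a ha⟩
    · exact absurd h (hBK a ha)
  have h6 := rk_mono (M := M) h5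
  rw [Set.union_eq_left.2 Set.inter_subset_right] at h4
  rw [gap]
  omega

/-- Induction on the number of blown-up elements. A minimal `B` is removed from `𝒰` and the
polynomial is read as one in `x_B`, of degree less than `d`. Its constant coefficient is a relation
for `K`, the other coefficients are relations for `insert B K`, and all of them again involve only
standard monomials. `K` is allowed to vary for the sake of this step. -/
theorem eq_zero_of_mem_relIdeal (n : ℕ) : ∀ (𝒰 K : Finset (Set α)), 𝒰.card = n → 𝒰 ⊆ 𝒢 →
    (∀ G ∈ 𝒰, ∀ H ∈ 𝒢, G ⊆ H → H ∈ 𝒰) → K ⊆ 𝒢 → (∀ G ∈ 𝒰, ∀ k ∈ K, ¬ G ⊆ k) →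
    ∀ p ∈ relIdeal M 𝒢 𝒰 K, (∀ m ∈ p.support, IsStandard M 𝒢 𝒰 K m) → p = 0 := by
  induction n with
  | zero =>
    intro 𝒰 K hcard _ _ _ _ p hp hst
    rw [Finset.card_eq_zero] at hcard
    subst hcard
    by_cases hK : IsNested M 𝒢 K
    · have : relIdeal M 𝒢 ∅ K = ⊥ := by
        rw [relIdeal, Ideal.span_eq_bot]
        rintro q (⟨S, hS, hn, rfl⟩ | ⟨A, hA, D, hD, -⟩)
        · rw [Finset.subset_empty.1 hS, Finset.empty_union] at hn
          exact absurd hK hn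
        · simp at hD
      rw [this] at hp
      exact hp
    · rw [← MvPolynomial.support_eq_empty, Finset.eq_empty_iff_forall_notMem]
      exact fun m hm => hK ((hst m hm).isNested.mono Finset.subset_union_right)
  | succ n ih =>
    intro 𝒰₀ K hcard hU hup hKG hUK p hp hst
    by_cases hK : IsNested M 𝒢 K
    swap
    · rw [← MvPolynomial.support_eq_empty, Finset.eq_empty_iff_forall_notMem]
      exact fun m hm => hK ((hst m hm).isNested.mono Finset.subset_union_right)
    obtain ⟨B, hBmin⟩ := 𝒰₀.exists_minimal (Finset.card_pos.1 (by omega))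
    have hB : B ∈ 𝒰₀ := hBmin.prop
    set 𝒰 := 𝒰₀.erase B with h𝒰
    have hins : insert B 𝒰 = 𝒰₀ := Finset.insert_erase hB
    have hmem𝒰 : ∀ G, G ∈ 𝒰 ↔ G ≠ B ∧ G ∈ 𝒰₀ := fun G => Finset.mem_erase
    have hb : IsBlowup M 𝒢 𝒰 K B :=
      { subset := (Finset.erase_subset _ _).trans hU
        upper := fun G hG H hH hGH => by
          rw [hmem𝒰] at hG ⊢
          refine ⟨?_, hup G hG.2 H hH hGH⟩
          rintro rfl
          exact hG.1 (subset_antisymm hGH (hBmin.2 hG.2 hGH))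
        mem := hU hB
        notMem := Finset.notMem_erase _ _
        upper_of_ssubset := fun H hH hBH => by
          rw [hmem𝒰]
          exact ⟨hBH.ne', hup B hB H hH hBH.subset⟩
        subset_K := hKG
        not_subset_K := fun G hG => hUK G ((hmem𝒰 G).1 hG).2
        not_subset_K' := hUK B hB }
    have hBE := building_subset_ground h𝒢 hb.mem
    have hKE := sU_subset_ground h𝒢 hKG
    set d := rk M (B ∪ sU K) - rk M (sU K) with hd
    have hdpos : 0 < d := by
      by_contra hcon
      have hcl := closure_eq_of_rk_le (M := M) (X := sU K) (Y := B ∪ sU K)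
        Set.subset_union_right (by omega)
      obtain ⟨k, hk, hBk⟩ := hK.exists_subset_of_subset_closure h𝒢 hb.mem (by
        rw [hcl]
        exact Set.subset_union_left.trans (M.subset_closure _ (Set.union_subset hBE hKE)))
      exact hUK B hB k hk hBk
    have hcard' : 𝒰.card = n := by rw [h𝒰, Finset.card_erase_of_mem hB]; omega
    have hlt : ∀ m ∈ p.support, m B < d := by
      intro m hm
      by_cases hBm : B ∈ m.support
      · exact ((hst m hm).lt_gap B hBm).trans_le (gap_le_of_isNested h𝒢 (hst m hm).isNested
          Finset.subset_union_right (Finset.mem_union_left _ hBm) (hUK B hB))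
      · rwa [Finsupp.notMem_support_iff.1 hBm]
    set P : (MvPolynomial (Set α) ℚ)[X] := (X + C (upSum 𝒰 MvPolynomial.X B)) ^ d with hP
    have hPm : P.Monic := (monic_X_add_C _).pow d
    have hPd : P.natDegree = d := by rw [hP, (monic_X_add_C _).natDegree_pow]; simp
    have hP0 : P.coeff 0 = upSum 𝒰 MvPolynomial.X B ^ d := by
      rw [hP, coeff_zero_eq_eval_zero]; simp
    have hdegree : (split B p).degree < (P.natDegree : WithBot ℕ) := by
      rw [hPd, degree_lt_iff_coeff_zero]
      intro i hi
      rw [← MvPolynomial.support_eq_empty, Finset.eq_empty_iff_forall_notMem]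
      intro m hm
      obtain ⟨m', hm', h, -⟩ := exists_of_mem_support_coeff_split hm
      have := hlt m' hm'
      omega
    rw [← hins] at hp
    obtain ⟨h0, hJ⟩ := coeff_mem_of_mem_sup (relIdeal_le_insert h𝒢 hb) hPm
      (fun j hj => by
        rw [hP0]
        exact upSum_pow_mul_mem h𝒢 hb (by omega) hj)
      (split_mem_of_mem_relIdeal h𝒢 hb hp) hdegree
    have hsplit : split B p = 0 := by
      ext1 i
      rw [coeff_zero]
      rcases Nat.eq_zero_or_pos i with rfl | hi
      · refine ih 𝒰 K hcard' hb.subset hb.upper hKG hb.not_subset_K _ h0 fun m hm => ?_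
        obtain ⟨m', hm', h, rfl⟩ := exists_of_mem_support_coeff_split hm
        have hm0 : m'.erase B = m' := Finsupp.erase_of_notMem_support
          (Finsupp.notMem_support_iff.2 h)
        rw [hm0]
        have h' := hst m' hm'
        refine ⟨fun G hG => (hmem𝒰 G).2 ⟨?_, h'.support_subset hG⟩, h'.isNested, h'.lt_gap⟩
        rintro rfl
        exact Finsupp.mem_support_iff.1 hG h
      · refine ih 𝒰 (insert B K) hcard' hb.subset hb.upper
          (Finset.insert_subset hb.mem hKG) ?_ _ (hJ i) fun m hm => ?_
        · intro G hG k hk hGk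
          rcases Finset.mem_insert.1 hk with rfl | hk
          · exact hb.notMem (hb.upper G hG k hb.mem hGk)
          · exact hb.not_subset_K G hG k hk hGk
        · obtain ⟨m', hm', h, rfl⟩ := exists_of_mem_support_coeff_split hm
          have h' := hst m' hm'
          have hBm : B ∈ m'.support := Finsupp.mem_support_iff.2 (by omega)
          -- Moving `B` from the support to `K` does not change their union, on which both the
          -- nestedness condition and the gaps depend.
          have hsupp : (m'.erase B).support ∪ insert B K = m'.support ∪ K := by
            rw [Finsupp.support_erase, Finset.union_insert, ← Finset.insert_union,
              Finset.insert_erase hBm]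
          refine ⟨?_, hsupp ▸ h'.isNested, ?_⟩
          · rw [Finsupp.support_erase]
            exact Finset.erase_subset_erase _ h'.support_subset
          · intro G hG
            rw [hsupp]
            rw [Finsupp.support_erase, Finset.mem_erase] at hG
            rw [Finsupp.erase_ne hG.1]
            exact h'.lt_gap G hG.2
    rw [← eval_split B p, hsplit, eval_zero]

end Ideal
end

section

variable {α : Type*} {M : Matroid α} {𝒢 : Finset (Set α)}

/-! ### The Hilbert–Poincaré series -/

/-- The class of the variable `x_G` in the Chow ring, and `0` if `G` is not in the building set. -/
def chowVar (M : Matroid α) (𝒢 : Finset (Set α)) (G : Set α) : ChowRing M 𝒢 :=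
  if h : G ∈ 𝒢 then Ideal.Quotient.mk (chowIdeal M 𝒢) (MvPolynomial.X ⟨G, h⟩) else 0

theorem prod_chowVar (S : Finset (Set α)) (hS : S ⊆ 𝒢) :
    ∏ G ∈ S, chowVar M 𝒢 G =
      Ideal.Quotient.mk _ (∏ G ∈ S.subtype (· ∈ 𝒢), MvPolynomial.X G) := by
  rw [map_prod]
  conv_lhs => rw [← Finset.subtype_map_of_mem (p := (· ∈ 𝒢)) (s := S) (fun G hG => hS hG)]
  rw [Finset.prod_map]
  apply Finset.prod_congr rfl
  intro G _
  simp [chowVar]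

theorem prod_chowVar_eq_zero : ∀ S ⊆ 𝒢, ¬ IsNested M 𝒢 S → ∏ G ∈ S, chowVar M 𝒢 G = 0 := by
  intro S hS hn
  rw [prod_chowVar S hS, Ideal.Quotient.eq_zero_iff_mem]
  apply Ideal.subset_span
  refine Or.inl ⟨S.subtype (· ∈ 𝒢), ?_, rfl⟩
  have : (S.subtype (· ∈ 𝒢)).map (Function.Embedding.subtype _) = S :=
    Finset.subtype_map_of_mem (fun G hG => hS hG)
  exact fun h => hn (this ▸ h)

theorem sum_chowVar_eq_zero : ∀ e ∈ M.E, ∑ G ∈ 𝒢 with e ∈ G, chowVar M 𝒢 G = 0 := by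
  intro e he
  have : ∑ G ∈ 𝒢 with e ∈ G, chowVar M 𝒢 G =
      Ideal.Quotient.mk (chowIdeal M 𝒢) (∑ G : 𝒢 with e ∈ G.1, MvPolynomial.X G) := by
    rw [map_sum, Finset.sum_filter, Finset.sum_filter, ← Finset.sum_coe_sort 𝒢]
    apply Finset.sum_congr rfl
    intro G _
    simp [chowVar]
  rw [this, Ideal.Quotient.eq_zero_iff_mem]
  exact Ideal.subset_span (Or.inr ⟨e, he, rfl⟩)

/-- The exponent vectors of the standard monomials with support `N`. -/
def stdExponents (M : Matroid α) (N : Finset (Set α)) : Finset (Set α →₀ ℕ) :=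
  N.finsupp fun G => Finset.Ico 1 (gap M N G)

/-- The set of all nested sets. -/
def nestedSets (M : Matroid α) (𝒢 : Finset (Set α)) : Finset (Finset (Set α)) :=
  𝒢.powerset.filter (IsNested M 𝒢)

theorem mem_nestedSets {N : Finset (Set α)} : N ∈ nestedSets M 𝒢 ↔ IsNested M 𝒢 N := by
  simp only [nestedSets, Finset.mem_filter, Finset.mem_powerset, and_iff_right_iff_imp]
  exact fun h => h.1

theorem mem_stdExponents {N : Finset (Set α)} {m : Set α →₀ ℕ} :
    m ∈ stdExponents M N ↔ m.support = N ∧ ∀ G ∈ N, m G < gap M N G := by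
  rw [stdExponents, Finset.mem_finsupp_iff]
  constructor
  · rintro ⟨h1, h2⟩
    refine ⟨h1.antisymm fun G hG => ?_, fun G hG => (Finset.mem_Ico.1 (h2 G hG)).2⟩
    have := (Finset.mem_Ico.1 (h2 G hG)).1
    rw [Finsupp.mem_support_iff]; omega
  · rintro ⟨rfl, h⟩
    refine ⟨subset_rfl, fun G hG => Finset.mem_Ico.2 ⟨?_, h G hG⟩⟩
    rw [Finsupp.mem_support_iff] at hG; omega

theorem isStandard_iff {m : Set α →₀ ℕ} : IsStandard M 𝒢 𝒢 ∅ m ↔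
    ∃ N ∈ nestedSets M 𝒢, m ∈ stdExponents M N := by
  simp only [mem_nestedSets, mem_stdExponents]
  constructor
  · intro h
    exact ⟨m.support, by simpa using h.isNested, rfl, by simpa using h.lt_gap⟩
  · rintro ⟨_, hN, rfl, h⟩
    exact ⟨hN.1, by simpa using hN, by simpa using h⟩

/-- The exponent vectors of the standard monomials of degree `k`. -/
def stdOfDegree (M : Matroid α) (𝒢 : Finset (Set α)) (k : ℕ) : Finset (Set α →₀ ℕ) :=
  ((nestedSets M 𝒢).biUnion (stdExponents M)).filter (fun m => m.degree = k)

theorem mem_stdOfDegree {k : ℕ} {m : Set α →₀ ℕ} :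
    m ∈ stdOfDegree M 𝒢 k ↔ IsStandard M 𝒢 𝒢 ∅ m ∧ m.degree = k := by
  rw [stdOfDegree, Finset.mem_filter, Finset.mem_biUnion, isStandard_iff]

section
variable [M.Loopless] [M.Finite] (h𝒢 : IsBuildingSet M 𝒢)
include h𝒢

/-- The linear form of `e` is the power relation with `A = ∅`, `C = cl {e}` and `k = 1`. One
inclusion of ideals suffices, since independence can be tested after applying a map. -/
theorem chowIdeal_le_comap : chowIdeal M 𝒢 ≤
    (relIdeal M 𝒢 𝒢 ∅).comap (MvPolynomial.rename (R := ℚ) (Subtype.val : 𝒢 → Set α)) := by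
  rw [chowIdeal, Ideal.span_le]
  rintro p (⟨S, hS, rfl⟩ | ⟨e, he, rfl⟩)
  · rw [SetLike.mem_coe, Ideal.mem_comap, map_prod]
    apply Ideal.subset_span
    refine Or.inl ⟨S.map (Function.Embedding.subtype _), ?_, by rwa [Finset.union_empty], ?_⟩
    · intro G hG
      simp only [Finset.mem_map, Function.Embedding.subtype_apply] at hG
      obtain ⟨G', -, rfl⟩ := hG
      exact G'.2
    · rw [Finset.prod_map]
      simp
  · rw [SetLike.mem_coe, Ideal.mem_comap, map_sum]
    have hmem := closure_singleton_mem h𝒢 he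
    have : ∑ G : 𝒢 with e ∈ G.1, MvPolynomial.rename (R := ℚ) (Subtype.val : 𝒢 → Set α)
        (MvPolynomial.X G) = (∏ G ∈ (∅ : Finset (Set α)), MvPolynomial.X G) *
          upSum 𝒢 MvPolynomial.X (M.closure {e}) ^ 1 := by
      rw [Finset.prod_empty, one_mul, pow_one, upSum, Finset.sum_filter, Finset.sum_filter,
        ← Finset.sum_coe_sort 𝒢]
      apply Finset.sum_congr rfl
      intro G _
      have hiff : e ∈ (G : Set α) ↔ M.closure {e} ⊆ G := by
        constructor
        · intro h
          have := M.closure_subset_closure (Set.singleton_subset_iff.2 h)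
          rwa [(h𝒢.isFlat G G.2).closure] at this
        · exact fun h => h (M.mem_closure_self e)
      simp [hiff]
    rw [this]
    apply Ideal.subset_span
    refine Or.inr ⟨∅, Finset.empty_subset _, M.closure {e}, hmem, 1, ?_, ?_, rfl⟩
    · simp only [Finset.union_idempotent, sU, Finset.coe_empty, Set.sUnion_empty, closure_empty']
      intro h
      exact h (M.mem_closure_self e)
    · simp only [Finset.union_idempotent, sU, Finset.coe_empty, Set.sUnion_empty, Set.union_empty,
        rk_closure]
      have : rk M {e} ≤ 1 := by
        have := M.eRk_singleton_le e
        rw [← coe_rk] at this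
        exact_mod_cast this
      omega

/-- The map from the Chow ring to the quotient of the polynomial ring in all variables. -/
def chowToRel : ChowRing M 𝒢 →ₐ[ℚ] (MvPolynomial (Set α) ℚ ⧸ relIdeal M 𝒢 𝒢 ∅) :=
  Ideal.quotientMapₐ _ (MvPolynomial.rename Subtype.val) (chowIdeal_le_comap h𝒢)

theorem chowToRel_mon {m : Set α →₀ ℕ} (hm : m.support ⊆ 𝒢) :
    chowToRel h𝒢 (mon (chowVar M 𝒢) m) =
      Ideal.Quotient.mk (relIdeal M 𝒢 𝒢 ∅) (MvPolynomial.monomial m 1) := by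
  rw [mon, Finsupp.prod, map_prod, MvPolynomial.monomial_eq, map_one, one_mul, Finsupp.prod,
    map_prod]
  apply Finset.prod_congr rfl
  intro G hG
  rw [map_pow, map_pow, chowVar, dif_pos (hm hG)]
  congr 1
  have : MvPolynomial.rename (R := ℚ) (Subtype.val : 𝒢 → Set α) (MvPolynomial.X ⟨G, hm hG⟩) =
    MvPolynomial.X G := MvPolynomial.rename_X _ _
  rw [← this]
  rfl

theorem linearIndependent_mon (k : ℕ) :
    LinearIndependent ℚ (fun m : stdOfDegree M 𝒢 k => mon (chowVar M 𝒢) (m : Set α →₀ ℕ)) := by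
  apply LinearIndependent.of_comp (chowToRel h𝒢).toLinearMap
  rw [linearIndependent_iff']
  intro s g hg i hi
  have hst := fun m : stdOfDegree M 𝒢 k => (mem_stdOfDegree.1 m.2).1
  set p : MvPolynomial (Set α) ℚ := ∑ m ∈ s, MvPolynomial.monomial (m : Set α →₀ ℕ) (g m) with hp
  have hcoe : ∀ m : stdOfDegree M 𝒢 k, m ∈ s → p.coeff m = g m := by
    intro m hm
    rw [hp, MvPolynomial.coeff_sum]
    simp only [MvPolynomial.coeff_monomial]
    rw [Finset.sum_eq_single m]
    · simp
    · intro b _ hb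
      rw [if_neg fun h => hb (Subtype.ext h)]
    · exact fun h => absurd hm h
  have h0 : p = 0 := by
    refine eq_zero_of_mem_relIdeal h𝒢 _ 𝒢 ∅ rfl subset_rfl (fun _ _ H hH _ => hH)
      (Finset.empty_subset _) (by simp) p ?_ ?_
    · rw [← Ideal.Quotient.eq_zero_iff_mem, hp, map_sum, ← hg]
      apply Finset.sum_congr rfl
      intro m _
      simp only [Function.comp, AlgHom.toLinearMap_apply]
      rw [chowToRel_mon h𝒢 (hst m).support_subset]
      have : MvPolynomial.monomial (m : Set α →₀ ℕ) (g m) =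
          g m • MvPolynomial.monomial (m : Set α →₀ ℕ) (1 : ℚ) := by
        rw [MvPolynomial.smul_monomial, smul_eq_mul, mul_one]
      rw [this]
      rfl
    · intro m hm
      obtain ⟨m', -, h⟩ := Finset.mem_biUnion.1 (MvPolynomial.support_sum hm)
      have := Finset.mem_singleton.1 (MvPolynomial.support_monomial_subset h)
      exact this ▸ hst m'
  rw [← hcoe i hi, h0, MvPolynomial.coeff_zero]

theorem chowPiece_eq_span (k : ℕ) : chowPiece M 𝒢 k =
    Submodule.span ℚ (Set.range
      (fun m : stdOfDegree M 𝒢 k => mon (chowVar M 𝒢) (m : Set α →₀ ℕ))) := by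
  have hmon : ∀ n : 𝒢 →₀ ℕ, Ideal.Quotient.mk (chowIdeal M 𝒢) (MvPolynomial.monomial n 1) =
      mon (chowVar M 𝒢) (n.embDomain (Function.Embedding.subtype _)) := by
    intro n
    rw [mon, Finsupp.prod_embDomain, MvPolynomial.monomial_eq, map_one, one_mul, Finsupp.prod,
      map_prod, Finsupp.prod]
    apply Finset.prod_congr rfl
    intro G _
    simp [chowVar]
  apply le_antisymm
  · rintro _ ⟨p, hp, rfl⟩
    rw [SetLike.mem_coe, MvPolynomial.mem_homogeneousSubmodule] at hp
    rw [p.as_sum, map_sum]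
    apply Submodule.sum_mem
    intro n hn
    have hdeg : n.degree = k := by
      by_contra h
      exact MvPolynomial.mem_support_iff.1 hn (hp.coeff_eq_zero h)
    have e : MvPolynomial.monomial n (p.coeff n) =
        p.coeff n • MvPolynomial.monomial n (1 : ℚ) := by
      rw [MvPolynomial.smul_monomial, smul_eq_mul, mul_one]
    rw [e, map_smul]
    apply Submodule.smul_mem
    have h1 := mon_mem_span_standard h𝒢 (prod_chowVar_eq_zero (M := M) (𝒢 := 𝒢))
      sum_chowVar_eq_zero (m := n.embDomain (Function.Embedding.subtype _)) (by
        rw [Finsupp.support_embDomain]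
        intro G hG
        simp only [Finset.mem_map, Function.Embedding.subtype_apply] at hG
        obtain ⟨G', -, rfl⟩ := hG
        exact G'.2)
    change Ideal.Quotient.mk (chowIdeal M 𝒢) (MvPolynomial.monomial n 1) ∈ _
    rw [hmon]
    refine Submodule.span_mono ?_ h1
    rintro _ ⟨m, hm, hd, rfl⟩
    refine ⟨⟨m, mem_stdOfDegree.2 ⟨hm, ?_⟩⟩, rfl⟩
    rw [hd, ← hdeg, Finsupp.degree_apply, Finsupp.degree_apply, Finsupp.support_embDomain,
      Finset.sum_map]
    exact Finset.sum_congr rfl fun i _ =>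
      Finsupp.embDomain_apply_self (Function.Embedding.subtype (· ∈ 𝒢)) n i
  · rw [Submodule.span_le]
    rintro _ ⟨⟨m, hm⟩, rfl⟩
    rw [mem_stdOfDegree] at hm
    have hmem : ∀ G ∈ m.support, G ∈ 𝒢 := fun G hG => hm.1.support_subset hG
    refine ⟨MvPolynomial.monomial (m.subtypeDomain (· ∈ 𝒢)) 1, ?_, ?_⟩
    · rw [SetLike.mem_coe, MvPolynomial.mem_homogeneousSubmodule]
      apply MvPolynomial.isHomogeneous_monomial
      rw [← hm.2, Finsupp.degree_apply, Finsupp.degree_apply, Finsupp.support_subtypeDomain]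
      conv_rhs => rw [← Finset.subtype_map_of_mem (p := (· ∈ 𝒢)) hmem]
      rw [Finset.sum_map]
      simp
    · change Ideal.Quotient.mk (chowIdeal M 𝒢) _ = _
      rw [hmon]
      congr 1
      ext G
      by_cases hG : G ∈ 𝒢
      · have := Finsupp.embDomain_apply_self (Function.Embedding.subtype (· ∈ 𝒢))
          (m.subtypeDomain (· ∈ 𝒢)) ⟨G, hG⟩
        exact this
      · rw [Finsupp.embDomain_of_notMem_range]
        · by_contra h
          exact hG (hmem G (Finsupp.mem_support_iff.2 (Ne.symm h)))
        · rintro ⟨G', rfl⟩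
          exact hG G'.2

theorem finrank_chowPiece (k : ℕ) :
    Module.finrank ℚ (chowPiece M 𝒢 k) = (stdOfDegree M 𝒢 k).card := by
  rw [chowPiece_eq_span h𝒢, finrank_span_eq_card (linearIndependent_mon h𝒢 k), Fintype.card_coe]

end

/-- The polynomial `t + t² + ⋯ + t^{d-1}`. -/
def truncGeom (d : ℕ) : ℝ[X] := ∑ a ∈ Finset.Ico 1 d, X ^ a

theorem sum_finsupp_eq_prod (N : Finset (Set α)) (t : Set α → Finset ℕ) :
    ∑ m ∈ N.finsupp t, (X : ℝ[X]) ^ m.degree = ∏ G ∈ N, ∑ a ∈ t G, X ^ a := by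
  rw [Finset.prod_sum, Finset.finsupp, Finset.sum_map]
  apply Finset.sum_congr rfl
  intro f _
  rw [Finset.prod_pow_eq_pow_sum]
  congr 1
  rw [Finsupp.degree_apply]
  change ∑ i ∈ (Finsupp.indicator N f).support, Finsupp.indicator N f i = _
  rw [Finset.sum_subset (Finsupp.support_indicator_subset N f)]
  · rw [← Finset.sum_attach]
    apply Finset.sum_congr rfl
    intro G _
    exact Finsupp.indicator_of_mem G.2 _
  · intro G _ hG
    exact Finsupp.notMem_support_iff.1 hG

/-- The contribution of a nested set to the Hilbert–Poincaré series. -/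
def nestedWeight (M : Matroid α) (N : Finset (Set α)) : ℝ[X] := ∏ G ∈ N, truncGeom (gap M N G)

/-- For a fixed support `N` the exponents vary independently in `1 ≤ m G < gap M N G`, so the
generating function of the basis factors over `N`. -/
theorem chowSeries_eq [M.Loopless] [M.Finite] (h𝒢 : IsBuildingSet M 𝒢) :
    chowSeries M 𝒢 = ((∑ N ∈ nestedSets M 𝒢, nestedWeight M N : ℝ[X]) : PowerSeries ℝ) := by
  ext k
  rw [chowSeries, PowerSeries.coeff_mk, finrank_chowPiece h𝒢, Polynomial.coeff_coe]
  have h1 : ∑ N ∈ nestedSets M 𝒢, nestedWeight M N =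
      ∑ m ∈ (nestedSets M 𝒢).biUnion (stdExponents M), (X : ℝ[X]) ^ m.degree := by
    rw [Finset.sum_biUnion]
    · exact Finset.sum_congr rfl fun N _ => (sum_finsupp_eq_prod N _).symm
    · intro N _ N' _ hne
      rw [Function.onFun, Finset.disjoint_left]
      intro m hm hm'
      exact hne ((mem_stdExponents.1 hm).1.symm.trans (mem_stdExponents.1 hm').1)
  rw [h1, finsetSum_coeff, stdOfDegree, Finset.card_filter]
  push_cast
  apply Finset.sum_congr rfl
  intro m _
  rw [coeff_X_pow]
  simp [eq_comm]

end

section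

variable {α : Type*} {M : Matroid α} {𝒢 : Finset (Set α)}

/-! ### Maximal nested sets -/

/-- The members of `S` strictly below `G`. -/
abbrev lower (S : Finset (Set α)) (G : Set α) : Set (Set α) := {H | H ∈ S ∧ H ⊂ G}

theorem lower_subset (S : Finset (Set α)) (G : Set α) : lower S G ⊆ S := fun _ h => h.1

/-- The maximal elements of the building set. -/
def maxElts (𝒢 : Finset (Set α)) : Finset (Set α) := 𝒢.filter (Maximal (· ∈ 𝒢))

theorem exists_maxElts {G : Set α} (hG : G ∈ 𝒢) : ∃ g ∈ maxElts 𝒢, G ⊆ g := by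
  obtain ⟨g, hGg, hg⟩ := 𝒢.exists_le_maximal hG
  exact ⟨g, Finset.mem_filter.2 ⟨hg.prop, hg⟩, hGg⟩

section
variable [M.Loopless] [M.Finite] (h𝒢 : IsBuildingSet M 𝒢)
include h𝒢

theorem subset_lowerJoin {S : Finset (Set α)} (hS : S ⊆ 𝒢) {G H : Set α} (hH : H ∈ S)
    (hHG : H ⊂ G) : H ⊆ lowerJoin M S G :=
  (Set.subset_sUnion_of_mem (show H ∈ lower S G from ⟨hH, hHG⟩)).trans
    (M.subset_closure _ (sUnion_subset_ground h𝒢 ((lower_subset S G).trans (by exact_mod_cast hS))))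

theorem lowerJoin_subset (S : Finset (Set α)) {G : Set α} (hG : G ∈ 𝒢) :
    lowerJoin M S G ⊆ G := by
  have := M.closure_subset_closure (X := ⋃₀ lower S G) (Y := G)
    (Set.sUnion_subset fun H hH => hH.2.subset)
  rwa [(h𝒢.isFlat G hG).closure] at this

theorem IsNested.not_subset_lowerJoin {S : Finset (Set α)} (hS : IsNested M 𝒢 S) {G : Set α}
    (hG : G ∈ 𝒢) : ¬ G ⊆ lowerJoin M S G := by
  intro h
  obtain ⟨n, hn, hGn⟩ := hS.exists_subset h𝒢 (lower_subset S G) hG h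
  exact hn.2.not_subset hGn

theorem IsNested.rk_eq {S : Finset (Set α)} {G : Set α}
    (hG : G ∈ 𝒢) : rk M G = rk M (lowerJoin M S G) + gap M S G := by
  have := rk_mono (M := M) (lowerJoin_subset h𝒢 S hG)
  rw [gap]
  rw [lowerJoin, rk_closure] at this ⊢
  omega

theorem IsNested.gap_pos {S : Finset (Set α)} (hS : IsNested M 𝒢 S) {G : Set α}
    (hG : G ∈ 𝒢) : 0 < gap M S G := by
  by_contra hcon
  have h1 := IsNested.rk_eq h𝒢 (S := S) hG
  have h2 := closure_eq_of_rk_le (M := M) (lowerJoin_subset h𝒢 S hG) (by omega)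
  rw [(h𝒢.isFlat G hG).closure, lowerJoin, M.closure_closure] at h2
  exact hS.not_subset_lowerJoin h𝒢 hG h2.ge

/-- Let `T` contain `D` and have its join in `𝒢`. If another member of `T` contains `G`, then `D` is
redundant. If another member is not below `G`, replacing `D` by `G` gives a forbidden join in `S`.
Otherwise `T` lies below `F`, and its join meets the factor `D`, so it is contained in `D`. -/
theorem IsNested.insert_factor {S : Finset (Set α)} (hS : IsNested M 𝒢 S) {G F D : Set α}
    (hG : G ∈ S) (hF : M.IsFlat F) (hJF : lowerJoin M S G ⊆ F) (hFG : F ⊂ G)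
    (hD : D ∈ factors 𝒢 F) (hDJ : ¬ D ⊆ lowerJoin M S G) : IsNested M 𝒢 (insert D S) := by
  have hDG := mem_of_mem_factors hD
  refine isNested_of_closure_mem h𝒢 (Finset.insert_subset hDG.1 hS.1) ?_
  intro T hT hC
  have hTG : T ⊆ 𝒢 := hT.trans (by exact_mod_cast Finset.insert_subset hDG.1 hS.1)
  have hTE := sUnion_subset_ground h𝒢 hTG
  have hTs := M.subset_closure _ hTE
  have hTS : ∀ t ∈ T, t ≠ D → t ∈ S := fun t ht hne =>
    (Finset.mem_insert.1 (by exact_mod_cast hT ht)).resolve_left hne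
  by_cases hDT : D ∈ T
  swap
  · exact hS.closure_mem h𝒢 (fun t ht => hTS t ht fun h => hDT (h ▸ ht)) hC
  have hDsubG : D ⊆ G := hDG.2.trans hFG.subset
  by_cases h1 : ∃ t ∈ T, t ≠ D ∧ G ⊆ t
  · obtain ⟨t, ht, htD, hGt⟩ := h1
    have hcup : ⋃₀ T = ⋃₀ (T \ {D}) := by
      apply subset_antisymm
      · apply Set.sUnion_subset
        intro s hs
        by_cases hsD : s = D
        · rw [hsD]
          exact (hDsubG.trans hGt).trans (Set.subset_sUnion_of_mem ⟨ht, htD⟩)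
        · exact Set.subset_sUnion_of_mem ⟨hs, hsD⟩
      · exact Set.sUnion_subset_sUnion Set.sdiff_subset
    rw [hcup] at hC ⊢
    exact (hS.closure_mem h𝒢 (fun s hs => hTS s hs.1 hs.2) hC).1
  push Not at h1
  by_cases h2 : ∃ t ∈ T, t ≠ D ∧ ¬ t ⊆ G
  · exfalso
    obtain ⟨t, ht, htD, htG⟩ := h2
    obtain ⟨x, hx⟩ := building_nonempty h𝒢 hDG.1
    have hj := closure_union_mem h𝒢 hC (hS.1 hG) (hTs ⟨D, hDT, hx⟩) (hDsubG hx)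
    have hcup : ⋃₀ T ∪ G = ⋃₀ (insert G (T \ {D})) := by
      rw [Set.sUnion_insert]
      apply subset_antisymm
      · apply Set.union_subset _ Set.subset_union_left
        apply Set.sUnion_subset
        intro s hs
        by_cases hsD : s = D
        · rw [hsD]
          exact hDsubG.trans Set.subset_union_left
        · exact (Set.subset_sUnion_of_mem (show s ∈ T \ {D} from ⟨hs, hsD⟩)).trans
            Set.subset_union_right
      · exact Set.union_subset Set.subset_union_right
          ((Set.sUnion_subset_sUnion Set.sdiff_subset).trans Set.subset_union_left)
    rw [M.closure_union_closure_left_eq, hcup] at hj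
    have hsub : insert G (T \ {D}) ⊆ (S : Set (Set α)) := by
      rintro s (rfl | hs)
      · exact hG
      · exact hTS s hs.1 hs.2
    have hsE := sUnion_subset_ground h𝒢 (hsub.trans (by exact_mod_cast hS.1))
    have hmem : ∀ s ∈ insert G (T \ {D}), s ⊆ M.closure (⋃₀ (insert G (T \ {D}))) := fun s hs =>
      (Set.subset_sUnion_of_mem hs).trans (M.subset_closure _ hsE)
    rcases hS.closure_mem h𝒢 hsub hj with h | h
    · have := hmem t (Or.inr ⟨ht, htD⟩)
      rw [h] at this
      exact htG this
    · exact h1 _ h.1 h.2 (hmem G (Or.inl rfl))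
  · push Not at h2
    have hCF : M.closure (⋃₀ T) ⊆ F := by
      have := M.closure_subset_closure (X := ⋃₀ T) (Y := F) (by
        apply Set.sUnion_subset
        intro t ht
        by_cases htD : t = D
        · rw [htD]; exact hDG.2
        · exact (subset_lowerJoin h𝒢 hS.1 (hTS t ht htD) ⟨h2 t ht htD, h1 t ht htD⟩).trans hJF)
      rwa [hF.closure] at this
    obtain ⟨x, hx⟩ := building_nonempty h𝒢 hDG.1
    have hDC : D ⊆ M.closure (⋃₀ T) := (Set.subset_sUnion_of_mem hDT).trans hTs
    rwa [subset_antisymm (subset_factor h𝒢 hF hD hC hCF (hDC hx) hx) hDC]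

theorem IsNested.union_maxElts {N : Finset (Set α)} (hN : IsNested M 𝒢 N) :
    IsNested M 𝒢 (N ∪ maxElts 𝒢) := by
  have hsub : N ∪ maxElts 𝒢 ⊆ 𝒢 := Finset.union_subset hN.1 (Finset.filter_subset _ _)
  refine isNested_of_closure_mem h𝒢 hsub ?_
  intro T hT hC
  have hTE := sUnion_subset_ground h𝒢 (hT.trans (by exact_mod_cast hsub))
  by_cases h : ∃ t ∈ T, t ∈ maxElts 𝒢
  · obtain ⟨t, ht, htm⟩ := h
    have hts := (Set.subset_sUnion_of_mem ht).trans (M.subset_closure _ hTE)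
    have := subset_antisymm hts ((Finset.mem_filter.1 htm).2.2 hC hts)
    rwa [← this]
  · push Not at h
    refine hN.closure_mem h𝒢 (fun t ht => ?_) hC
    exact (Finset.mem_union.1 (by exact_mod_cast hT ht)).resolve_right (h t ht)

theorem IsMaxNested.maxElts_subset {S : Finset (Set α)} (hS : IsMaxNested M 𝒢 S) :
    maxElts 𝒢 ⊆ S :=
  Finset.subset_union_right.trans (hS.2 (hS.1.union_maxElts h𝒢) Finset.subset_union_left)

/-- Were the corank larger, adjoining one point to the lower join would give a flat strictly below
`G`; the factor of this flat at the new point could be added to `S`. -/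
theorem IsMaxNested.rk_eq {S : Finset (Set α)} (hS : IsMaxNested M 𝒢 S) {G : Set α} (hG : G ∈ S) :
    rk M G = rk M (lowerJoin M S G) + 1 := by
  have hGG := hS.1.1 hG
  have h1 := IsNested.rk_eq h𝒢 (S := S) hGG
  have h2 := hS.1.gap_pos h𝒢 hGG
  by_contra hne
  obtain ⟨x, hxG, hxJ⟩ := Set.not_subset.1 (hS.1.not_subset_lowerJoin h𝒢 hGG)
  have hGE := building_subset_ground h𝒢 hGG
  have hxE := hGE hxG
  have hJ : M.IsFlat (lowerJoin M S G) := M.isFlat_closure _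
  set F := M.closure (insert x (lowerJoin M S G)) with hFdef
  have hrF : rk M F = rk M (lowerJoin M S G) + 1 := by
    rw [hFdef, rk_closure, rk_insert hxE (by rwa [hJ.closure])]
  have hins : insert x (lowerJoin M S G) ⊆ G := Set.insert_subset hxG (lowerJoin_subset h𝒢 S hGG)
  have hFs := M.subset_closure (insert x (lowerJoin M S G)) (hins.trans hGE)
  have hFG : F ⊂ G := by
    refine ⟨?_, fun h => ?_⟩
    · have := M.closure_subset_closure hins
      rwa [(h𝒢.isFlat G hGG).closure] at this
    · have := rk_mono (M := M) h
      omega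
  obtain ⟨D, hD, hxD⟩ := subset_sUnion_factors h𝒢 (M.isFlat_closure _) (hFs (Set.mem_insert _ _))
  have hDG := mem_of_mem_factors hD
  have hDJ : ¬ D ⊆ lowerJoin M S G := fun h => hxJ (h hxD)
  have hn := hS.1.insert_factor h𝒢 hG (M.isFlat_closure _)
    ((Set.subset_insert _ _).trans hFs) hFG hD hDJ
  have hDS : D ∈ S := hS.2 hn (Finset.subset_insert _ _) (Finset.mem_insert_self _ _)
  exact hDJ (subset_lowerJoin h𝒢 hS.1.1 hDS (hDG.2.trans_ssubset hFG))

theorem IsMaxNested.gap_eq_one {S : Finset (Set α)} (hS : IsMaxNested M 𝒢 S) {G : Set α}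
    (hG : G ∈ S) : gap M S G = 1 := by
  have h1 := IsNested.rk_eq h𝒢 (S := S) (hS.1.1 hG)
  have h2 := hS.rk_eq h𝒢 hG
  omega

/-- Suppose `H` could be added, and let `G` be the least member of `N` above it. `H` is not below
the lower join of `G`, which has corank one, so `H` together with that join spans `G`; this join is
forbidden in a nested set. -/
theorem IsNested.isMaxNested {N : Finset (Set α)} (hN : IsNested M 𝒢 N) (hmax : maxElts 𝒢 ⊆ N)
    (hgap : ∀ G ∈ N, gap M N G ≤ 1) : IsMaxNested M 𝒢 N := by
  refine ⟨hN, fun S hS hNS H hHS => ?_⟩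
  by_contra hHN
  obtain ⟨g, hg, hHg⟩ := exists_maxElts (hS.1 hHS)
  obtain ⟨G, hGmin⟩ := (N.filter (H ⊆ ·)).exists_minimal
    ⟨g, Finset.mem_filter.2 ⟨hmax hg, hHg⟩⟩
  have hG := Finset.mem_filter.1 hGmin.prop
  have hGG := hN.1 hG.1
  have hHG : H ⊂ G := hG.2.ssubset_of_ne fun h => hHN (h ▸ hG.1)
  have hHJ : ¬ H ⊆ lowerJoin M N G := by
    intro h
    obtain ⟨n, hn, hHn⟩ := hN.exists_subset h𝒢 (lower_subset N G) (hS.1 hHS) h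
    exact hn.2.not_subset (hGmin.2 (Finset.mem_filter.2 ⟨hn.1, hHn⟩) hn.2.subset)
  have hT : ⋃₀ (insert H (lower N G)) ⊆ G := by
    rw [Set.sUnion_insert]
    exact Set.union_subset hHG.subset (Set.sUnion_subset fun s hs => hs.2.subset)
  have hr1 : rk M (lowerJoin M N G) < rk M (⋃₀ (insert H (lower N G))) := by
    by_contra hcon
    rw [lowerJoin, rk_closure] at hcon
    have := closure_eq_of_rk_le (M := M) (Set.sUnion_subset_sUnion (Set.subset_insert H (lower N G)))
      (not_lt.1 hcon)
    apply hHJ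
    rw [lowerJoin, this]
    exact (Set.subset_sUnion_of_mem (Set.mem_insert _ _)).trans
      (M.subset_closure _ (hT.trans (building_subset_ground h𝒢 hGG)))
  have h1 := IsNested.rk_eq h𝒢 (S := N) hGG
  have h2 := hgap G hG.1
  have h3 := closure_eq_of_rk_le (M := M) hT (by omega)
  rw [(h𝒢.isFlat G hGG).closure] at h3
  have hsub : insert H (lower N G) ⊆ (S : Set (Set α)) := by
    rintro s (rfl | hs)
    · exact hHS
    · exact hNS hs.1
  have := hS.closure_mem h𝒢 hsub (by rw [h3]; exact hGG)
  rw [h3] at this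
  rcases this with h | h
  · exact hHG.ne h.symm
  · exact h.2.ne rfl

/-- A maximal member `G` of `N` is a factor of the join, hence modular, and it meets the union of
the rest exactly in the members below it. Removing it lowers the rank by its gap. -/
theorem IsNested.rk_sU_eq (n : ℕ) : ∀ N : Finset (Set α), N.card = n → IsNested M 𝒢 N →
    rk M (sU N) = ∑ G ∈ N, gap M N G := by
  induction n with
  | zero =>
    intro N hcard _
    rw [Finset.card_eq_zero.1 hcard]
    simp [sU, rk_empty]
  | succ n ih =>
    intro N hcard hN
    obtain ⟨G, hGmax⟩ := N.exists_maximal (Finset.card_pos.1 (by omega))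
    have hG : G ∈ N := hGmax.prop
    have hins : insert G (N.erase G) = N := Finset.insert_erase hG
    have hN' : IsNested M 𝒢 (N.erase G) := hN.mono (Finset.erase_subset _ _)
    have ih' := ih (N.erase G) (by rw [Finset.card_erase_of_mem hG]; omega) hN'
    have hnot : ∀ n ∈ N.erase G, ¬ G ⊆ n := by
      intro n hn h
      rw [Finset.mem_erase] at hn
      exact hn.1 (subset_antisymm (hGmax.2 hn.2 h) h)
    have hfac := mem_factors_of_isNested h𝒢 (by rwa [hins]) hnot
    have hE := sU_subset_ground h𝒢 hN.1
    have h1 := rk_factor_union_add h𝒢 (M.isFlat_closure _) hfac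
      (X := sU (N.erase G)) (by
        rw [hins]
        exact (sU_mono (Finset.erase_subset _ _)).trans (M.subset_closure _ hE))
    have h2 : sU (N.erase G) ∩ G = ⋃₀ lower N G := by
      ext y
      constructor
      · rintro ⟨⟨n, hn, hyn⟩, hyG⟩
        have hn' : n ∈ N.erase G := hn
        rw [Finset.mem_erase] at hn'
        refine ⟨n, ⟨hn'.2, ?_⟩, hyn⟩
        rcases hN.subset_or_subset h𝒢 hn'.2 hG hyn hyG with h | h
        · exact h.ssubset_of_ne hn'.1
        · exact absurd h (hnot n hn)
      · rintro ⟨n, hn, hyn⟩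
        exact ⟨⟨n, Finset.mem_coe.2 (Finset.mem_erase.2 ⟨hn.2.ne, hn.1⟩), hyn⟩, hn.2.subset hyn⟩
    have h3 : ∀ H ∈ N.erase G, gap M (N.erase G) H = gap M N H := by
      intro H hH
      have : lower (N.erase G) H = lower N H := by
        ext K
        simp only [Set.mem_ofPred_eq, Finset.mem_erase]
        constructor
        · rintro ⟨h, h'⟩; exact ⟨h.2, h'⟩
        · rintro ⟨h, h'⟩
          refine ⟨⟨?_, h⟩, h'⟩
          rintro rfl
          exact hnot H hH h'.subset
      rw [gap, gap]
      change rk M H - rk M (⋃₀ lower (N.erase G) H) = rk M H - rk M (⋃₀ lower N H)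
      rw [this]
    rw [← Finset.add_sum_erase N _ hG, ← Finset.sum_congr rfl h3, ← ih']
    have h4 := IsNested.rk_eq h𝒢 (S := N) (hN.1 hG)
    rw [lowerJoin, rk_closure] at h4
    rw [← sU_insert, hins, h2] at h1
    change _ = rk M (⋃₀ lower N G) + _ at h4
    omega

theorem IsMaxNested.card_eq {S : Finset (Set α)} (hS : IsMaxNested M 𝒢 S) :
    S.card = rk M M.E := by
  have h1 := IsNested.rk_sU_eq h𝒢 _ S rfl hS.1
  rw [Finset.sum_congr rfl fun G hG => hS.gap_eq_one h𝒢 hG, Finset.sum_const, smul_eq_mul,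
    mul_one] at h1
  rw [← h1]
  congr 1
  apply subset_antisymm (sU_subset_ground h𝒢 hS.1.1)
  intro x hx
  obtain ⟨g, hg, h⟩ := exists_maxElts (closure_singleton_mem h𝒢 hx)
  exact ⟨g, Finset.mem_coe.2 (hS.maxElts_subset h𝒢 hg), h (M.mem_closure_self x)⟩

/-! ### Parents and children -/

theorem IsNested.exists_isParent {S : Finset (Set α)} (hS : IsNested M 𝒢 S) {G H : Set α}
    (hG : G ∈ S) (hH : H ∈ S) (hGH : G ⊂ H) : ∃ P, IsParent S G P := by
  obtain ⟨P, hPmin⟩ := (S.filter (G ⊂ ·)).exists_minimal ⟨H, Finset.mem_filter.2 ⟨hH, hGH⟩⟩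
  have hP := Finset.mem_filter.1 hPmin.prop
  refine ⟨P, hP, fun Q hQ => ?_⟩
  obtain ⟨x, hx⟩ := building_nonempty h𝒢 (hS.1 hG)
  rcases hS.subset_or_subset h𝒢 hP.1 hQ.1 (hP.2.subset hx) (hQ.2.subset hx) with h | h
  · exact h
  · exact hPmin.2 (Finset.mem_filter.2 hQ) h

theorem IsNested.exists_child {S : Finset (Set α)} (hS : IsNested M 𝒢 S) {G H : Set α}
    (hG : G ∈ S) (hH : H ∈ S) (hHG : H ⊂ G) : ∃ C ∈ S, IsParent S C G ∧ H ⊆ C := by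
  obtain ⟨C, hCmax⟩ := (S.filter fun C => C ⊂ G ∧ H ⊆ C).exists_maximal
    ⟨H, Finset.mem_filter.2 ⟨hH, hHG, subset_rfl⟩⟩
  have hC := Finset.mem_filter.1 hCmax.prop
  refine ⟨C, hC.1, ⟨⟨hG, hC.2.1⟩, fun Q hQ => ?_⟩, hC.2.2⟩
  obtain ⟨x, hx⟩ := building_nonempty h𝒢 (hS.1 hC.1)
  rcases hS.subset_or_subset h𝒢 hG hQ.1 (hC.2.1.subset hx) (hQ.2.subset hx) with h | h
  · exact h
  · by_contra hcon
    exact hQ.2.not_subset (hCmax.2 (Finset.mem_filter.2 ⟨hQ.1, ⟨h, hcon⟩,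
      hC.2.2.trans hQ.2.subset⟩) hQ.2.subset)

omit [M.Loopless] [M.Finite] h𝒢 in
theorem IsParent.not_ssubset {S : Finset (Set α)} {C G H : Set α} (h : IsParent S C G)
    (hH : H ∈ S) (hHG : H ⊂ G) : ¬ C ⊂ H := fun hCH => hHG.not_subset (h.2 ⟨hH, hCH⟩)

omit [M.Loopless] [M.Finite] h𝒢 in
theorem IsParent.eq_of_subset {S : Finset (Set α)} {C G H : Set α} (h : IsParent S C G)
    (hH : H ∈ S) (hHG : H ⊂ G) (hCH : C ⊆ H) : C = H := by
  by_contra hne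
  exact h.not_ssubset hH hHG (hCH.ssubset_of_ne hne)

/-! ### Labels -/

section Label
variable [LinearOrder α]

/-- The lower join has corank one in `G`, so every point of `G` outside it completes it to `G`. -/
theorem IsMaxNested.isLabel_iff {S : Finset (Set α)} (hS : IsMaxNested M 𝒢 S) {G : Set α}
    (hG : G ∈ S) {e : α} : IsLabel M S G e ↔ IsLeast (G \ lowerJoin M S G) e := by
  have hGG := hS.1.1 hG
  have hJ : M.IsFlat (lowerJoin M S G) := M.isFlat_closure _
  have hJG := lowerJoin_subset h𝒢 S hGG
  have hGE := building_subset_ground h𝒢 hGG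
  have : {x | x ∈ M.E ∧ M.closure (insert x (lowerJoin M S G)) = G} = G \ lowerJoin M S G := by
    ext x
    constructor
    · rintro ⟨hxE, hcl⟩
      refine ⟨?_, fun hx => ?_⟩
      · rw [← hcl]
        exact M.mem_closure_of_mem' (Set.mem_insert _ _) hxE
      · rw [Set.insert_eq_of_mem hx, hJ.closure] at hcl
        exact hS.1.not_subset_lowerJoin h𝒢 hGG hcl.ge
    · rintro ⟨hxG, hxJ⟩
      refine ⟨hGE hxG, ?_⟩
      rw [closure_eq_of_rk_le (Y := G) (Set.insert_subset hxG hJG), (h𝒢.isFlat G hGG).closure]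
      rw [rk_insert (hGE hxG) (by rwa [hJ.closure]), hS.rk_eq h𝒢 hG]
  rw [IsLabel, this]

omit [M.Loopless] h𝒢 in
theorem exists_isLeast {s : Set α} (hs : s.Nonempty) (hsE : s ⊆ M.E) : ∃ e, IsLeast s e := by
  obtain ⟨a, ha, h⟩ := Set.exists_min_image s id (M.ground_finite.subset hsE) hs
  exact ⟨a, ha, fun b hb => h b hb⟩

omit [M.Loopless] h𝒢 in
theorem exists_isGreatest {s : Set α} (hs : s.Nonempty) (hsE : s ⊆ M.E) : ∃ e, IsGreatest s e := by
  obtain ⟨a, ha, h⟩ := Set.exists_max_image s id (M.ground_finite.subset hsE) hs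
  exact ⟨a, ha, fun b hb => h b hb⟩

theorem IsMaxNested.exists_isLeast {S : Finset (Set α)} (hS : IsMaxNested M 𝒢 S) {G : Set α}
    (hG : G ∈ S) : ∃ e, IsLeast (G \ lowerJoin M S G) e := by
  obtain ⟨x, hxG, hxJ⟩ := Set.not_subset.1 (hS.1.not_subset_lowerJoin h𝒢 (hS.1.1 hG))
  exact BuiltMatroid.exists_isLeast ⟨x, hxG, hxJ⟩
    (Set.sdiff_subset.trans (building_subset_ground h𝒢 (hS.1.1 hG)))

theorem IsMaxNested.lt_of_not_isDescent {S : Finset (Set α)} (hS : IsMaxNested M 𝒢 S) {G P : Set α}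
    (hG : G ∈ S) (hP : IsParent S G P) (hnd : ¬ IsDescent M S G) {a b : α}
    (ha : IsLeast (G \ lowerJoin M S G) a) (hb : IsLeast (P \ lowerJoin M S P) b) : a < b := by
  have hle : a ≤ b := by
    by_contra hcon
    exact hnd ⟨hG, P, hP, a, b, (hS.isLabel_iff h𝒢 hG).2 ha, (hS.isLabel_iff h𝒢 hP.1.1).2 hb,
      not_le.1 hcon⟩
  refine lt_of_le_of_ne hle ?_
  rintro rfl
  exact hb.1.2 (subset_lowerJoin h𝒢 hS.1.1 hG hP.1.2 ha.1.1)

/-- As long as the path from `H` up to `G` avoids `N` it meets no descent, so the labels increase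
along it. The induction is on the number of members above `H`. -/
theorem label_lt {S N : Finset (Set α)} (hS : IsMaxNested M 𝒢 S)
    (hdes : ∀ G, IsDescent M S G → G ∈ N) {G : Set α} (hG : G ∈ S) {l : α}
    (hl : IsLeast (G \ lowerJoin M S G) l) (n : ℕ) : ∀ H ∈ S, (S.filter (H ⊂ ·)).card = n → H ⊂ G →
    (∀ m ∈ N, H ⊆ m → ¬ m ⊂ G) → ∀ a, IsLeast (H \ lowerJoin M S H) a → a < l := by
  induction n using Nat.strong_induction_on with
  | _ n ih =>
    intro H hH hn hHG hHN a ha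
    obtain ⟨P, hP⟩ := hS.1.exists_isParent h𝒢 hH hG hHG
    have hPG : P ⊆ G := hP.2 ⟨hG, hHG⟩
    have hnd : ¬ IsDescent M S H := fun h => hHN H (hdes H h) subset_rfl hHG
    obtain ⟨b, hb⟩ := hS.exists_isLeast h𝒢 hP.1.1
    have hab := hS.lt_of_not_isDescent h𝒢 hH hP hnd ha hb
    by_cases hPe : P = G
    · subst hPe
      rwa [← hb.unique hl]
    · refine hab.trans (ih _ ?_ P hP.1.1 rfl (hPG.ssubset_of_ne hPe)
        (fun m hm hPm => hHN m hm (hP.1.2.subset.trans hPm)) b hb)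
      rw [← hn]
      apply Finset.card_lt_card
      refine ⟨fun Q hQ => ?_, fun h => ?_⟩
      · rw [Finset.mem_filter] at hQ ⊢
        exact ⟨hQ.1, hP.1.2.trans hQ.2⟩
      · have := h (Finset.mem_filter.2 hP.1)
        exact (Finset.mem_filter.1 this).2.ne rfl

/-- A member `H ⊂ G` of `S` is either below a member of `N` that is below `G`, or it is spanned by
its own label, which is smaller than `l`, and by the members below it. Conversely, minimality of `l`
puts all smaller points of `G` into the lower join. -/
theorem lowerJoin_eq {S N : Finset (Set α)} (hS : IsMaxNested M 𝒢 S) (hNS : N ⊆ S)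
    (hdes : ∀ G, IsDescent M S G → G ∈ N) {G : Set α} (hG : G ∈ S) {l : α}
    (hl : IsLeast (G \ lowerJoin M S G) l) :
    lowerJoin M S G = M.closure (lowerJoin M N G ∪ {x | x ∈ G \ lowerJoin M N G ∧ x < l}) := by
  have hGG := hS.1.1 hG
  have hGE := building_subset_ground h𝒢 hGG
  have hJE : lowerJoin M N G ⊆ M.E := M.closure_subset_ground _
  set Y := lowerJoin M N G ∪ {x | x ∈ G \ lowerJoin M N G ∧ x < l} with hY
  have hYE : Y ⊆ M.E := Set.union_subset hJE fun x hx => hGE hx.1.1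
  have hYs := M.subset_closure Y hYE
  apply subset_antisymm
  · have key : ∀ n, ∀ H ∈ S, (S.filter (· ⊂ H)).card = n → H ⊂ G → H ⊆ M.closure Y := by
      intro n
      induction n using Nat.strong_induction_on with
      | _ n ih =>
        intro H hH hn hHG
        by_cases hex : ∃ m ∈ N, H ⊆ m ∧ m ⊂ G
        · obtain ⟨m, hm, hHm, hmG⟩ := hex
          exact (hHm.trans (subset_lowerJoin h𝒢 (hNS.trans hS.1.1) hm hmG)).trans
            (Set.subset_union_left.trans hYs)
        · push Not at hex
          obtain ⟨a, ha⟩ := hS.exists_isLeast h𝒢 hH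
          have hal := label_lt h𝒢 hS hdes hG hl _ H hH rfl hHG hex a ha
          have hcl := ((hS.isLabel_iff h𝒢 hH).2 ha).1.2
          rw [← hcl]
          apply M.closure_subset_closure_of_subset_closure
          apply Set.insert_subset
          · by_cases haJ : a ∈ lowerJoin M N G
            · exact hYs (Or.inl haJ)
            · exact hYs (Or.inr ⟨⟨hHG.subset ha.1.1, haJ⟩, hal⟩)
          · apply M.closure_subset_closure_of_subset_closure
            apply Set.sUnion_subset
            rintro K ⟨hK, hKH⟩
            refine ih _ ?_ K hK rfl (hKH.trans hHG)
            rw [← hn]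
            apply Finset.card_lt_card
            refine ⟨fun Q hQ => ?_, fun h => ?_⟩
            · rw [Finset.mem_filter] at hQ ⊢
              exact ⟨hQ.1, hQ.2.trans hKH⟩
            · exact (Finset.mem_filter.1 (h (Finset.mem_filter.2 ⟨hK, hKH⟩))).2.ne rfl
    apply M.closure_subset_closure_of_subset_closure
    exact Set.sUnion_subset fun H hH => key _ H hH.1 rfl hH.2
  · have hJ : M.IsFlat (lowerJoin M S G) := M.isFlat_closure _
    have := M.closure_subset_closure (X := Y) (Y := lowerJoin M S G) (by
      apply Set.union_subset
      · exact M.closure_subset_closure (Set.sUnion_subset_sUnion fun H hH => ⟨hNS hH.1, hH.2⟩)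
      · rintro x ⟨hx, hxl⟩
        by_contra hxJ
        exact not_le.2 hxl (hl.2 ⟨hx.1, hxJ⟩))
    rwa [hJ.closure] at this

/-! ### Completeness and the completion of a nested set -/

variable (hc : IsComplete M 𝒢)
include hc

theorem IsComplete.exists_eq_closure {F G Y : Set α} (hF : M.IsFlat F) (hG : G ∈ 𝒢) (hFG : F ⊆ G)
    {b : α} (hYdef : Y = {x | x ∈ G \ F ∧ x < b}) (hne : Y.Nonempty) :
    M.closure (F ∪ Y) = F ∨ ∃ H ∈ 𝒢, H ⊆ G ∧ M.closure (F ∪ Y) = M.closure (F ∪ H) := by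
  have hGE := building_subset_ground h𝒢 hG
  obtain ⟨e, he⟩ := exists_isGreatest (M := M) hne (by
    rw [hYdef]; exact fun x hx => hGE hx.1.1)
  have heY : e ∈ G \ F ∧ e < b := by have := he.1; rwa [hYdef] at this
  have hYe : Y = {x | x ∈ G \ F ∧ x ≤ e} := by
    ext x
    constructor
    · intro hx
      have hx' := hx
      rw [hYdef] at hx'
      exact ⟨hx'.1, he.2 hx⟩
    · rintro ⟨hx, hxe⟩
      rw [hYdef]
      exact ⟨hx, hxe.trans_lt heY.2⟩
  have hmem : M.closure (F ∪ Y) ∈ orderChain M F G := Or.inr ⟨e, heY.1, by rw [← hYe]⟩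
  rcases hc F hF G hG hFG hmem with h | h
  · obtain ⟨⟨H, hH, hHG, heq⟩, -⟩ := h
    exact Or.inr ⟨H, hH, hHG, heq⟩
  · exact Or.inl h

/-- By `lowerJoin_eq` and completeness the lower join of `G` in `S` is the one in `N` joined with a
single `H ∈ 𝒢`. `H` lies below one child `C`, so every child of `G` lies below `C` or below a member
of `N`. -/
theorem eq_of_isParent_of_notMem {S N : Finset (Set α)} (hS : IsMaxNested M 𝒢 S) (hNS : N ⊆ S)
    (hdes : ∀ G, IsDescent M S G → G ∈ N) {G C₁ C₂ : Set α} (hC₁ : C₁ ∈ S) (hC₂ : C₂ ∈ S)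
    (h₁ : IsParent S C₁ G) (h₂ : IsParent S C₂ G) (hn₁ : C₁ ∉ N) (hn₂ : C₂ ∉ N) : C₁ = C₂ := by
  have hG : G ∈ S := h₁.1.1
  have hGG := hS.1.1 hG
  have hGE := building_subset_ground h𝒢 hGG
  obtain ⟨l, hl⟩ := hS.exists_isLeast h𝒢 hG
  have heq := lowerJoin_eq h𝒢 hS hNS hdes hG hl
  have hJ : M.IsFlat (lowerJoin M N G) := M.isFlat_closure _
  have hN := hS.1.mono hNS
  have hlowN : ∀ C ∈ S, IsParent S C G → C ∉ N → ∀ n ∈ lower N G, ¬ C ⊆ n := by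
    intro C _ hCp hCN n hn hCn
    have := hCp.eq_of_subset (hNS hn.1) hn.2 hCn
    exact hCN (this ▸ hn.1)
  have hbad : ∀ C ∈ S, IsParent S C G → C ∉ N → ¬ C ⊆ lowerJoin M N G := by
    intro C hC hCp hCN h
    obtain ⟨n, hn, hCn⟩ := hN.exists_subset h𝒢 (lower_subset N G) (hS.1.1 hC) h
    exact hlowN C hC hCp hCN n hn hCn
  have hsubJ : ∀ C ∈ S, IsParent S C G → C ⊆ lowerJoin M S G := fun C hC hCp =>
    subset_lowerJoin h𝒢 hS.1.1 hC hCp.1.2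
  by_cases hne : {x | x ∈ G \ lowerJoin M N G ∧ x < l}.Nonempty
  swap
  · rw [Set.not_nonempty_iff_eq_empty.1 hne, Set.union_empty, hJ.closure] at heq
    exact absurd (heq ▸ hsubJ C₁ hC₁ h₁) (hbad C₁ hC₁ h₁ hn₁)
  rcases hc.exists_eq_closure h𝒢 hJ hGG (lowerJoin_subset h𝒢 N hGG) rfl hne with h | h
  · rw [h] at heq
    exact absurd (heq ▸ hsubJ C₁ hC₁ h₁) (hbad C₁ hC₁ h₁ hn₁)
  · obtain ⟨H, hH, hHG, hcl⟩ := h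
    rw [hcl] at heq
    have hHE := building_subset_ground h𝒢 hH
    have hHs : H ⊆ lowerJoin M S G := by
      rw [heq]
      exact Set.subset_union_right.trans (M.subset_closure _
        (Set.union_subset hJ.subset_ground hHE))
    obtain ⟨h, hh, hHh⟩ := hS.1.exists_subset h𝒢 (lower_subset S G) hH hHs
    obtain ⟨C, hC, hCp, hhC⟩ := hS.1.exists_child h𝒢 hG hh.1 hh.2
    have key : ∀ C' ∈ S, IsParent S C' G → C' ∉ N → C' = C := by
      intro C' hC' hCp' hCN'
      have hsub : insert C (lower N G) ⊆ (S : Set (Set α)) := by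
        rintro s (rfl | hs)
        · exact hC
        · exact hNS hs.1
      have hE := sUnion_subset_ground h𝒢 (hsub.trans (by exact_mod_cast hS.1.1))
      have hC'cl : C' ⊆ M.closure (⋃₀ (insert C (lower N G))) := by
        refine (hsubJ C' hC' hCp').trans ?_
        rw [heq]
        apply M.closure_subset_closure_of_subset_closure
        apply Set.union_subset
        · exact M.closure_subset_closure (Set.sUnion_subset_sUnion (Set.subset_insert _ _))
        · exact (hHh.trans hhC).trans ((Set.subset_sUnion_of_mem (Set.mem_insert _ _)).trans
            (M.subset_closure _ hE))
      obtain ⟨n, hn, hC'n⟩ := hS.1.exists_subset h𝒢 hsub (hS.1.1 hC') hC'cl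
      rcases hn with rfl | hn
      · exact hCp'.eq_of_subset hC hCp.1.2 hC'n
      · exact absurd hC'n (hlowN C' hC' hCp' hCN' n hn)
    rw [key C₁ hC₁ h₁ hn₁, key C₂ hC₂ h₂ hn₂]

-- Both lower joins arise from the same flat by adding initial segments of the same set, so they are
-- comparable; having corank one in `G`, they are equal.
omit hc in
theorem lowerJoin_unique {S₁ S₂ N : Finset (Set α)} (hS₁ : IsMaxNested M 𝒢 S₁)
    (hS₂ : IsMaxNested M 𝒢 S₂) (hN₁ : N ⊆ S₁) (hN₂ : N ⊆ S₂)
    (hd₁ : ∀ G, IsDescent M S₁ G → G ∈ N) (hd₂ : ∀ G, IsDescent M S₂ G → G ∈ N) {G : Set α}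
    (hG₁ : G ∈ S₁) (hG₂ : G ∈ S₂) : lowerJoin M S₁ G = lowerJoin M S₂ G := by
  obtain ⟨l₁, hl₁⟩ := hS₁.exists_isLeast h𝒢 hG₁
  obtain ⟨l₂, hl₂⟩ := hS₂.exists_isLeast h𝒢 hG₂
  have e₁ := lowerJoin_eq h𝒢 hS₁ hN₁ hd₁ hG₁ hl₁
  have e₂ := lowerJoin_eq h𝒢 hS₂ hN₂ hd₂ hG₂ hl₂
  have r₁ := hS₁.rk_eq h𝒢 hG₁
  have r₂ := hS₂.rk_eq h𝒢 hG₂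
  have f₁ : M.IsFlat (lowerJoin M S₁ G) := M.isFlat_closure _
  have f₂ : M.IsFlat (lowerJoin M S₂ G) := M.isFlat_closure _
  rcases le_total l₁ l₂ with h | h
  · have : lowerJoin M S₁ G ⊆ lowerJoin M S₂ G := by
      rw [e₁, e₂]
      exact M.closure_subset_closure (Set.union_subset_union_right _
        fun x hx => ⟨hx.1, hx.2.trans_le h⟩)
    have := closure_eq_of_rk_le (M := M) this (by omega)
    rwa [f₁.closure, f₂.closure] at this
  · have : lowerJoin M S₂ G ⊆ lowerJoin M S₁ G := by
      rw [e₁, e₂]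
      exact M.closure_subset_closure (Set.union_subset_union_right _
        fun x hx => ⟨hx.1, hx.2.trans_le h⟩)
    have := closure_eq_of_rk_le (M := M) this (by omega)
    rw [f₁.closure, f₂.closure] at this
    exact this.symm

-- From the top down: the maximal elements are common, and if a parent is common, then so is its
-- lower join, which determines the children as the maximal members below it.
omit hc in
theorem isMaxNested_unique {S₁ S₂ N : Finset (Set α)} (hS₁ : IsMaxNested M 𝒢 S₁)
    (hS₂ : IsMaxNested M 𝒢 S₂) (hN₁ : N ⊆ S₁) (hN₂ : N ⊆ S₂)
    (hd₁ : ∀ G, IsDescent M S₁ G → G ∈ N) (hd₂ : ∀ G, IsDescent M S₂ G → G ∈ N) : S₁ = S₂ := by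
  have key : ∀ n, ∀ H ∈ S₁, (S₁.filter (H ⊂ ·)).card = n → H ∈ S₂ := by
    intro n
    induction n using Nat.strong_induction_on with
    | _ n ih =>
      intro H hH hn
      obtain ⟨g, hg, hHg⟩ := exists_maxElts (hS₁.1.1 hH)
      by_cases hHg' : H = g
      · rw [hHg']; exact hS₂.maxElts_subset h𝒢 hg
      obtain ⟨P, hP⟩ := hS₁.1.exists_isParent h𝒢 hH (hS₁.maxElts_subset h𝒢 hg)
        (hHg.ssubset_of_ne hHg')
      have hP₂ : P ∈ S₂ := by
        refine ih _ ?_ P hP.1.1 rfl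
        rw [← hn]
        apply Finset.card_lt_card
        refine ⟨fun Q hQ => ?_, fun h => ?_⟩
        · rw [Finset.mem_filter] at hQ ⊢
          exact ⟨hQ.1, hP.1.2.trans hQ.2⟩
        · exact (Finset.mem_filter.1 (h (Finset.mem_filter.2 hP.1))).2.ne rfl
      have heq := lowerJoin_unique h𝒢 hS₁ hS₂ hN₁ hN₂ hd₁ hd₂ hP.1.1 hP₂
      have h1 := subset_lowerJoin h𝒢 hS₁.1.1 hH hP.1.2
      rw [heq] at h1
      obtain ⟨D, hD, hHD⟩ := hS₂.1.exists_subset h𝒢 (lower_subset S₂ P) (hS₁.1.1 hH) h1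
      have h2 := subset_lowerJoin h𝒢 hS₂.1.1 hD.1 hD.2
      rw [← heq] at h2
      obtain ⟨D', hD', hDD'⟩ := hS₁.1.exists_subset h𝒢 (lower_subset S₁ P) (hS₂.1.1 hD.1) h2
      have h3 := hP.eq_of_subset hD'.1 hD'.2 (hHD.trans hDD')
      rw [subset_antisymm hHD (h3 ▸ hDD')]
      exact hD.1
  exact subset_antisymm (fun H hH => key _ H hH rfl)
    (hS₁.2 hS₂.1 fun H hH => key _ H hH rfl)

/-- While some `G ∈ N` has gap at least two, add a factor `D` of the last flat before `G` in its
order chain over `J`; completeness makes a suitable choice possible. The enlarged set is completed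
by induction, and `D` is then shown not to be a descent of the result. -/
theorem exists_isMaxNested (n : ℕ) : ∀ N : Finset (Set α), 𝒢.card - N.card = n → IsNested M 𝒢 N →
    maxElts 𝒢 ⊆ N → ∃ S, IsMaxNested M 𝒢 S ∧ N ⊆ S ∧ ∀ G, IsDescent M S G → G ∈ N := by
  induction n using Nat.strong_induction_on with
  | _ n ih =>
    intro N hn hN hmax
    by_cases hgap : ∀ G ∈ N, gap M N G ≤ 1
    · exact ⟨N, hN.isMaxNested h𝒢 hmax hgap, subset_rfl, fun G hG => hG.1⟩
    push Not at hgap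
    obtain ⟨G, hG, hgap⟩ := hgap
    have hGG := hN.1 hG
    have hGE := building_subset_ground h𝒢 hGG
    have hGf := h𝒢.isFlat G hGG
    set J := lowerJoin M N G with hJdef
    have hJ : M.IsFlat J := M.isFlat_closure _
    have hJG : J ⊆ G := lowerJoin_subset h𝒢 N hGG
    have hrk : rk M G = rk M J + gap M N G := IsNested.rk_eq h𝒢 hGG
    -- `b` is the point at which the order chain reaches `G`; it turns out to be the label of `G`.
    obtain ⟨b, hbleast⟩ : ∃ b, IsLeast
        {b | b ∈ G \ J ∧ M.closure (J ∪ {x | x ∈ G \ J ∧ x ≤ b}) = G} b := by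
      apply BuiltMatroid.exists_isLeast (M := M) _ (fun x hx => hGE hx.1.1)
      obtain ⟨x, hxG, hxJ⟩ := Set.not_subset.1 (hN.not_subset_lowerJoin h𝒢 hGG)
      obtain ⟨c, hc⟩ := exists_isGreatest (M := M) (s := G \ J) ⟨x, hxG, hxJ⟩
        (Set.sdiff_subset.trans hGE)
      refine ⟨c, hc.1, ?_⟩
      have : J ∪ {x | x ∈ G \ J ∧ x ≤ c} = G := by
        ext y
        constructor
        · rintro (h | h)
          · exact hJG h
          · exact h.1.1
        · intro hy
          by_cases hyJ : y ∈ J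
          · exact Or.inl hyJ
          · exact Or.inr ⟨⟨hy, hyJ⟩, hc.2 ⟨hy, hyJ⟩⟩
      rw [this, hGf.closure]
    set Y := {x | x ∈ G \ J ∧ x < b} with hY
    have hJYG : J ∪ Y ⊆ G := Set.union_subset hJG fun x hx => hx.1.1
    have hins : J ∪ {x | x ∈ G \ J ∧ x ≤ b} = insert b (J ∪ Y) := by
      ext y
      simp only [Set.mem_union, Set.mem_ofPred_eq, Set.mem_insert_iff, hY, le_iff_lt_or_eq]
      constructor
      · rintro (h | ⟨h, h' | h'⟩) <;> tauto
      · rintro (rfl | h | h)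
        · exact Or.inr ⟨hbleast.1.1, Or.inr rfl⟩
        · exact Or.inl h
        · exact Or.inr ⟨h.1, Or.inl h.2⟩
    have hGcl : M.closure (insert b (J ∪ Y)) = G := hins ▸ hbleast.1.2
    set K := M.closure (J ∪ Y) with hKdef
    have hK : M.IsFlat K := M.isFlat_closure _
    have hJYK : J ∪ Y ⊆ K := M.subset_closure _ (hJYG.trans hGE)
    have hrkK : rk M G ≤ rk M K + 1 := by
      rw [← hGcl, rk_closure, hKdef, rk_closure]
      by_cases hb : b ∈ M.closure (J ∪ Y)
      · have := rk_mono (M := M) (Set.insert_subset hb hJYK)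
        rw [rk_closure] at this
        omega
      · rw [rk_insert (hGE hbleast.1.1.1) hb]
    have hYne : Y.Nonempty := by
      rw [Set.nonempty_iff_ne_empty]
      intro h
      rw [hKdef, h, Set.union_empty, hJ.closure] at hrkK
      omega
    have hKG : K ⊂ G := by
      have h1 : K ⊆ G := by
        have := M.closure_subset_closure hJYG
        rwa [hGf.closure] at this
      refine h1.ssubset_of_ne fun h => ?_
      obtain ⟨e, he⟩ := exists_isGreatest (M := M) hYne (fun x hx => hGE hx.1.1)
      have hYe : Y = {x | x ∈ G \ J ∧ x ≤ e} := by
        ext x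
        exact ⟨fun hx => ⟨hx.1, he.2 hx⟩, fun hx => ⟨hx.1, hx.2.trans_lt he.1.2⟩⟩
      have := hbleast.2 ⟨he.1.1, by rw [← hYe]; exact h⟩
      exact not_lt.2 this he.1.2
    have hbK : b ∉ K := by
      intro hb
      have := M.closure_subset_closure (Set.insert_subset hb hJYK)
      rw [hGcl, hK.closure] at this
      exact hKG.not_subset this
    have hKJ : K ≠ J := by
      obtain ⟨y, hy⟩ := hYne
      intro h
      exact hy.1.2 (h ▸ hJYK (Or.inr hy))
    obtain ⟨H, hH, hHG, hKH⟩ := (hc.exists_eq_closure h𝒢 hJ hGG hJG hY hYne).resolve_left hKJ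
    have hHE := building_subset_ground h𝒢 hH
    have hHK : H ⊆ K := by
      rw [hKdef, hKH]
      exact Set.subset_union_right.trans (M.subset_closure _
        (Set.union_subset hJ.subset_ground hHE))
    obtain ⟨D, hD, hHD⟩ := exists_factor hH hHK
    have hDG := mem_of_mem_factors hD
    have hDJ : ¬ D ⊆ J := by
      intro h
      apply hKJ
      rw [hKdef, hKH, Set.union_eq_left.2 (hHD.trans h), hJ.closure]
    have hDsG : D ⊂ G := hDG.2.trans_ssubset hKG
    have hN' : IsNested M 𝒢 (insert D N) := hN.insert_factor h𝒢 hG hK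
      (Set.subset_union_left.trans hJYK) hKG hD hDJ
    have hDN : D ∉ N := fun h => hDJ (subset_lowerJoin h𝒢 hN.1 h hDsG)
    have hcard := Finset.card_le_card hN'.1
    have hcard' := Finset.card_insert_of_notMem hDN
    obtain ⟨S, hS, hNS, hdes⟩ := ih (𝒢.card - (insert D N).card) (by omega) _ rfl hN'
      (hmax.trans (Finset.subset_insert _ _))
    have hNS' : N ⊆ S := (Finset.subset_insert _ _).trans hNS
    have hDS : D ∈ S := hNS (Finset.mem_insert_self _ _)
    have hGS : G ∈ S := hNS' hG
    refine ⟨S, hS, hNS', fun Q hQ => ?_⟩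
    rcases Finset.mem_insert.1 (hdes Q hQ) with rfl | hQN
    swap
    · exact hQN
    -- If the new element, now called `Q`, were a descent, its label would exceed `b`. All of `Y`
    -- would then lie in `J` or in the lower join of `Q`, leaving nothing for `Q` itself to
    -- contribute to `K`.
    exfalso
    obtain ⟨-, P, hP, a, b', ha, hb', hlt⟩ := hQ
    rw [hS.isLabel_iff h𝒢 hDS] at ha
    rw [hS.isLabel_iff h𝒢 hP.1.1] at hb'
    have hT : insert Q (lower N G) ⊆ ((insert Q N : Finset (Set α)) : Set (Set α)) := by
      rintro s (rfl | hs)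
      · simp
      · exact Finset.mem_coe.2 (Finset.mem_insert_of_mem hs.1)
    have hTE := sUnion_subset_ground h𝒢 (hT.trans (by exact_mod_cast hN'.1))
    have hKT : K ⊆ M.closure (⋃₀ (insert Q (lower N G))) := by
      rw [hKdef, hKH]
      apply M.closure_subset_closure_of_subset_closure
      apply Set.union_subset
      · exact M.closure_subset_closure (Set.sUnion_subset_sUnion (Set.subset_insert _ _))
      · exact hHD.trans ((Set.subset_sUnion_of_mem (Set.mem_insert _ _)).trans
          (M.subset_closure _ hTE))
    have hlow : ∀ m ∈ lower N G, ¬ Q ⊆ m := fun m hm h =>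
      hDJ (h.trans (subset_lowerJoin h𝒢 hN.1 hm.1 hm.2))
    -- `K` is spanned by `Q` and the members of `N` below `G`, and its corank in `G` is at most one.
    have hLJ : lowerJoin M S G = K := by
      have h1 : K ⊆ lowerJoin M S G := hKT.trans (M.closure_subset_closure
        (Set.sUnion_subset_sUnion (by
          rintro s (rfl | hs)
          · exact ⟨hDS, hDsG⟩
          · exact ⟨hNS' hs.1, hs.2⟩)))
      have h2 := hS.rk_eq h𝒢 hGS
      have h3 := closure_eq_of_rk_le (M := M) h1 (by omega)
      rw [hK.closure, lowerJoin, M.closure_closure] at h3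
      exact h3.symm
    have hPG : P = G := by
      by_contra hne
      have hPG' : P ⊂ G := (show P ⊆ G from hP.2 ⟨hGS, hDsG⟩).ssubset_of_ne hne
      have h1 := subset_lowerJoin h𝒢 hS.1.1 hP.1.1 hPG'
      rw [hLJ] at h1
      obtain ⟨m, hm, hPm⟩ := hS.1.exists_subset h𝒢 (hT.trans (by exact_mod_cast hNS))
        (hS.1.1 hP.1.1) (h1.trans hKT)
      rcases hm with rfl | hm
      · exact hP.1.2.not_subset hPm
      · exact hlow m hm (hP.1.2.subset.trans hPm)
    subst hPG
    rw [hLJ] at hb'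
    have hbb : b' ≤ b := hb'.2 ⟨hbleast.1.1.1, hbK⟩
    have hbb' : b ≤ b' := by
      by_contra hcon
      apply hb'.1.2
      by_cases h : b' ∈ J
      · exact hJYK (Or.inl h)
      · exact hJYK (Or.inr ⟨⟨hb'.1.1, h⟩, not_le.1 hcon⟩)
    have hba : b < a := hbb'.trans_lt hlt
    -- A point of `Y` is outside `J`, so nestedness places it in `Q`. Being smaller than the label
    -- `a` of `Q`, it lies in the lower join of `Q`.
    have hYQ : Y ⊆ lowerJoin M S Q := by
      intro y hy
      obtain ⟨m, hm, hym⟩ := hN'.mem_sUnion h𝒢 hT (hKT (hJYK (Or.inr hy)))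
      rcases hm with rfl | hm
      · by_contra hyJ
        exact not_le.2 (hy.2.trans hba) (ha.2 ⟨hym, hyJ⟩)
      · exact absurd (subset_lowerJoin h𝒢 hN.1 hm.1 hm.2 hym) hy.1.2
    have hsub : lower N P ∪ lower S Q ⊆ (S : Set (Set α)) := by
      rintro s (hs | hs)
      · exact hNS' hs.1
      · exact hs.1
    obtain ⟨m, hm, hQm⟩ := hS.1.exists_subset h𝒢 hsub hDG.1 (by
      refine hDG.2.trans ?_
      rw [hKdef]
      apply M.closure_subset_closure_of_subset_closure
      apply Set.union_subset
      · exact M.closure_subset_closure (Set.sUnion_subset_sUnion Set.subset_union_left)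
      · exact hYQ.trans (M.closure_subset_closure
          (Set.sUnion_subset_sUnion Set.subset_union_right)))
    rcases hm with hm | hm
    · exact hlow m hm hQm
    · exact hm.2.not_subset hQm

end Label
end
end

section

/-! ### Summation over chains of children -/

theorem truncGeom_one : truncGeom 1 = 0 := by simp [truncGeom]

theorem truncGeom_one_add {d : ℕ} (hd : 0 < d) : truncGeom (1 + d) = X * (1 + truncGeom d) := by
  obtain ⟨e, rfl⟩ : ∃ e, d = e + 1 := ⟨d - 1, by omega⟩
  rw [truncGeom, truncGeom, Finset.sum_Ico_eq_sum_range, Finset.sum_Ico_eq_sum_range,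
    show 1 + (e + 1) - 1 = e + 1 by omega, show e + 1 - 1 = e by omega, Finset.sum_range_succ',
    mul_add, Finset.mul_sum, add_comm]
  congr 1
  · simp
  · exact Finset.sum_congr rfl fun i _ => by ring

section Chain
variable {ι : Type*} {S D : Finset ι} {R : ι → ι → Prop} {r : ι → ℕ} {d : Finset ι → ι → ℕ}

/-- The contribution of `G` to the weight of `N`: members of `D` are not allowed outside `N`. -/
def chainWeight (D : Finset ι) (d : Finset ι → ι → ℕ) (N : Finset ι) (G : ι) : ℝ[X] :=
  if G ∈ N then truncGeom (d N G) else if G ∈ D then 0 else 1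

/-- A gap function `d` on subsets of `S` governed by a partial matching `R`: the gap of `G` is one,
unless `G` has an `R`-child outside of `N`, whose gap it then exceeds by one. -/
structure IsChainGap (S D : Finset ι) (R : ι → ι → Prop) (r : ι → ℕ) (d : Finset ι → ι → ℕ) :
    Prop where
  rank_lt : ∀ {c G}, R c G → r c < r G
  notMem : ∀ {c G}, R c G → c ∉ D
  left_unique : ∀ {c c' G}, R c G → R c' G → c = c'
  right_unique : ∀ {c G G'}, R c G → R c G' → G = G'
  eq_one : ∀ {N G}, N ⊆ S → G ∈ S → (∀ c, R c G → c ∈ N) → d N G = 1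
  eq_add : ∀ {N c G}, N ⊆ S → G ∈ S → R c G → c ∉ N → d N G = 1 + d N c

namespace IsChainGap
variable (h : IsChainGap S D R r d)
include h

theorem pos {N : Finset ι} (hN : N ⊆ S) {G : ι} (hG : G ∈ S) : 0 < d N G := by
  by_cases hc : ∀ c, R c G → c ∈ N
  · simp [h.eq_one hN hG hc]
  · push Not at hc
    obtain ⟨c, hc, hcN⟩ := hc
    rw [h.eq_add hN hG hc hcN]
    omega

/-- The gap of `G` depends only on which elements of the `R`-chain below `G` belong to `N`. An
element with no `R`-parent in the down-closed set `Z` is in no such chain, except possibly as its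
top. -/
theorem insert_eq {Z N : Finset ι} (hZS : Z ⊆ S) (hZ : ∀ c G, R c G → G ∈ Z → c ∈ Z) (hN : N ⊆ S)
    {a : ι} (ha : a ∈ S) (haZ : ∀ G ∈ Z, ¬ R a G) (n : ℕ) :
    ∀ G ∈ Z, r G = n → d (insert a N) G = d N G := by
  have hN' : insert a N ⊆ S := Finset.insert_subset ha hN
  induction n using Nat.strong_induction_on with
  | _ n ih =>
    intro G hG hn
    by_cases hc : ∀ c, R c G → c ∈ N
    · rw [h.eq_one hN (hZS hG) hc,
        h.eq_one hN' (hZS hG) fun c hcG => Finset.mem_insert_of_mem (hc c hcG)]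
    · push Not at hc
      obtain ⟨c, hc, hcN⟩ := hc
      have hca : c ∉ insert a N := by
        rw [Finset.mem_insert, not_or]
        refine ⟨?_, hcN⟩
        rintro rfl
        exact haZ G hG hc
      rw [h.eq_add hN (hZS hG) hc hcN, h.eq_add hN' (hZS hG) hc hca,
        ih (r c) (hn ▸ h.rank_lt hc) c (hZ c G hc hG) rfl]

theorem prod_insert_eq {Z N : Finset ι} (hZS : Z ⊆ S) (hZ : ∀ c G, R c G → G ∈ Z → c ∈ Z)
    (hN : N ⊆ S) {a : ι} (ha : a ∈ S) (haZ : ∀ G ∈ Z, ¬ R a G) {Y : Finset ι} (hY : Y ⊆ Z)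
    (haY : a ∉ Y) :
    ∏ G ∈ Y, chainWeight D d (insert a N) G = ∏ G ∈ Y, chainWeight D d N G := by
  apply Finset.prod_congr rfl
  intro G hG
  have hGa : G ≠ a := fun hh => haY (hh ▸ hG)
  simp only [chainWeight, h.insert_eq hZS hZ hN ha haZ _ G (hY hG) rfl, Finset.mem_insert, hGa,
    false_or]

/-- Pair `N` with `insert c N`, where `c` is the `R`-child of `G`. If `c` is present the gap is one
and the term vanishes. If it is absent, the factor is `X * (1 + truncGeom (d N c))`, which is `X`
times the sum of the two weights of `c`. -/
theorem sum_truncGeom_mul {Z : Finset ι} (hZS : Z ⊆ S) (hZ : ∀ c G, R c G → G ∈ Z → c ∈ Z)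
    {G : ι} (hG : G ∈ S) (hGZ : G ∉ Z) (hRG : ∀ c, R c G → c ∈ Z) :
    ∑ N ∈ Z.powerset, truncGeom (d N G) * ∏ H ∈ Z, chainWeight D d N H =
      (if ∃ c, R c G then X else 0) * ∑ N ∈ Z.powerset, ∏ H ∈ Z, chainWeight D d N H := by
  split_ifs with hc
  · obtain ⟨c, hc⟩ := hc
    have hcZ := hRG c hc
    have haZ : ∀ H ∈ Z, ¬ R c H := fun H hH hcH => hGZ (h.right_unique hc hcH ▸ hH)
    obtain ⟨Y, hcY, rfl⟩ : ∃ Y, c ∉ Y ∧ insert c Y = Z :=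
      ⟨Z.erase c, Finset.notMem_erase c Z, Finset.insert_erase hcZ⟩
    rw [Finset.sum_powerset_insert hcY, Finset.sum_powerset_insert hcY, ← Finset.sum_add_distrib,
      ← Finset.sum_add_distrib, Finset.mul_sum]
    apply Finset.sum_congr rfl
    intro N hN
    have hNY := Finset.mem_powerset.1 hN
    have hNS : N ⊆ S := (hNY.trans (Finset.subset_insert c Y)).trans hZS
    have hcS := hZS hcZ
    have hcN : c ∉ N := fun hh => hcY (hNY hh)
    have h1 : d (insert c N) G = 1 := by
      apply h.eq_one (Finset.insert_subset hcS hNS) hG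
      intro c' hc'
      rw [h.left_unique hc' hc]
      exact Finset.mem_insert_self _ _
    rw [Finset.prod_insert hcY, Finset.prod_insert hcY,
      h.prod_insert_eq hZS hZ hNS hcS haZ (Finset.subset_insert c Y) hcY, h1, truncGeom_one,
      h.eq_add hNS hG hc hcN, truncGeom_one_add (h.pos hNS hcS)]
    have h2 : chainWeight D d N c = 1 := by
      rw [chainWeight, if_neg hcN, if_neg (h.notMem hc)]
    have h3 : chainWeight D d (insert c N) c = truncGeom (d N c) := by
      rw [chainWeight, if_pos (Finset.mem_insert_self _ _),
        h.insert_eq hZS hZ hNS hcS haZ _ c hcZ rfl]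
    rw [h2, h3]
    ring
  · rw [zero_mul]
    apply Finset.sum_eq_zero
    intro N hN
    rw [h.eq_one ((Finset.mem_powerset.1 hN).trans hZS) hG fun c hcG => absurd ⟨c, hcG⟩ hc,
      truncGeom_one, zero_mul]

/-- Remove an element `G` of largest rank, which influences no other gap in `Z`. The sets without
`G` give the first summand of its factor, and those with `G` give the second by `sum_truncGeom_mul`.
-/
theorem sum_prod_chainWeight (n : ℕ) : ∀ Z : Finset ι, Z.card = n → Z ⊆ S →
    (∀ c G, R c G → G ∈ Z → c ∈ Z) →
    ∑ N ∈ Z.powerset, ∏ G ∈ Z, chainWeight D d N G =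
      ∏ G ∈ Z, ((if G ∈ D then 0 else 1) + if ∃ c, R c G then X else 0) := by
  induction n with
  | zero =>
    intro Z hn _ _
    rw [Finset.card_eq_zero.1 hn]
    simp
  | succ n ih =>
    intro Z hn hZS hZ
    obtain ⟨G, hG, hmax⟩ := Z.exists_max_image r (Finset.card_pos.1 (by omega))
    obtain ⟨Y, hGY, rfl⟩ : ∃ Y, G ∉ Y ∧ insert G Y = Z :=
      ⟨Z.erase G, Finset.notMem_erase G Z, Finset.insert_erase hG⟩
    have hGZ : ∀ H ∈ insert G Y, ¬ R G H := fun H hH hGH =>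
      (h.rank_lt hGH).not_ge (hmax H hH)
    have hYS : Y ⊆ S := (Finset.subset_insert G Y).trans hZS
    have hY : ∀ c H, R c H → H ∈ Y → c ∈ Y := by
      intro c H hcH hH
      have hHZ : H ∈ insert G Y := Finset.mem_insert_of_mem hH
      rcases Finset.mem_insert.1 (hZ c H hcH hHZ) with rfl | hc
      · exact absurd hcH (hGZ H hHZ)
      · exact hc
    have hRG : ∀ c, R c G → c ∈ Y := by
      intro c hc
      rcases Finset.mem_insert.1 (hZ c G hc hG) with rfl | hc'
      · exact absurd hc (hGZ _ hG)
      · exact hc'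
    rw [Finset.prod_insert hGY, ← ih Y (by rw [Finset.card_insert_of_notMem hGY] at hn; omega) hYS hY,
      add_mul, ← h.sum_truncGeom_mul hYS hY (hZS hG) hGY hRG, Finset.mul_sum,
      Finset.sum_powerset_insert hGY]
    congr 1
    · apply Finset.sum_congr rfl
      intro N hN
      have hGN : G ∉ N := fun hh => hGY (Finset.mem_powerset.1 hN hh)
      rw [Finset.prod_insert hGY, chainWeight, if_neg hGN]
    · apply Finset.sum_congr rfl
      intro N hN
      have hNS := (Finset.mem_powerset.1 hN).trans hYS
      rw [Finset.prod_insert hGY, h.prod_insert_eq hZS hZ hNS (hZS hG) hGZ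
        (Finset.subset_insert G Y) hGY, chainWeight, if_pos (Finset.mem_insert_self _ _),
        h.insert_eq hZS hZ hNS (hZS hG) hGZ _ G hG rfl]

end IsChainGap
end Chain

end

section

variable {α : Type*} {M : Matroid α} {𝒢 : Finset (Set α)}

/-! ### The fibers of the completion map -/

section Fiber
variable [LinearOrder α]

/-- `C` is a child of `G` in `S`, but not a descent. -/
def IsAscentChild (M : Matroid α) (S : Finset (Set α)) (C G : Set α) : Prop :=
  C ∈ S ∧ IsParent S C G ∧ ¬ IsDescent M S C

/-- The set of descents of `S`. -/
def descents (M : Matroid α) (S : Finset (Set α)) : Finset (Set α) := S.filter (IsDescent M S)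

theorem mem_descents {S : Finset (Set α)} {G : Set α} : G ∈ descents M S ↔ IsDescent M S G := by
  rw [descents, Finset.mem_filter, and_iff_right_iff_imp]
  exact fun h => h.1

theorem descents_subset (S : Finset (Set α)) : descents M S ⊆ S := Finset.filter_subset _ _

theorem mem_stableMaxNested {S : Finset (Set α)} :
    S ∈ stableMaxNested M 𝒢 ↔ IsStableMaxNested M 𝒢 S := by
  rw [stableMaxNested, Finset.mem_filter, Finset.mem_powerset, and_iff_right_iff_imp]
  exact fun h => h.1.1.1

variable [M.Loopless] [M.Finite] (h𝒢 : IsBuildingSet M 𝒢)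
include h𝒢

theorem mem_factors_lowerJoin {S : Finset (Set α)} (hS : IsNested M 𝒢 S) {C G : Set α} (hC : C ∈ S)
    (h : IsParent S C G) : C ∈ factors 𝒢 (lowerJoin M S G) := by
  refine ⟨⟨hS.1 hC, subset_lowerJoin h𝒢 hS.1 hC h.1.2⟩, ?_⟩
  rintro D ⟨hD, hDJ⟩ hCD
  obtain ⟨n, hn, hDn⟩ := hS.exists_subset h𝒢 (lower_subset S G) hD hDJ
  rw [h.eq_of_subset hn.1 hn.2 (hCD.trans hDn)]
  exact hDn

theorem IsMaxNested.gap_eq_one_of_children {S N : Finset (Set α)} (hS : IsMaxNested M 𝒢 S)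
    (hNS : N ⊆ S) {G : Set α} (hG : G ∈ S) (h : ∀ C ∈ S, IsParent S C G → C ∈ N) :
    gap M N G = 1 := by
  rw [← hS.gap_eq_one h𝒢 hG, gap, gap]
  congr 2
  apply Set.Subset.antisymm
  · exact Set.sUnion_subset_sUnion fun H hH => ⟨hNS hH.1, hH.2⟩
  · rintro x ⟨H, hH, hx⟩
    obtain ⟨C, hC, hCG, hHC⟩ := hS.1.exists_child h𝒢 hG hH.1 hH.2
    exact ⟨C, ⟨h C hC hCG, hCG.1.2⟩, hHC hx⟩

/-- `C` is a factor of the lower join of `G`, hence modular there. The remaining children are in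
`N`, so `C` and the members of `N` below `G` span this join, and they intersect in the members of
`N` below `C`. -/
theorem IsMaxNested.gap_eq_one_add {S N : Finset (Set α)} (hS : IsMaxNested M 𝒢 S)
    (hNS : N ⊆ S) {C G : Set α} (hC : C ∈ S) (hCG : IsParent S C G) (hCN : C ∉ N)
    (h : ∀ C' ∈ S, IsParent S C' G → C' ≠ C → C' ∈ N) :
    gap M N G = 1 + gap M N C := by
  have hG : G ∈ S := hCG.1.1
  have hGG := hS.1.1 hG
  have hX : ⋃₀ lower N G ⊆ lowerJoin M S G := by
    rintro x ⟨H, hH, hx⟩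
    exact subset_lowerJoin h𝒢 hS.1.1 (hNS hH.1) hH.2 hx
  have h1 := rk_factor_union_add h𝒢 (M.isFlat_closure _) (mem_factors_lowerJoin h𝒢 hS.1 hC hCG) hX
  have h2 : C ∪ ⋃₀ lower N G = ⋃₀ lower S G := by
    apply Set.Subset.antisymm
    · rintro x (hx | ⟨H, hH, hx⟩)
      · exact ⟨C, ⟨hC, hCG.1.2⟩, hx⟩
      · exact ⟨H, ⟨hNS hH.1, hH.2⟩, hx⟩
    · rintro x ⟨H, hH, hx⟩
      obtain ⟨C', hC', hCG', hHC'⟩ := hS.1.exists_child h𝒢 hG hH.1 hH.2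
      by_cases hne : C' = C
      · exact Or.inl (hne ▸ hHC' hx)
      · exact Or.inr ⟨C', ⟨h C' hC' hCG' hne, hCG'.1.2⟩, hHC' hx⟩
  have h3 : ⋃₀ lower N G ∩ C = ⋃₀ lower N C := by
    apply Set.Subset.antisymm
    · rintro x ⟨⟨H, hH, hx⟩, hxC⟩
      have hne : H ≠ C := fun hh => hCN (hh ▸ hH.1)
      refine ⟨H, ⟨hH.1, ?_⟩, hx⟩
      rcases hS.1.subset_or_subset h𝒢 (hNS hH.1) hC hx hxC with hsub | hsub
      · exact hsub.ssubset_of_ne hne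
      · exact absurd (hCG.eq_of_subset (hNS hH.1) hH.2 hsub).symm hne
    · rintro x ⟨H, hH, hx⟩
      exact ⟨⟨H, ⟨hH.1, hH.2.trans hCG.1.2⟩, hx⟩, hH.2.subset hx⟩
  have h4 : rk M G = rk M (⋃₀ lower S G) + 1 := by rw [hS.rk_eq h𝒢 hG, lowerJoin, rk_closure]
  rw [h2, h3] at h1
  have h5 : rk M (⋃₀ lower N C) ≤ rk M C := rk_mono (Set.sUnion_subset fun H hH => hH.2.subset)
  rw [gap, gap]
  change rk M G - rk M (⋃₀ lower N G) = 1 + (rk M C - rk M (⋃₀ lower N C))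
  omega

theorem rk_lt_rk {S : Finset (Set α)} (hS : IsMaxNested M 𝒢 S) {C G : Set α} (hC : C ∈ S)
    (hG : G ∈ S) (h : C ⊂ G) : rk M C < rk M G := by
  rw [hS.rk_eq h𝒢 hG]
  exact Nat.lt_succ_of_le (rk_mono (subset_lowerJoin h𝒢 hS.1.1 hC h))

variable (hc : IsComplete M 𝒢)
include hc

theorem IsMaxNested.ascentChild_unique {S : Finset (Set α)} (hS : IsMaxNested M 𝒢 S)
    {C C' G : Set α} (h : IsAscentChild M S C G) (h' : IsAscentChild M S C' G) : C = C' :=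
  eq_of_isParent_of_notMem h𝒢 hc hS (descents_subset S) (fun _ hG => mem_descents.2 hG) h.1 h'.1
    h.2.1 h'.2.1 (fun hC => h.2.2 (mem_descents.1 hC)) (fun hC => h'.2.2 (mem_descents.1 hC))

theorem IsMaxNested.isChainGap {S : Finset (Set α)} (hS : IsMaxNested M 𝒢 S) :
    IsChainGap S (descents M S) (IsAscentChild M S) (rk M)
      (fun N G => gap M (N ∪ descents M S) G) where
  rank_lt h := rk_lt_rk h𝒢 hS h.1 h.2.1.1.1 h.2.1.1.2
  notMem h hC := h.2.2 (mem_descents.1 hC)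
  left_unique h h' := hS.ascentChild_unique h𝒢 hc h h'
  right_unique h h' := h.2.1.unique h'.2.1
  eq_one {N G} hN hG h := by
    apply hS.gap_eq_one_of_children h𝒢 (Finset.union_subset hN (descents_subset S)) hG
    intro C hC hCG
    by_cases hd : IsDescent M S C
    · exact Finset.mem_union_right _ (mem_descents.2 hd)
    · exact Finset.mem_union_left _ (h C ⟨hC, hCG, hd⟩)
  eq_add {N C G} hN hG h hCN := by
    apply hS.gap_eq_one_add h𝒢 (Finset.union_subset hN (descents_subset S)) h.1 h.2.1
    · rw [Finset.mem_union, not_or]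
      exact ⟨hCN, fun hC => h.2.2 (mem_descents.1 hC)⟩
    · intro C' hC' hCG' hne
      by_contra hcon
      rw [Finset.mem_union, not_or] at hcon
      exact hne (hS.ascentChild_unique h𝒢 hc ⟨hC', hCG', fun hd => hcon.2 (mem_descents.2 hd)⟩ h)

/-- The number of elements that have an ascent child. -/
theorem IsMaxNested.card_filter_ascentChild {S : Finset (Set α)} (hS : IsMaxNested M 𝒢 S) :
    (S.filter fun G => ∃ C, IsAscentChild M S C G).card + des M S + (maxElts 𝒢).card =
      rk M M.E := by
  have hpar : ∀ C ∈ S, C ∉ maxElts 𝒢 → ∃ P, IsParent S C P := by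
    intro C hC hCm
    obtain ⟨g, hg, hCg⟩ := exists_maxElts (hS.1.1 hC)
    refine hS.1.exists_isParent h𝒢 hC (hS.maxElts_subset h𝒢 hg) (hCg.ssubset_of_ne ?_)
    rintro rfl
    exact hCm hg
  have hmax : ∀ {C P}, IsParent S C P → C ∉ maxElts 𝒢 := by
    intro C P hP hC
    exact hP.1.2.not_subset ((Finset.mem_filter.1 hC).2.2 (hS.1.1 hP.1.1) hP.1.2.subset)
  -- Taking parents is a bijection from the members that are neither descents nor maximal to the
  -- members having an ascent child.
  have hcard : (S.filter fun G => ∃ C, IsAscentChild M S C G).card =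
      (S \ (descents M S ∪ maxElts 𝒢)).card := by
    symm
    have hex : ∀ C ∈ S \ (descents M S ∪ maxElts 𝒢), ∃ P, IsAscentChild M S C P := by
      intro C hC
      rw [Finset.mem_sdiff, Finset.mem_union, not_or] at hC
      obtain ⟨P, hP⟩ := hpar C hC.1 hC.2.2
      exact ⟨P, hC.1, hP, fun hd => hC.2.1 (mem_descents.2 hd)⟩
    choose p hp using hex
    refine Finset.card_bij p ?_ ?_ ?_
    · intro C hC
      exact Finset.mem_filter.2 ⟨(hp C hC).2.1.1.1, C, hp C hC⟩
    · intro C hC C' hC' heq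
      exact hS.ascentChild_unique h𝒢 hc (hp C hC) (heq ▸ hp C' hC')
    · intro G hG
      obtain ⟨-, C, hC⟩ := Finset.mem_filter.1 hG
      have hCS : C ∈ S \ (descents M S ∪ maxElts 𝒢) := by
        rw [Finset.mem_sdiff, Finset.mem_union, not_or]
        exact ⟨hC.1, fun hd => hC.2.2 (mem_descents.1 hd), hmax hC.2.1⟩
      exact ⟨C, hCS, (hp C hCS).2.1.unique hC.2.1⟩
  have hdisj : Disjoint (descents M S) (maxElts 𝒢) := by
    rw [Finset.disjoint_left]
    intro C hC
    obtain ⟨-, P, hP, -⟩ := mem_descents.1 hC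
    exact hmax hP
  have h1 := Finset.card_sdiff_add_card_eq_card
    (Finset.union_subset (descents_subset (M := M) S) (hS.maxElts_subset h𝒢))
  rw [Finset.card_union_of_disjoint hdisj, hS.card_eq h𝒢] at h1
  have h2 : des M S = (descents M S).card := rfl
  omega

-- A descent without an ascent child is minimal, giving a bottom descent, or has only descents as
-- children, giving a double descent.
omit [M.Loopless] [M.Finite] h𝒢 hc in
theorem isStableMaxNested_iff {S : Finset (Set α)} : IsStableMaxNested M 𝒢 S ↔
    IsMaxNested M 𝒢 S ∧ ∀ G ∈ descents M S, ∃ C, IsAscentChild M S C G := by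
  refine and_congr_right fun _ => ⟨?_, ?_⟩
  · rintro ⟨hb, hd⟩ G hG
    by_contra hcon
    have hG := mem_descents.1 hG
    refine hd G ⟨hG, fun hmin => hb G ⟨hG, hmin⟩, fun H hH hHG => ?_⟩
    by_contra hHd
    exact hcon ⟨H, hH, hHG, hHd⟩
  · intro h
    refine ⟨fun G hG => ?_, fun G hG => ?_⟩
    · obtain ⟨C, hC⟩ := h G (mem_descents.2 hG.1)
      exact hC.2.1.1.2.not_subset (hG.2.2 hC.1 hC.2.1.1.2.subset)
    · obtain ⟨C, hC⟩ := h G (mem_descents.2 hG.1)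
      exact hC.2.2 (hG.2.2 C hC.1 hC.2.1)

/-- A descent without an ascent child contributes 0. In the stable case descents contribute `X`,
other members with an ascent child contribute `1 + X`, and the rest contribute 1; the exponent of `1
+ X` is the count in `card_filter_ascentChild` with the descents subtracted once more. -/
theorem IsMaxNested.prod_eq {S : Finset (Set α)} (hS : IsMaxNested M 𝒢 S) :
    ∏ G ∈ S, ((if G ∈ descents M S then 0 else 1) +
      if ∃ C, IsAscentChild M S C G then (X : ℝ[X]) else 0) =
    if IsStableMaxNested M 𝒢 S then
      X ^ des M S * (1 + X) ^ (rk M M.E - (maxElts 𝒢).card - 2 * des M S) else 0 := by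
  split_ifs with hst
  · have hD := (isStableMaxNested_iff.1 hst).2
    have hcard := hS.card_filter_ascentChild h𝒢 hc
    set A := S.filter fun G => ∃ C, IsAscentChild M S C G with hA
    have hDA : descents M S ⊆ A := fun G hG =>
      Finset.mem_filter.2 ⟨descents_subset S hG, hD G hG⟩
    have hdes : (descents M S).card = des M S := rfl
    have h1 := Finset.card_sdiff_add_card_eq_card hDA
    rw [show rk M M.E - (maxElts 𝒢).card - 2 * des M S = (A \ descents M S).card by omega,
      ← Finset.prod_sdiff (Finset.filter_subset _ S : A ⊆ S), ← Finset.prod_sdiff hDA,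
      Finset.prod_eq_one, one_mul, mul_comm]
    · congr 1
      · rw [← hdes]
        apply Finset.prod_eq_pow_card
        intro G hG
        rw [if_pos hG, if_pos (hD G hG), zero_add]
      · apply Finset.prod_eq_pow_card
        intro G hG
        rw [Finset.mem_sdiff] at hG
        rw [if_neg hG.2, if_pos (Finset.mem_filter.1 hG.1).2]
    · intro G hG
      rw [Finset.mem_sdiff] at hG
      rw [if_neg fun hd => hG.2 (hDA hd), if_neg fun hC => hG.2 (Finset.mem_filter.2 ⟨hG.1, hC⟩),
        add_zero]
  · rw [isStableMaxNested_iff, not_and] at hst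
    have := hst hS
    push Not at this
    obtain ⟨G, hG, hGC⟩ := this
    refine Finset.prod_eq_zero (descents_subset S hG) ?_
    rw [if_pos hG, if_neg (fun ⟨C, hC⟩ => hGC C hC), add_zero]

theorem IsMaxNested.sum_nestedWeight {S : Finset (Set α)} (hS : IsMaxNested M 𝒢 S) :
    ∑ N ∈ nestedSets M 𝒢, (if N ⊆ S ∧ descents M S ⊆ N then nestedWeight M N else 0) =
    if IsStableMaxNested M 𝒢 S then
      X ^ des M S * (1 + X) ^ (rk M M.E - (maxElts 𝒢).card - 2 * des M S) else 0 := by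
  rw [← hS.prod_eq h𝒢 hc]
  refine Eq.trans ?_ (((hS.isChainGap h𝒢 hc).sum_prod_chainWeight _ S rfl subset_rfl
    (fun C G h _ => h.1)).trans (Finset.prod_congr rfl fun G _ => by congr))
  have hsub : S.powerset ⊆ nestedSets M 𝒢 := fun N hN =>
    mem_nestedSets.2 (hS.1.mono (Finset.mem_powerset.1 hN))
  rw [← Finset.sum_subset hsub fun N _ hN => if_neg fun h => hN (Finset.mem_powerset.2 h.1)]
  apply Finset.sum_congr rfl
  intro N hN
  have hNS := Finset.mem_powerset.1 hN
  split_ifs with h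
  · rw [← Finset.prod_subset hNS, nestedWeight]
    · apply Finset.prod_congr rfl
      intro G hG
      rw [chainWeight, if_pos hG, Finset.union_eq_left.2 h.2]
    · intro G _ hG
      rw [chainWeight, if_neg hG, if_neg fun hd => hG (h.2 hd)]
  · have : ¬ descents M S ⊆ N := fun hd => h ⟨hNS, hd⟩
    obtain ⟨G, hG, hGN⟩ := Finset.not_subset.1 this
    symm
    apply Finset.prod_eq_zero (descents_subset S hG)
    rw [chainWeight, if_neg hGN, if_pos hG]

theorem exists_unique_isMaxNested {N : Finset (Set α)} (hN : IsNested M 𝒢 N) :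
    ∃ S, (IsMaxNested M 𝒢 S ∧ N ⊆ S ∧ descents M S ⊆ N) ∧
      ∀ S', IsMaxNested M 𝒢 S' → N ⊆ S' → descents M S' ⊆ N → S' = S := by
  obtain ⟨S, hS, hNS, hd⟩ := exists_isMaxNested h𝒢 hc _ _ rfl (hN.union_maxElts h𝒢)
    Finset.subset_union_right
  have hNS' := Finset.subset_union_left.trans hNS
  have hdes : descents M S ⊆ N := by
    -- The completion was built from `N ∪ maxElts 𝒢`, but maximal elements have no parent and so are
    -- never descents.
    intro G hG
    rcases Finset.mem_union.1 (hd G (mem_descents.1 hG)) with h | h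
    · exact h
    · obtain ⟨-, P, hP, -⟩ := mem_descents.1 hG
      exact absurd ((Finset.mem_filter.1 h).2.2 (hS.1.1 hP.1.1) hP.1.2.subset)
        hP.1.2.not_subset
  refine ⟨S, ⟨hS, hNS', hdes⟩, fun S' hS' hN' hd' => ?_⟩
  exact isMaxNested_unique h𝒢 hS' hS hN' hNS' (fun G hG => hd' (mem_descents.2 hG))
    (fun G hG => hdes (mem_descents.2 hG))

theorem sum_nestedWeight :
    ∑ N ∈ nestedSets M 𝒢, nestedWeight M N =
      ∑ S ∈ stableMaxNested M 𝒢,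
        X ^ des M S * (1 + X) ^ (rk M M.E - (maxElts 𝒢).card - 2 * des M S) := by
  set T := (nestedSets M 𝒢).filter (IsMaxNested M 𝒢) with hT
  have h1 : ∀ N ∈ nestedSets M 𝒢, nestedWeight M N =
      ∑ S ∈ T, if N ⊆ S ∧ descents M S ⊆ N then nestedWeight M N else 0 := by
    intro N hN
    obtain ⟨S, ⟨hS, hNS, hd⟩, huniq⟩ := exists_unique_isMaxNested h𝒢 hc (mem_nestedSets.1 hN)
    rw [Finset.sum_eq_single_of_mem S (Finset.mem_filter.2 ⟨mem_nestedSets.2 hS.1, hS⟩),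
      if_pos ⟨hNS, hd⟩]
    intro S' hS' hne
    exact if_neg fun h => hne (huniq S' (Finset.mem_filter.1 hS').2 h.1 h.2)
  rw [Finset.sum_congr rfl h1, Finset.sum_comm,
    Finset.sum_congr rfl fun S hS => (Finset.mem_filter.1 hS).2.sum_nestedWeight h𝒢 hc,
    ← Finset.sum_filter]
  apply Finset.sum_congr _ fun _ _ => rfl
  ext S
  rw [Finset.mem_filter, mem_stableMaxNested, and_iff_right_iff_imp]
  exact fun h => Finset.mem_filter.2 ⟨mem_nestedSets.2 h.1.1, h.1⟩

theorem two_mul_des_le {S : Finset (Set α)} (hS : IsStableMaxNested M 𝒢 S) :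
    2 * des M S ≤ rk M M.E - (maxElts 𝒢).card := by
  have hcard := hS.1.card_filter_ascentChild h𝒢 hc
  have : descents M S ⊆ S.filter fun G => ∃ C, IsAscentChild M S C G := fun G hG =>
    Finset.mem_filter.2 ⟨descents_subset S hG, (isStableMaxNested_iff.1 hS).2 G hG⟩
  have h1 := Finset.card_le_card this
  have hdes : (descents M S).card = des M S := rfl
  omega

/-- The completion of the empty nested set has no descents and is therefore stable. This makes the
constant coefficient of the `γ`-polynomial nonzero, so that its center of symmetry is half the
degree of the Hilbert–Poincaré polynomial. -/
theorem exists_stable_des_eq_zero : ∃ S ∈ stableMaxNested M 𝒢, des M S = 0 := by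
  have hN : IsNested M 𝒢 ∅ := by
    refine ⟨Finset.empty_subset _, fun A hA _ hcard => ?_⟩
    rw [Finset.subset_empty.1 hA] at hcard
    simp at hcard
  obtain ⟨S, ⟨hS, -, hd⟩, -⟩ := exists_unique_isMaxNested h𝒢 hc hN
  have hd' := Finset.subset_empty.1 hd
  refine ⟨S, (mem_stableMaxNested).2 (isStableMaxNested_iff.2 ⟨hS, ?_⟩),
    Finset.card_eq_zero.2 hd'⟩
  simp [hd']

end Fiber

end

section

variable {α : Type*} {M : Matroid α} {𝒢 : Finset (Set α)}

/-! ### Gamma expansions of a given degree -/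

/-- The polynomial of center of symmetry `n / 2` with `γ`-polynomial `γ`. -/
def gammaSum (n : ℕ) (γ : ℝ[X]) : ℝ[X] :=
  ∑ i ∈ Finset.range (n / 2 + 1), C (γ.coeff i) * X ^ i * (1 + X) ^ (n - 2 * i)

theorem coeff_gammaSum (n : ℕ) (γ : ℝ[X]) (j : ℕ) : (gammaSum n γ).coeff j =
    ∑ i ∈ Finset.range (n / 2 + 1),
      if i ≤ j then γ.coeff i * ((n - 2 * i).choose (j - i) : ℝ) else 0 := by
  rw [gammaSum, finsetSum_coeff]
  apply Finset.sum_congr rfl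
  intro i _
  rw [mul_assoc, coeff_C_mul, coeff_X_pow_mul', coeff_one_add_X_pow, mul_ite, mul_zero]

theorem coeff_gammaSum_symm {n j : ℕ} (γ : ℝ[X]) (hj : j ≤ n) :
    (gammaSum n γ).coeff j = (gammaSum n γ).coeff (n - j) := by
  rw [coeff_gammaSum, coeff_gammaSum]
  apply Finset.sum_congr rfl
  intro i hi
  have hi := Finset.mem_range.1 hi
  split_ifs with h1 h2 h2
  · rw [← Nat.choose_symm_of_eq_add (n := n - 2 * i) (a := j - i) (b := n - j - i) (by omega)]
  · rw [Nat.choose_eq_zero_of_lt (by omega), Nat.cast_zero, mul_zero]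
  · rw [Nat.choose_eq_zero_of_lt (by omega), Nat.cast_zero, mul_zero]
  · rfl

theorem coeff_zero_gammaSum (n : ℕ) (γ : ℝ[X]) : (gammaSum n γ).coeff 0 = γ.coeff 0 := by
  rw [coeff_gammaSum, Finset.sum_eq_single_of_mem 0 (by simp)]
  · simp
  · intro i _ hi
    rw [if_neg (by omega)]

theorem natDegree_gammaSum {n : ℕ} {γ : ℝ[X]} (h : γ.coeff 0 ≠ 0) :
    (gammaSum n γ).natDegree = n := by
  apply natDegree_eq_of_le_of_coeff_ne_zero
  · rw [natDegree_le_iff_coeff_eq_zero]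
    intro j hj
    rw [coeff_gammaSum]
    apply Finset.sum_eq_zero
    intro i hi
    have hi := Finset.mem_range.1 hi
    split_ifs
    · rw [Nat.choose_eq_zero_of_lt (by omega), Nat.cast_zero, mul_zero]
    · rfl
  · rwa [coeff_gammaSum_symm γ le_rfl, Nat.sub_self, coeff_zero_gammaSum]

/-- Triangularity: the coefficient of `X ^ k` involves only `γ.coeff i` with `i ≤ k`, and `γ.coeff
k` enters with coefficient one. -/
theorem coeff_eq_of_gammaSum_eq {n : ℕ} {γ δ : ℝ[X]} (h : gammaSum n γ = gammaSum n δ) (k : ℕ) :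
    k ≤ n / 2 → γ.coeff k = δ.coeff k := by
  induction k using Nat.strong_induction_on with
  | _ k ih =>
    intro hk
    have h1 := congrArg (fun p => p.coeff k) h
    have hkr : k ∈ Finset.range (n / 2 + 1) := Finset.mem_range.2 (by omega)
    simp only [coeff_gammaSum] at h1
    rw [← Finset.add_sum_erase _ _ hkr, ← Finset.add_sum_erase _ _ hkr] at h1
    have h2 : ∀ i ∈ (Finset.range (n / 2 + 1)).erase k,
        (if i ≤ k then γ.coeff i * ((n - 2 * i).choose (k - i) : ℝ) else 0) =
        if i ≤ k then δ.coeff i * ((n - 2 * i).choose (k - i) : ℝ) else 0 := by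
      intro i hi
      rw [Finset.mem_erase, Finset.mem_range] at hi
      split_ifs with hik
      · rw [ih i (by omega) (by omega)]
      · rfl
    rw [Finset.sum_congr rfl h2] at h1
    simpa using h1

theorem eq_of_gammaSum_eq {n : ℕ} {γ δ : ℝ[X]} (h : gammaSum n γ = gammaSum n δ)
    (hγ : γ.natDegree ≤ n / 2) (hδ : δ.natDegree ≤ n / 2) : γ = δ := by
  ext k
  by_cases hk : k ≤ n / 2
  · exact coeff_eq_of_gammaSum_eq h k hk
  · rw [coeff_eq_zero_of_natDegree_lt (by omega), coeff_eq_zero_of_natDegree_lt (by omega)]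

theorem sum_eq_gammaSum {ι : Type*} (T : Finset ι) (f : ι → ℕ) {n : ℕ}
    (hf : ∀ S ∈ T, 2 * f S ≤ n) :
    ∑ S ∈ T, (X : ℝ[X]) ^ f S * (1 + X) ^ (n - 2 * f S) = gammaSum n (∑ S ∈ T, X ^ f S) := by
  simp only [gammaSum, finsetSum_coeff, map_sum, Finset.sum_mul]
  rw [Finset.sum_comm]
  apply Finset.sum_congr rfl
  intro S hS
  have := hf S hS
  rw [Finset.sum_eq_single_of_mem (f S) (Finset.mem_range.2 (by omega))]
  · simp
  · intro i _ hi
    rw [coeff_X_pow, if_neg hi]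
    simp

theorem chowSeries_gammaExpansion [LinearOrder α] [M.Finite] [M.Loopless]
    (h𝒢 : IsBuildingSet M 𝒢) (hc : IsComplete M 𝒢) :
    ∃ H : ℝ[X], (H : PowerSeries ℝ) = chowSeries M 𝒢 ∧
      IsGammaExpansion H (∑ S ∈ stableMaxNested M 𝒢, X ^ des M S) ∧
      (∀ γ : ℝ[X], IsGammaExpansion H γ → γ = ∑ S ∈ stableMaxNested M 𝒢, X ^ des M S) ∧
      IsGammaPositive H := by
  set γ : ℝ[X] := ∑ S ∈ stableMaxNested M 𝒢, X ^ des M S with hγ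
  set n := rk M M.E - (maxElts 𝒢).card
  have hdes : ∀ S ∈ stableMaxNested M 𝒢, 2 * des M S ≤ n := fun S hS =>
    two_mul_des_le h𝒢 hc ((mem_stableMaxNested).1 hS)
  have hcoeff : ∀ i, γ.coeff i =
      (((stableMaxNested M 𝒢).filter fun S => i = des M S).card : ℝ) := by
    intro i
    simp [hγ, finsetSum_coeff, coeff_X_pow]
  have h0 : γ.coeff 0 ≠ 0 := by
    obtain ⟨S, hS, hS0⟩ := exists_stable_des_eq_zero h𝒢 hc
    rw [hcoeff, Nat.cast_ne_zero]
    exact Finset.card_ne_zero_of_mem (Finset.mem_filter.2 ⟨hS, hS0.symm⟩)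
  have hdeg := natDegree_gammaSum (n := n) h0
  have hγdeg : γ.natDegree ≤ n / 2 := by
    refine natDegree_sum_le_of_forall_le _ _ fun S hS => ?_
    have := hdes S hS
    exact (natDegree_X_pow_le _).trans (by omega)
  have hexp : IsGammaExpansion (gammaSum n γ) γ := by
    rw [IsGammaExpansion, hdeg]
    exact ⟨hγdeg, rfl⟩
  refine ⟨gammaSum n γ, ?_, hexp, ?_, ?_, γ, hexp, fun i => ?_⟩
  · rw [chowSeries_eq h𝒢, sum_nestedWeight h𝒢 hc, sum_eq_gammaSum _ _ hdes]
  · rintro δ ⟨hδ, heq⟩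
    rw [hdeg] at hδ heq
    exact eq_of_gammaSum_eq heq.symm hδ hγdeg
  · rw [hdeg]
    exact fun i hi => coeff_gammaSum_symm γ hi
  · rw [hcoeff]
    exact Nat.cast_nonneg _

end

end BuiltMatroid

end

theorem theorem1p1 {α : Type*} [LinearOrder α] (M : Matroid α) [M.Finite] [M.Loopless]
    (𝒢 : Finset (Set α)) (h𝒢 : BuiltMatroid.IsBuildingSet M 𝒢)
    (hcomplete : BuiltMatroid.IsComplete M 𝒢) :
    ∃ H : ℝ[X], (H : PowerSeries ℝ) = BuiltMatroid.chowSeries M 𝒢 ∧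
      BuiltMatroid.IsGammaExpansion H
        (∑ S ∈ BuiltMatroid.stableMaxNested M 𝒢, X ^ BuiltMatroid.des M S) ∧
      (∀ γ : ℝ[X], BuiltMatroid.IsGammaExpansion H γ →
        γ = ∑ S ∈ BuiltMatroid.stableMaxNested M 𝒢, X ^ BuiltMatroid.des M S) ∧
      BuiltMatroid.IsGammaPositive H :=
  BuiltMatroid.chowSeries_gammaExpansion h𝒢 hcomplete
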